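/- Let $m_1,m_2,m_3\ge 3$ and let $G$ be a group of type $\mathcal D_5$, i.e. a group with the presentation $$G=\langle x,y,t_1,t_2,t_3 \mid t_1^{2^{m_1}}=t_2^{2^{m_2}}=t_3^{2^{m_3}}=1,\ x^2=t_2,\ y^2=t_3,\ t_1,t_2,t_3\text{ central},\ (x,y)=t_1^{2^{m_1-1}}\rangle .$$ Let $\mathcal Z(G)$ be the centre of $G$ and $G'$ its commutator subgroup. For a field $K$ with $\operatorname{char}K\nmid |G|$ let $\zeta$ be a primitive $e$-th root of unity over $K$, $e$ the exponent of $G$. Two elements $g,h\in G$ lie in the same $K$-class if $h$ is conjugate to $g^r$ for some $r$ for which there is $\sigma\in\operatorname{Gal}(K(\zeta)/K)$ with $\sigma(\zeta)=\zeta^r$. For $w\in G$, the $K$-classes involving $w$ are those of the elements $aw$ with $a\in\mathcal Z(G)$. Let $N_1$ be the number of cyclic subgroups of $\mathcal Z(G)$, let $N_2,N_3,N_4$ be the numbers of $\mathbb Q$-classes involving $x$, $y$ and $xy$ respectively, let $N=N_1+N_2+N_3+N_4$, and let $N_0$ be the number of cyclic subgroups of $G/G'$. 1. $N$ is the total number of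 $\mathbb Q$-classes of $G$. Moreover, if for $a\ge b\ge c\ge 1$ we put $$f(a,b,c)=\tfrac73(4^c-1)+3\cdot 2^c(2^b-2^c)+(a-b)2^{b+c}+1$$ and extend $f$ symmetrically to all triples of positive integers (so that $f(a,b,c)$ is the number of cyclic subgroups of $C_{2^a}\times C_{2^b}\times C_{2^c}$), then, with $\alpha=f(m_1-1,m_2,m_3)$, $$N_1=f(m_1,m_2,m_3),\quad N_2=f(m_1-1,m_2+1,m_3)-\alpha,\quad N_3=f(m_1-1,m_2,m_3+1)-\alpha,$$ $$N_4=f(m_1-1,\max(m_2,m_3)+1,\min(m_2,m_3))-\alpha,\quad N_0=f(m_1-1,m_2+1,m_3+1).$$ Also $N_0\le N$ and $36\le 2N_0$. 2. $\mathbb QG$ is the direct sum of $N_0$ fields and $N-N_0$ quaternion algebras (over extension fields of $\mathbb Q$; they may be rings of $2\times2$ matrices). 3. Let $K$ be a finite field of odd order $q$. Then $KG$ is semisimple and has at least $2N-36$ simple components in its Wedderburn decomposition. If $q\equiv 3\pmod 8$, then it has exactly $2N-36$ simple components, and $KG$ is the direct sum of $2N_0-36$ fields and $2(N-N_0)$ rings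 of $2\times 2$ matrices over fields. -/

import Mathlib

universe u v w

open scoped commutatorElement

/-- Generators of the groups of type `D₅`. -/
inductive D5Gen : Type
  | x | y | t₁ | t₂ | t₃

/-- Defining relations of the group of type `D₅` with parameters `m₁, m₂, m₃`:
`t₁ ^ 2 ^ m₁ = t₂ ^ 2 ^ m₂ = t₃ ^ 2 ^ m₃ = 1`, `x ^ 2 = t₂`, `y ^ 2 = t₃`,
`(x, y) = t₁ ^ 2 ^ (m₁ - 1)`, and `t₁, t₂, t₃` are central. -/
def d5Rels (m₁ m₂ m₃ : ℕ) : Set (FreeGroup D5Gen) :=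
  { FreeGroup.of D5Gen.t₁ ^ 2 ^ m₁,
    FreeGroup.of D5Gen.t₂ ^ 2 ^ m₂,
    FreeGroup.of D5Gen.t₃ ^ 2 ^ m₃,
    FreeGroup.of D5Gen.x ^ 2 * (FreeGroup.of D5Gen.t₂)⁻¹,
    FreeGroup.of D5Gen.y ^ 2 * (FreeGroup.of D5Gen.t₃)⁻¹,
    ⁅FreeGroup.of D5Gen.x, FreeGroup.of D5Gen.y⁆ *
      (FreeGroup.of D5Gen.t₁ ^ 2 ^ (m₁ - 1))⁻¹ } ∪
  { r | ∃ t ∈ ({D5Gen.t₁, D5Gen.t₂, D5Gen.t₃} : Set D5Gen), ∃ g : D5Gen,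
      r = ⁅FreeGroup.of t, FreeGroup.of g⁆ }

/-- The group of type `D₅` with parameters `m₁, m₂, m₃`. -/
abbrev D5Group (m₁ m₂ m₃ : ℕ) : Type := PresentedGroup (d5Rels m₁ m₂ m₃)

/-- `K`-conjugacy in a finite group `G` of exponent `e` with `char K ∤ |G|`: the elements `g`
and `h` are `K`-conjugate if `h` is conjugate to `g ^ r` for some `r` such that an automorphism
`σ` of `K(ζ)` over `K`, with `ζ` a primitive `e`-th root of unity, has `σ ζ = ζ ^ r`. -/
def KConj (K : Type v) [Field K] {G : Type u} [Group G] (g h : G) : Prop :=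
  ∃ (σ : CyclotomicField (Monoid.exponent G) K ≃ₐ[K] CyclotomicField (Monoid.exponent G) K)
    (r : ℕ),
    (∃ ζ : CyclotomicField (Monoid.exponent G) K,
      IsPrimitiveRoot ζ (Monoid.exponent G) ∧ σ ζ = ζ ^ r) ∧ IsConj (g ^ r) h

/-- The `K`-class of `g`, as the set of all elements that are `K`-conjugate to `g`. -/
def kClass (K : Type v) [Field K] {G : Type u} [Group G] (g : G) : Set G :=
  { h | KConj K g h }

/-- The number of all `K`-classes of `G`. -/
noncomputable def numKClasses (K : Type v) [Field K] (G : Type u) [Group G] : ℕ :=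
  (Set.range (fun g : G => kClass K g)).ncard

/-- The number of `K`-classes involving `w`: those of the elements `a * w` with `a` central. -/
noncomputable def numKClassesInvolving (K : Type v) [Field K] {G : Type u} [Group G]
    (w : G) : ℕ :=
  ((fun a : G => kClass K (a * w)) '' (Subgroup.center G : Set G)).ncard

/-- The number of cyclic subgroups of `A`. -/
noncomputable def numCyclicSubgroups (A : Type u) [Group A] : ℕ :=
  Nat.card { H : Subgroup A // IsCyclic H }

/-- For `a ≥ b ≥ c ≥ 1` the number of cyclic subgroups of a direct product of cyclic groups of
orders `2 ^ a`, `2 ^ b`, `2 ^ c`. -/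
def cyclicCountSorted (a b c : ℕ) : ℚ :=
  7 / 3 * (4 ^ c - 1) + 3 * 2 ^ c * (2 ^ b - 2 ^ c) + ((a : ℚ) - b) * 2 ^ (b + c) + 1

/-- The same count, for exponents in any order: they are put in decreasing order first. -/
def cyclicCount (a b c : ℕ) : ℚ :=
  cyclicCountSorted (max a (max b c)) (max (min a b) (min (max a b) c)) (min a (min b c))

/-- The number of simple components of a semisimple ring, that is, of its minimal nonzero
two-sided ideals. -/
noncomputable def numSimpleComponents (A : Type u) [Ring A] : ℕ :=
  Nat.card { I : TwoSidedIdeal A // IsAtom I }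

/-- The `K`-algebra `A` is the direct sum of `r` fields and `s` quaternion algebras, each
quaternion algebra `⟨1, i, j, k⟩`, `i ^ 2 = a ≠ 0`, `j ^ 2 = b ≠ 0`, `k = i j = - j i`, being taken
over an extension field of `K`. (A quaternion algebra may be a ring of `2 × 2` matrices.)
It is meant for fields `K` of characteristic different from `2`. -/
def IsSumOfFieldsAndQuaternions (K : Type v) [Field K] (A : Type w) [Ring A] [Algebra K A]
    (r s : ℕ) : Prop :=
  ∃ (F : Fin r → Type v) (_ : ∀ i, Field (F i)) (_ : ∀ i, Algebra K (F i))
    (E : Fin s → Type v) (_ : ∀ j, Field (E j)) (_ : ∀ j, Algebra K (E j))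
    (a b : ∀ j, E j),
    (∀ j, a j ≠ 0 ∧ b j ≠ 0) ∧
    Nonempty (A ≃ₐ[K] (∀ i, F i) × (∀ j, QuaternionAlgebra (E j) (a j) 0 (b j)))

/-- The `K`-algebra `A` is the direct sum of `r` fields and `s` rings of `2 × 2` matrices over
extension fields of `K`. -/
def IsSumOfFieldsAndMatrixRings (K : Type v) [Field K] (A : Type w) [Ring A] [Algebra K A]
    (r s : ℕ) : Prop :=
  ∃ (F : Fin r → Type v) (_ : ∀ i, Field (F i)) (_ : ∀ i, Algebra K (F i))
    (E : Fin s → Type v) (_ : ∀ j, Field (E j)) (_ : ∀ j, Algebra K (E j)),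
    Nonempty (A ≃ₐ[K] (∀ i, F i) × (∀ j, Matrix (Fin 2) (Fin 2) (E j)))

/-! Let `s = t₁ ^ 2 ^ (m₁ - 1)`. It is a central involution and `G' = {1, s}`. The centre `Z` is a
product of cyclic groups of orders `2 ^ m₁`, `2 ^ m₂`, `2 ^ m₃`, and `A = G / G'` is one of orders
`2 ^ (m₁ - 1)`, `2 ^ (m₂ + 1)`, `2 ^ (m₃ + 1)`; a concrete model of the presented group proves both.

Classes. Over `ℚ` the exponents `r` are exactly the odd ones, so central elements are classified by
the cyclic subgroups of `Z`. A noncentral `g` has conjugacy class `{g, g * s}`, so its `ℚ`-class is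
determined by the cyclic subgroup generated by its image in `A`. The four cosets of `Z` correspond
to the parities of the last two coordinates in `A`, and odd powers keep parities. Hence `N₂`, `N₃`,
`N₄` count cyclic subgroups of `A` by parity. The even layer is `Z / ⟨s⟩` and has `α` of them,
whence `N - N₀ = N₁ - α`.

Algebras. In characteristic not two, `(1 + s) / 2` and `(1 - s) / 2` split `K[G]`. The first part is
`K[A]`, a sum of fields. On the second, `s = -1`, so `x` and `y` anticommute and have central
squares: over each residue field of `K[Z]` at a maximal ideal containing `s + 1` there is one
quaternion algebra (`TypeD5.nonempty_algEquiv`).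

It remains to count maximal ideals, which are the Galois orbits of characters (`charKer_eq_iff`).
Over `ℚ` these are cyclic subgroups of the dual group, which is isomorphic to the group: `N₀` for
`A`, and `N₁ - α` for characters of `Z` with `χ s = -1`. Over a field with `q` elements the Galois
exponents modulo `8` lie in `{1, q}`, a proper subgroup of the units, so a cyclic subgroup of order
divisible by `8` gives at least two orbits, and exactly two if `q ≡ 3` modulo `8` (`ncard_cls_aux`).
In `A` exactly `36` cyclic subgroups have order dividing `4`. For `Z`, `s` is a fourth power as `m₁
≥ 3`, so every character with `χ s = -1` has order divisible by `8`. Quaternion algebras over finite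
fields of odd order split, and the components can be counted. -/

open scoped Quaternion

/-! ### Counting cyclic subgroups through element orders. -/

/-- The number of cyclic subgroups that have a generator in `X`. -/
noncomputable def cycCount {A : Type*} [Group A] (X : Set A) : ℕ :=
  (Subgroup.zpowers '' X).ncard

theorem ncard_image_congr {α β γ : Type*} {f : α → β} {g : α → γ} {X : Set α}
    (h : ∀ a ∈ X, ∀ b ∈ X, f a = f b ↔ g a = g b) : (f '' X).ncard = (g '' X).ncard := by
  classical
  refine Set.ncard_congr' ?_
  have key : ∀ b : f '' X, ∃ a ∈ X, f a = b := fun b => b.2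
  choose r hrX hr using key
  refine Equiv.ofBijective (fun b => ⟨g (r b), r b, hrX b, rfl⟩) ⟨?_, ?_⟩
  · intro b c hbc
    have := (h _ (hrX b) _ (hrX c)).2 (congrArg Subtype.val hbc)
    exact Subtype.ext ((hr b).symm.trans (this.trans (hr c)))
  · rintro ⟨_, a, ha, rfl⟩
    refine ⟨⟨f a, a, ha, rfl⟩, Subtype.ext ?_⟩
    exact (h _ (hrX _) _ ha).1 (hr ⟨f a, a, ha, rfl⟩)

theorem cycCount_univ (A : Type*) [Group A] :
    cycCount (Set.univ : Set A) = numCyclicSubgroups A := by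
  have : Subgroup.zpowers '' (Set.univ : Set A) = {H : Subgroup A | IsCyclic H} := by
    ext H
    constructor
    · rintro ⟨a, -, rfl⟩
      exact inferInstanceAs (IsCyclic (Subgroup.zpowers a))
    · intro hH
      obtain ⟨a, ha⟩ := (Subgroup.isCyclic_iff_exists_zpowers_eq_top H).1 hH
      exact ⟨a, trivial, ha⟩
  rw [cycCount, this]
  rfl

theorem cycCount_image {A B : Type*} [Group A] [Group B] (f : A →* B)
    (hf : Function.Injective f) (X : Set A) : cycCount (f '' X) = cycCount X := by
  have : Subgroup.zpowers '' (f '' X) = Subgroup.map f '' (Subgroup.zpowers '' X) := by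
    simp only [Set.image_image, MonoidHom.map_zpowers]
  rw [cycCount, this, Set.ncard_image_of_injective _ (Subgroup.map_injective hf), cycCount]

theorem cycCount_range {A B : Type*} [Group A] [Group B] (f : A →* B)
    (hf : Function.Injective f) : cycCount (Set.range f) = numCyclicSubgroups A := by
  rw [← Set.image_univ, cycCount_image f hf, cycCount_univ]

theorem numCyclicSubgroups_congr {A B : Type*} [Group A] [Group B] (f : A ≃* B) :
    numCyclicSubgroups A = numCyclicSubgroups B := by
  rw [← cycCount_range f.toMonoidHom f.injective, ← cycCount_univ]
  congr
  exact f.surjective.range_eq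

theorem cycCount_union {A : Type*} [Group A] [Finite A] {X Y : Set A}
    (h : ∀ a ∈ X, ∀ b ∈ Y, Subgroup.zpowers a ≠ Subgroup.zpowers b) :
    cycCount (X ∪ Y) = cycCount X + cycCount Y := by
  rw [cycCount, Set.image_union, Set.ncard_union_eq]
  · rfl
  · rw [Set.disjoint_left]
    rintro _ ⟨a, ha, rfl⟩ ⟨b, hb, hab⟩
    exact h a ha b hb hab.symm

/-- A cyclic group of order `d` has `φ(d)` generators, so this is the size of each fibre of
`Subgroup.zpowers` over the subgroups of order `d`. -/
theorem ncard_orderOf_eq {A : Type*} [Group A] [Finite A] (d : ℕ) :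
    {a : A | orderOf a = d}.ncard = d.totient * cycCount {a : A | orderOf a = d} := by
  classical
  have := Fintype.ofFinite A
  rw [cycCount, Set.ncard_eq_toFinset_card', Set.ncard_eq_toFinset_card', Set.toFinset_image,
    mul_comm, Finset.card_eq_sum_card_image Subgroup.zpowers]
  refine Finset.sum_const_nat ?_
  intro C hC
  obtain ⟨a, ha, rfl⟩ := Finset.mem_image.1 hC
  have ha : orderOf a = d := by simpa using ha
  rw [← IsCyclic.card_orderOf_eq_totient (α := Subgroup.zpowers a) (d := d)
    (by rw [← Nat.card_eq_fintype_card, Nat.card_zpowers, ha])]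
  symm
  refine Finset.card_bij (fun g _ => (g : A)) ?_ (fun _ _ _ _ h => Subtype.ext h) ?_
  · intro g hg
    have hg : orderOf (g : A) = d := by simpa using hg
    simp only [Finset.mem_filter, Set.mem_toFinset, Set.mem_ofPred_eq]
    refine ⟨hg, ?_⟩
    refine Subgroup.eq_of_le_of_card_ge ((Subgroup.zpowers_le).2 g.2) ?_
    rw [Nat.card_zpowers, Nat.card_zpowers, ha, hg]
  · intro b hb
    simp only [Finset.mem_filter, Set.mem_toFinset, Set.mem_ofPred_eq] at hb
    refine ⟨⟨b, hb.2 ▸ Subgroup.mem_zpowers b⟩, ?_, rfl⟩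
    simpa using hb.1

/-- The elements added in passing from `k` to `k + 1` are those of order `2 ^ (k + 1)`, and `φ(2 ^
(k + 1)) = 2 ^ k`. -/
theorem cycCount_pow_two_succ {A : Type*} [Group A] [Finite A] (k : ℕ) :
    (cycCount {a : A | a ^ 2 ^ (k + 1) = 1} : ℚ) = cycCount {a : A | a ^ 2 ^ k = 1} +
      (({a : A | a ^ 2 ^ (k + 1) = 1}.ncard : ℚ) - {a : A | a ^ 2 ^ k = 1}.ncard) / 2 ^ k := by
  have hU : {a : A | a ^ 2 ^ (k + 1) = 1} =
      {a : A | a ^ 2 ^ k = 1} ∪ {a : A | orderOf a = 2 ^ (k + 1)} := by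
    ext a
    simp only [Set.mem_ofPred_eq, Set.mem_union]
    constructor
    · intro h
      by_cases h' : a ^ 2 ^ k = 1
      · exact Or.inl h'
      · exact Or.inr (orderOf_eq_prime_pow h' h)
    · rintro (h | h)
      · rw [pow_succ, pow_mul, h, one_pow]
      · rw [← h, pow_orderOf_eq_one]
  have hne : ∀ a ∈ {a : A | a ^ 2 ^ k = 1}, ∀ b ∈ {a : A | orderOf a = 2 ^ (k + 1)},
      orderOf a ≠ orderOf b := by
    intro a ha b hb hab
    rw [Set.mem_ofPred_eq] at ha hb
    have := orderOf_dvd_of_pow_eq_one ha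
    rw [hab, hb, Nat.pow_dvd_pow_iff_le_right (by norm_num)] at this
    omega
  have h1 := cycCount_union (X := {a : A | a ^ 2 ^ k = 1})
    (Y := {a : A | orderOf a = 2 ^ (k + 1)}) (fun a ha b hb h => hne a ha b hb (by
      rw [← Nat.card_zpowers, h, Nat.card_zpowers]))
  have h2 : ({a : A | a ^ 2 ^ k = 1} ∪ {a : A | orderOf a = 2 ^ (k + 1)}).ncard =
      {a : A | a ^ 2 ^ k = 1}.ncard + {a : A | orderOf a = 2 ^ (k + 1)}.ncard := by
    refine Set.ncard_union_eq ?_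
    rw [Set.disjoint_left]
    exact fun a ha hb => hne a ha a hb rfl
  rw [← hU] at h1 h2
  rw [h1, h2, ncard_orderOf_eq, Nat.totient_prime_pow_succ Nat.prime_two]
  push_cast
  field_simp
  ring

/-! ### Cyclic subgroups of a product of three cyclic 2-groups. -/

/-- The direct product of cyclic groups of orders `2 ^ a`, `2 ^ b`, `2 ^ c`. -/
abbrev TriCyclic (a b c : ℕ) : Type :=
  Multiplicative (ZMod (2 ^ a) × ZMod (2 ^ b) × ZMod (2 ^ c))

instance (a b c : ℕ) : Finite (TriCyclic a b c) :=
  inferInstanceAs (Finite (ZMod (2 ^ a) × ZMod (2 ^ b) × ZMod (2 ^ c)))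

theorem ZMod.card_two_pow_nsmul_eq_zero (a k : ℕ) :
    {u : ZMod (2 ^ a) | 2 ^ k • u = 0}.ncard = 2 ^ min k a := by
  have h : {u : ZMod (2 ^ a) | 2 ^ k • u = 0} =
      (AddMonoidHom.ker (nsmulAddMonoidHom (α := ZMod (2 ^ a)) (2 ^ k)) : Set _) := by
    ext; simp [AddMonoidHom.mem_ker]
  rw [h]
  have := IsAddCyclic.card_nsmulAddMonoidHom_ker (ZMod (2 ^ a)) (2 ^ k)
  rw [Nat.card_zmod] at this
  rw [← Nat.card_coe_set_eq]
  refine this.trans ?_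
  rcases le_total k a with h | h
  · rw [min_eq_left h]
    exact Nat.gcd_eq_right (Nat.pow_dvd_pow 2 h)
  · rw [min_eq_right h]
    exact Nat.gcd_eq_left (Nat.pow_dvd_pow 2 h)

theorem TriCyclic.ncard_pow_eq_one (a b c k : ℕ) :
    {u : TriCyclic a b c | u ^ 2 ^ k = 1}.ncard = 2 ^ (min k a + min k b + min k c) := by
  have h : {u : TriCyclic a b c | u ^ 2 ^ k = 1} = Multiplicative.ofAdd ''
      ({u : ZMod (2 ^ a) | 2 ^ k • u = 0} ×ˢ ({u : ZMod (2 ^ b) | 2 ^ k • u = 0} ×ˢ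
        {u : ZMod (2 ^ c) | 2 ^ k • u = 0})) := by
    rw [Equiv.image_eq_preimage_symm]
    ext u
    simp only [Set.mem_ofPred_eq, Set.mem_preimage, Set.mem_prod]
    rw [← Multiplicative.toAdd.injective.eq_iff, toAdd_pow, toAdd_one, Prod.ext_iff, Prod.ext_iff]
    rfl
  rw [h, Set.ncard_image_of_injective _ Multiplicative.ofAdd.injective, Set.ncard_prod,
    Set.ncard_prod]
  simp only [ZMod.card_two_pow_nsmul_eq_zero]
  rw [pow_add, pow_add, mul_assoc]

/-- Induction on `k` by `cycCount_pow_two_succ`. The increment has a different form for `k < c`, `c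
≤ k < b` and `b ≤ k < a`, which produces the three terms of the formula, and it vanishes from `a`
on. -/
theorem cycCount_torsion {A : Type*} [Group A] [Finite A] {a b c : ℕ} (hab : b ≤ a) (hbc : c ≤ b)
    (h : ∀ k, {u : A | u ^ 2 ^ k = 1}.ncard = 2 ^ (min k a + min k b + min k c)) (k : ℕ) :
    (cycCount {u : A | u ^ 2 ^ k = 1} : ℚ) =
      cyclicCountSorted (min k a) (min k b) (min k c) := by
  induction k with
  | zero =>
    have : {u : A | u ^ 2 ^ 0 = 1} = {1} := by ext; simp
    rw [this, cycCount, Set.image_singleton, Set.ncard_singleton]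
    simp [cyclicCountSorted]
  | succ k ih =>
    rw [cycCount_pow_two_succ, ih, h, h]
    rcases Nat.lt_or_ge k c with h1 | h1
    · rw [min_eq_left (by omega : k ≤ a), min_eq_left (by omega : k ≤ b),
        min_eq_left (by omega : k ≤ c), min_eq_left (by omega : k + 1 ≤ a),
        min_eq_left (by omega : k + 1 ≤ b), min_eq_left (by omega : k + 1 ≤ c)]
      have h4 : (4 : ℚ) ^ k = 2 ^ k * 2 ^ k := by rw [← mul_pow]; norm_num
      simp only [cyclicCountSorted, pow_succ, pow_add, h4]
      push_cast
      field_simp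
      ring
    rcases Nat.lt_or_ge k b with h2 | h2
    · rw [min_eq_left (by omega : k ≤ a), min_eq_left (by omega : k ≤ b),
        min_eq_right (by omega : c ≤ k), min_eq_left (by omega : k + 1 ≤ a),
        min_eq_left (by omega : k + 1 ≤ b), min_eq_right (by omega : c ≤ k + 1)]
      simp only [cyclicCountSorted, pow_succ, pow_add]
      push_cast
      field_simp
      ring
    rcases Nat.lt_or_ge k a with h3 | h3
    · rw [min_eq_left (by omega : k ≤ a), min_eq_right (by omega : b ≤ k),
        min_eq_right (by omega : c ≤ k), min_eq_left (by omega : k + 1 ≤ a),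
        min_eq_right (by omega : b ≤ k + 1), min_eq_right (by omega : c ≤ k + 1)]
      simp only [cyclicCountSorted, pow_succ, pow_add]
      push_cast
      field_simp
      ring
    · rw [min_eq_right (by omega : a ≤ k), min_eq_right (by omega : b ≤ k),
        min_eq_right (by omega : c ≤ k), min_eq_right (by omega : a ≤ k + 1),
        min_eq_right (by omega : b ≤ k + 1), min_eq_right (by omega : c ≤ k + 1)]
      simp

theorem TriCyclic.cycCount_torsion (a b c k : ℕ) :
    (cycCount {u : TriCyclic a b c | u ^ 2 ^ k = 1} : ℚ) =
      cyclicCountSorted (min k (max a (max b c))) (min k (max (min a b) (min (max a b) c)))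
        (min k (min a (min b c))) := by
  refine _root_.cycCount_torsion (by omega) (by omega) (fun k => ?_) k
  rw [TriCyclic.ncard_pow_eq_one]
  congr 1
  omega

theorem TriCyclic.numCyclicSubgroups_eq (a b c : ℕ) :
    (numCyclicSubgroups (TriCyclic a b c) : ℚ) = cyclicCount a b c := by
  have h := TriCyclic.cycCount_torsion a b c (max a (max b c))
  have hu : {u : TriCyclic a b c | u ^ 2 ^ max a (max b c) = 1} = Set.univ := by
    refine Set.eq_of_subset_of_ncard_le (Set.subset_univ _) ?_
    rw [TriCyclic.ncard_pow_eq_one, Set.ncard_univ]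
    simp only [TriCyclic, Nat.card_congr Multiplicative.toAdd, Nat.card_prod, Nat.card_zmod]
    rw [← pow_add, ← pow_add]
    exact Nat.pow_le_pow_right (by norm_num) (by omega)
  rw [hu, cycCount_univ] at h
  have h2 : min (max a (max b c)) (max (min a b) (min (max a b) c)) =
      max (min a b) (min (max a b) c) := by omega
  have h3 : min (max a (max b c)) (min a (min b c)) = min a (min b c) := by omega
  rw [h, cyclicCount, min_self, h2, h3]

/-- The 4-torsion is a product of three cyclic groups of order 4, and the formula gives `7 / 3 * 15
+ 1 = 36`. -/
theorem TriCyclic.cycCount_pow_four (a b c : ℕ) (ha : 2 ≤ a) (hb : 2 ≤ b) (hc : 2 ≤ c) :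
    cycCount {u : TriCyclic a b c | u ^ 4 = 1} = 36 := by
  have h := TriCyclic.cycCount_torsion a b c 2
  rw [min_eq_left (by omega), min_eq_left (by omega), min_eq_left (by omega)] at h
  norm_num [cyclicCountSorted] at h
  exact_mod_cast h

/-! ### Maps between cyclic 2-groups: doubling, the involution, reductions. -/

/-- The additive map `ℤ/N → ℤ/M` with `1 ↦ r`. -/
def ZMod.scale (N M r : ℕ) (h : M ∣ N * r) : ZMod N →+ ZMod M :=
  ZMod.lift N ⟨zmultiplesHom (ZMod M) (r : ZMod M), by
    rw [zmultiplesHom_apply, natCast_zsmul, nsmul_eq_mul, ← Nat.cast_mul]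
    exact (ZMod.natCast_eq_zero_iff _ _).2 h⟩

theorem ZMod.scale_intCast {N M r : ℕ} (h : M ∣ N * r) (k : ℤ) :
    ZMod.scale N M r h (k : ZMod N) = k * r := by
  simp [ZMod.scale]

theorem ZMod.scale_natCast {N M r : ℕ} (h : M ∣ N * r) (k : ℕ) :
    ZMod.scale N M r h (k : ZMod N) = k * r := by
  simpa using ZMod.scale_intCast h (k : ℤ)

theorem ZMod.scale_one {N M r : ℕ} (h : M ∣ N * r) : ZMod.scale N M r h 1 = r := by
  simpa using ZMod.scale_natCast h 1

theorem ZMod.scale_injective {N M r : ℕ} (hr : r ≠ 0) (h : M = N * r) :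
    Function.Injective (ZMod.scale N M r h.dvd) := by
  rw [injective_iff_map_eq_zero]
  intro a ha
  obtain ⟨k, rfl⟩ := ZMod.intCast_surjective a
  rw [ZMod.scale_intCast] at ha
  have h1 : ((k * r : ℤ) : ZMod M) = 0 := by push_cast; exact ha
  rw [ZMod.intCast_zmod_eq_zero_iff_dvd] at h1
  rw [ZMod.intCast_zmod_eq_zero_iff_dvd]
  subst h
  push_cast at h1
  exact Int.dvd_of_mul_dvd_mul_right (by exact_mod_cast hr) h1

/-- Doubling, `ℤ/2ⁿ → ℤ/2ⁿ⁺¹`. -/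
def ZMod.dbl (n : ℕ) : ZMod (2 ^ n) →+ ZMod (2 ^ (n + 1)) :=
  ZMod.scale (2 ^ n) (2 ^ (n + 1)) 2 (pow_succ 2 n).dvd

/-- The embedding of `ℤ/2` into `ℤ/2ⁿ⁺¹`. -/
def ZMod.top (n : ℕ) : ZMod 2 →+ ZMod (2 ^ (n + 1)) :=
  ZMod.scale 2 (2 ^ (n + 1)) (2 ^ n) (pow_succ' 2 n).dvd

/-- Reduction modulo `2`. -/
def ZMod.par (n : ℕ) : ZMod (2 ^ (n + 1)) →+* ZMod 2 :=
  ZMod.castHom (dvd_pow_self 2 n.succ_ne_zero) (ZMod 2)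

/-- Reduction modulo `2ⁿ`. -/
def ZMod.red (n : ℕ) : ZMod (2 ^ (n + 1)) →+* ZMod (2 ^ n) :=
  ZMod.castHom (pow_dvd_pow 2 n.le_succ) (ZMod (2 ^ n))

theorem ZMod.dbl_injective (n : ℕ) : Function.Injective (ZMod.dbl n) :=
  ZMod.scale_injective two_ne_zero (pow_succ 2 n)

theorem ZMod.top_injective (n : ℕ) : Function.Injective (ZMod.top n) :=
  ZMod.scale_injective (by positivity) (pow_succ' 2 n)

theorem ZMod.dbl_one (n : ℕ) : ZMod.dbl n 1 = 2 := by
  rw [ZMod.dbl, ZMod.scale_one, Nat.cast_ofNat]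

theorem ZMod.top_one (n : ℕ) : ZMod.top n 1 = 2 ^ n := by
  rw [ZMod.top, ZMod.scale_one, Nat.cast_pow, Nat.cast_ofNat]

theorem ZMod.par_eq_zero_iff (n : ℕ) (a : ZMod (2 ^ (n + 1))) :
    ZMod.par n a = 0 ↔ ∃ b, ZMod.dbl n b = a := by
  constructor
  · intro h
    obtain ⟨k, rfl⟩ := ZMod.intCast_surjective a
    rw [map_intCast, ZMod.intCast_zmod_eq_zero_iff_dvd] at h
    obtain ⟨l, rfl⟩ := h
    refine ⟨l, ?_⟩
    rw [ZMod.dbl, ZMod.scale_intCast]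
    push_cast
    ring
  · rintro ⟨b, rfl⟩
    obtain ⟨k, rfl⟩ := ZMod.intCast_surjective b
    rw [ZMod.dbl, ZMod.scale_intCast, map_mul, map_natCast]
    have : ((2 : ℕ) : ZMod 2) = 0 := by decide
    rw [this, mul_zero]

theorem ZMod.par_dbl (n : ℕ) (a : ZMod (2 ^ n)) : ZMod.par n (ZMod.dbl n a) = 0 :=
  (ZMod.par_eq_zero_iff n _).2 ⟨a, rfl⟩

theorem ZMod.red_eq_zero_iff (n : ℕ) (a : ZMod (2 ^ (n + 1))) :
    ZMod.red n a = 0 ↔ ∃ b, ZMod.top n b = a := by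
  constructor
  · intro h
    obtain ⟨k, rfl⟩ := ZMod.intCast_surjective a
    rw [map_intCast, ZMod.intCast_zmod_eq_zero_iff_dvd] at h
    obtain ⟨l, rfl⟩ := h
    refine ⟨l, ?_⟩
    rw [ZMod.top, ZMod.scale_intCast]
    push_cast
    ring
  · rintro ⟨b, rfl⟩
    obtain ⟨k, rfl⟩ := ZMod.intCast_surjective b
    rw [ZMod.top, ZMod.scale_intCast, map_mul, map_natCast, ZMod.natCast_self, mul_zero]

theorem ZMod.red_surjective (n : ℕ) : Function.Surjective (ZMod.red n) :=
  ZMod.castHom_surjective _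

theorem ZMod.two_cases (a : ZMod 2) : a = 0 ∨ a = 1 := by
  revert a; decide

/-! ### A concrete model, its centre and its abelianization. -/

/-- A concrete model of the groups of type `D₅`: the triple `(a, i, j)` stands for
`t₁ ^ a * x ^ i * y ^ j`. -/
@[ext] structure D5Model (n m₂ m₃ : ℕ) where
  a : ZMod (2 ^ (n + 1))
  i : ZMod (2 ^ (m₂ + 1))
  j : ZMod (2 ^ (m₃ + 1))

namespace D5Model

variable {n m₂ m₃ : ℕ}

/-- The commutator pairing. -/
def twist (n : ℕ) {m₂ m₃ : ℕ} (j : ZMod (2 ^ (m₃ + 1))) (i : ZMod (2 ^ (m₂ + 1))) :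
    ZMod (2 ^ (n + 1)) := ZMod.top n (ZMod.par m₃ j * ZMod.par m₂ i)

/-- Moving `y ^ j` past `x ^ i` costs the central factor `s ^ (i * j)`, which depends only on
parities because `s` has order 2. The twist is biadditive, hence a cocycle, and this gives
associativity. -/
instance : Mul (D5Model n m₂ m₃) := ⟨fun g h => ⟨g.a + h.a + twist n g.j h.i, g.i + h.i, g.j + h.j⟩⟩
instance : One (D5Model n m₂ m₃) := ⟨⟨0, 0, 0⟩⟩
instance : Inv (D5Model n m₂ m₃) := ⟨fun g => ⟨-g.a + twist n g.j g.i, -g.i, -g.j⟩⟩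

@[simp] theorem mul_a (g h : D5Model n m₂ m₃) : (g * h).a = g.a + h.a + twist n g.j h.i := rfl
@[simp] theorem mul_i (g h : D5Model n m₂ m₃) : (g * h).i = g.i + h.i := rfl
@[simp] theorem mul_j (g h : D5Model n m₂ m₃) : (g * h).j = g.j + h.j := rfl
@[simp] theorem one_a : (1 : D5Model n m₂ m₃).a = 0 := rfl
@[simp] theorem one_i : (1 : D5Model n m₂ m₃).i = 0 := rfl
@[simp] theorem one_j : (1 : D5Model n m₂ m₃).j = 0 := rfl
@[simp] theorem inv_a (g : D5Model n m₂ m₃) : g⁻¹.a = -g.a + twist n g.j g.i := rfl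
@[simp] theorem inv_i (g : D5Model n m₂ m₃) : g⁻¹.i = -g.i := rfl
@[simp] theorem inv_j (g : D5Model n m₂ m₃) : g⁻¹.j = -g.j := rfl

instance : Group (D5Model n m₂ m₃) := Group.ofLeftAxioms
  (fun a b c => by
    ext <;> simp only [mul_a, mul_i, mul_j, twist, map_add, mul_add, add_mul] <;> abel)
  (fun a => by ext <;> simp [twist])
  (fun a => by
    have h : twist n a.j a.i + twist n a.j a.i = 0 := by
      rw [twist, ← map_add, CharTwo.add_self_eq_zero, map_zero]
    ext <;> simp
    rw [twist, twist] at *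
    simpa using h)

/-- The inclusion of the centre. -/
def ι : TriCyclic (n + 1) m₂ m₃ →* D5Model n m₂ m₃ where
  toFun z := ⟨z.toAdd.1, ZMod.dbl _ z.toAdd.2.1, ZMod.dbl _ z.toAdd.2.2⟩
  map_one' := by ext <;> simp
  map_mul' z w := by ext <;> simp [twist, ZMod.par_dbl]

/-- The abelianization map. -/
def π : D5Model n m₂ m₃ →* TriCyclic n (m₂ + 1) (m₃ + 1) where
  toFun g := Multiplicative.ofAdd (ZMod.red n g.a, g.i, g.j)
  map_one' := by simp
  map_mul' g h := by
    have : ZMod.red n (twist n g.j h.i) = 0 := (ZMod.red_eq_zero_iff n _).2 ⟨_, rfl⟩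
    rw [← ofAdd_add]
    simp [this]

theorem ι_injective : Function.Injective (ι : TriCyclic (n + 1) m₂ m₃ →* D5Model n m₂ m₃) := by
  intro z w h
  refine Multiplicative.toAdd.injective (Prod.ext ?_ (Prod.ext ?_ ?_))
  · exact congrArg D5Model.a h
  · exact ZMod.dbl_injective _ (congrArg D5Model.i h)
  · exact ZMod.dbl_injective _ (congrArg D5Model.j h)

theorem range_ι : (ι : TriCyclic (n + 1) m₂ m₃ →* D5Model n m₂ m₃).range =
    Subgroup.center (D5Model n m₂ m₃) := by
  ext g
  rw [Subgroup.mem_center_iff]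
  constructor
  · rintro ⟨z, rfl⟩ h
    ext <;> simp [ι, twist, ZMod.par_dbl, add_comm]
  · intro h
    -- Commuting with `x` forces an even exponent of `y`, and commuting with `y` an even exponent of
    -- `x`.
    have h1 := congrArg D5Model.a (h ⟨0, 1, 0⟩)
    have h2 := congrArg D5Model.a (h ⟨0, 0, 1⟩)
    simp only [mul_a, twist, map_zero, map_one, zero_mul, mul_zero, one_mul, mul_one, zero_add,
      add_zero] at h1 h2
    have h1 : ZMod.par m₃ g.j = 0 := ZMod.top_injective n (by
      rw [map_zero]
      exact left_eq_add.1 h1)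
    have h2 : ZMod.par m₂ g.i = 0 := ZMod.top_injective n (by
      rw [map_zero]
      exact add_eq_left.1 h2)
    obtain ⟨b, hb⟩ := (ZMod.par_eq_zero_iff _ _).1 h1
    obtain ⟨c, hc⟩ := (ZMod.par_eq_zero_iff _ _).1 h2
    refine ⟨Multiplicative.ofAdd (g.a, c, b), ?_⟩
    ext
    · rfl
    · exact hc
    · exact hb

theorem π_surjective :
    Function.Surjective (π : D5Model n m₂ m₃ →* TriCyclic n (m₂ + 1) (m₃ + 1)) := by
  intro w
  obtain ⟨a, ha⟩ := ZMod.red_surjective n w.toAdd.1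
  exact ⟨⟨a, w.toAdd.2.1, w.toAdd.2.2⟩, Multiplicative.toAdd.injective (Prod.ext ha rfl)⟩

end D5Model

/-- The central involution of a group of type `D₅`. -/
def TriCyclic.invol (n b c : ℕ) : TriCyclic (n + 1) b c := Multiplicative.ofAdd (2 ^ n, 0, 0)

/-- The map that the abelianization of a group of type `D₅` induces on the centre. -/
def TriCyclic.centerToAb (n b c : ℕ) : TriCyclic (n + 1) b c →* TriCyclic n (b + 1) (c + 1) :=
  AddMonoidHom.toMultiplicative ((ZMod.red n).toAddMonoidHom.prodMap
    ((ZMod.dbl b).prodMap (ZMod.dbl c)))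

/-- The structure of a group of type `D₅`: generators `x`, `y`, the inclusion `ι` of the centre,
and the abelianization map `π`. -/
structure TypeD5 (n m₂ m₃ : ℕ) (G : Type*) [Group G] where
  x : G
  y : G
  ι : TriCyclic (n + 1) m₂ m₃ →* G
  π : G →* TriCyclic n (m₂ + 1) (m₃ + 1)
  ι_injective : Function.Injective ι
  range_ι : ι.range = Subgroup.center G
  π_surjective : Function.Surjective π
  ker_π : π.ker = commutator G
  eq_of_π_eq_one : ∀ g, π g = 1 → g = 1 ∨ g = ι (TriCyclic.invol n m₂ m₃)
  π_ι : ∀ z, π (ι z) = TriCyclic.centerToAb n m₂ m₃ z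
  π_x : π x = Multiplicative.ofAdd (0, 1, 0)
  π_y : π y = Multiplicative.ofAdd (0, 0, 1)
  x_mul_x : x * x = ι (Multiplicative.ofAdd (0, 1, 0))
  y_mul_y : y * y = ι (Multiplicative.ofAdd (0, 0, 1))
  y_mul_x : y * x = ι (TriCyclic.invol n m₂ m₃) * (x * y)
  exists_rep : ∀ g, ∃ z, g = ι z ∨ g = ι z * x ∨ g = ι z * y ∨ g = ι z * (x * y)

namespace D5Model

variable {n m₂ m₃ : ℕ}

theorem eq_of_π_eq_one (g : D5Model n m₂ m₃) (h : π g = 1) :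
    g = 1 ∨ g = ι (TriCyclic.invol n m₂ m₃) := by
  have h1 : ZMod.red n g.a = 0 := congrArg (fun w => (Multiplicative.toAdd w).1) h
  have h2 : g.i = 0 := congrArg (fun w => (Multiplicative.toAdd w).2.1) h
  have h3 : g.j = 0 := congrArg (fun w => (Multiplicative.toAdd w).2.2) h
  obtain ⟨b, hb⟩ := (ZMod.red_eq_zero_iff n _).1 h1
  rcases ZMod.two_cases b with rfl | rfl
  · left
    ext
    · rw [← hb, map_zero]; rfl
    · exact h2
    · exact h3
  · right
    ext
    · rw [← hb, ZMod.top_one]; rfl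
    · rw [h2]; exact (map_zero _).symm
    · rw [h3]; exact (map_zero _).symm

theorem y_mul_x : (⟨0, 0, 1⟩ * ⟨0, 1, 0⟩ : D5Model n m₂ m₃) =
    ι (TriCyclic.invol n m₂ m₃) * (⟨0, 1, 0⟩ * ⟨0, 0, 1⟩) := by
  ext <;> simp [ι, TriCyclic.invol, twist, ZMod.top_one]

theorem π_ι (z : TriCyclic (n + 1) m₂ m₃) :
    π (ι z) = TriCyclic.centerToAb n m₂ m₃ z := rfl

theorem exists_rep (g : D5Model n m₂ m₃) : ∃ z, g = ι z ∨ g = ι z * ⟨0, 1, 0⟩ ∨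
    g = ι z * ⟨0, 0, 1⟩ ∨ g = ι z * (⟨0, 1, 0⟩ * ⟨0, 0, 1⟩) := by
  have key : ∀ (m : ℕ) (i : ZMod (2 ^ (m + 1))), ∃ b, ZMod.dbl m b = i ∨ ZMod.dbl m b + 1 = i := by
    intro m i
    rcases ZMod.two_cases (ZMod.par m i) with h | h
    · obtain ⟨b, hb⟩ := (ZMod.par_eq_zero_iff _ _).1 h
      exact ⟨b, Or.inl hb⟩
    · have h : ZMod.par m (i - 1) = 0 := by rw [map_sub, h, map_one, sub_self]
      obtain ⟨b, hb⟩ := (ZMod.par_eq_zero_iff _ _).1 h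
      exact ⟨b, Or.inr (by rw [hb, sub_add_cancel])⟩
  obtain ⟨b, hb⟩ := key _ g.i
  obtain ⟨c, hc⟩ := key _ g.j
  refine ⟨Multiplicative.ofAdd (g.a, b, c), ?_⟩
  rcases hb with hb | hb <;> rcases hc with hc | hc
  · left
    ext <;> simp [ι, ← hb, ← hc]
  · right; right; left
    ext <;> simp [ι, ← hb, ← hc, twist, ZMod.par_dbl]
  · right; left
    ext <;> simp [ι, ← hb, ← hc, twist, ZMod.par_dbl]
  · right; right; right
    ext <;> simp [ι, ← hb, ← hc, twist, ZMod.par_dbl]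

/-- The only nontrivial element of the kernel is the central involution, and it is the commutator of
`y` and `x`. -/
theorem ker_π : (π : D5Model n m₂ m₃ →* _).ker = commutator (D5Model n m₂ m₃) := by
  refine le_antisymm ?_ (Abelianization.commutator_subset_ker _)
  intro g hg
  rcases eq_of_π_eq_one g hg with rfl | rfl
  · exact one_mem _
  · have h := eq_mul_inv_of_mul_eq (y_mul_x (n := n) (m₂ := m₂) (m₃ := m₃)).symm
    rw [h, mul_inv_rev, ← mul_assoc, ← commutatorElement_def]
    have := Subgroup.commutator_mem_commutator (H₁ := ⊤) (H₂ := ⊤)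
      (Subgroup.mem_top (⟨0, 0, 1⟩ : D5Model n m₂ m₃))
      (Subgroup.mem_top (⟨0, 1, 0⟩ : D5Model n m₂ m₃))
    rw [commutatorElement_def] at this
    rw [commutator_def]
    convert this using 1
    group

/-- The model is a group of type `D₅`. -/
def typeD5 : TypeD5 n m₂ m₃ (D5Model n m₂ m₃) where
  x := ⟨0, 1, 0⟩
  y := ⟨0, 0, 1⟩
  ι := ι
  π := π
  ι_injective := ι_injective
  range_ι := range_ι
  π_surjective := π_surjective
  ker_π := ker_π
  eq_of_π_eq_one := eq_of_π_eq_one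
  π_ι := π_ι
  π_x := by simp [π]
  π_y := by simp [π]
  x_mul_x := by ext <;> simp [ι, twist, ZMod.dbl_one, one_add_one_eq_two]
  y_mul_y := by ext <;> simp [ι, twist, ZMod.dbl_one, one_add_one_eq_two]
  y_mul_x := y_mul_x
  exists_rep := exists_rep

end D5Model

/-- Transport of the structure along an isomorphism. -/
def TypeD5.map {n m₂ m₃ : ℕ} {G H : Type*} [Group G] [Group H] (d : TypeD5 n m₂ m₃ G)
    (f : G ≃* H) : TypeD5 n m₂ m₃ H where
  x := f d.x
  y := f d.y
  ι := f.toMonoidHom.comp d.ι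
  π := d.π.comp f.symm.toMonoidHom
  ι_injective := f.injective.comp d.ι_injective
  range_ι := by
    ext h
    obtain ⟨g, rfl⟩ := f.surjective h
    have : f g ∈ Subgroup.center H ↔ g ∈ Subgroup.center G := by
      simp only [Subgroup.mem_center_iff, f.surjective.forall, ← map_mul, f.injective.eq_iff]
    rw [this, ← d.range_ι]
    simp [MonoidHom.mem_range]
  π_surjective := d.π_surjective.comp f.symm.surjective
  ker_π := by
    have : commutator H = (commutator G).map f.toMonoidHom := by
      rw [commutator_def, commutator_def, Subgroup.map_commutator,
        Subgroup.map_top_of_surjective _ f.surjective]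
    rw [this, ← d.ker_π]
    ext h
    obtain ⟨g, rfl⟩ := f.surjective h
    simp [MonoidHom.mem_ker]
  eq_of_π_eq_one h hh := by
    obtain ⟨g, rfl⟩ := f.surjective h
    have := d.eq_of_π_eq_one g (by simpa using hh)
    rcases this with rfl | rfl
    · exact Or.inl (map_one f)
    · exact Or.inr rfl
  π_ι z := by simpa using d.π_ι z
  π_x := by simpa using d.π_x
  π_y := by simpa using d.π_y
  x_mul_x := by rw [← map_mul, d.x_mul_x]; rfl
  y_mul_y := by rw [← map_mul, d.y_mul_y]; rfl
  y_mul_x := by rw [← map_mul, d.y_mul_x, map_mul, map_mul]; rfl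
  exists_rep h := by
    obtain ⟨g, rfl⟩ := f.surjective h
    obtain ⟨z, hz⟩ := d.exists_rep g
    refine ⟨z, ?_⟩
    rcases hz with hz | hz | hz | hz
    · exact Or.inl (congrArg f hz)
    · exact Or.inr (Or.inl (by rw [hz, map_mul]; rfl))
    · exact Or.inr (Or.inr (Or.inl (by rw [hz, map_mul]; rfl)))
    · exact Or.inr (Or.inr (Or.inr (by rw [hz, map_mul, map_mul]; rfl)))

/-! ### The presented group is isomorphic to the model. -/

/-- The universal property of the groups of type `D₅`. -/
theorem exists_d5Group_hom {U : Type*} [Group U] (n m₂ m₃ : ℕ) (X Y T : U)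
    (hX : X ^ 2 ^ (m₂ + 1) = 1) (hY : Y ^ 2 ^ (m₃ + 1) = 1) (hT : T ^ 2 ^ (n + 1) = 1)
    (hTX : Commute T X) (hTY : Commute T Y) (hXY : Commute (X ^ 2) Y) (hYX : Commute (Y ^ 2) X)
    (hc : ⁅X, Y⁆ = T ^ 2 ^ n) :
    ∃ f : D5Group (n + 1) m₂ m₃ →* U, f (PresentedGroup.of D5Gen.x) = X ∧
      f (PresentedGroup.of D5Gen.y) = Y ∧ f (PresentedGroup.of D5Gen.t₁) = T := by
  let g : D5Gen → U := fun
    | .x => X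
    | .y => Y
    | .t₁ => T
    | .t₂ => X ^ 2
    | .t₃ => Y ^ 2
  have hrel : ∀ r ∈ d5Rels (n + 1) m₂ m₃, FreeGroup.lift g r = 1 := by
    intro r hr
    rcases hr with hr | ⟨t, ht, s, rfl⟩
    · simp only [Set.mem_insert_iff, Set.mem_singleton_iff] at hr
      rcases hr with rfl | rfl | rfl | rfl | rfl | rfl
      · simpa [g] using hT
      · simpa [g, ← pow_mul, ← pow_succ'] using hX
      · simpa [g, ← pow_mul, ← pow_succ'] using hY
      · simp [g]
      · simp [g]
      · simp [g, map_commutatorElement, hc]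
    · rw [map_commutatorElement, FreeGroup.lift_apply_of, FreeGroup.lift_apply_of,
        commutatorElement_eq_one_iff_commute]
      simp only [Set.mem_insert_iff, Set.mem_singleton_iff] at ht
      rcases ht with rfl | rfl | rfl <;> cases s
      · exact hTX
      · exact hTY
      · exact Commute.refl _
      · exact hTX.pow_right 2
      · exact hTY.pow_right 2
      · exact (Commute.refl X).pow_left 2
      · exact hXY
      · exact (hTX.pow_right 2).symm
      · exact Commute.refl _
      · exact hXY.pow_right 2
      · exact hYX
      · exact (Commute.refl Y).pow_left 2
      · exact (hTY.pow_right 2).symm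
      · exact hYX.pow_right 2
      · exact Commute.refl _
  exact ⟨PresentedGroup.toGroup hrel, PresentedGroup.toGroup.of hrel,
    PresentedGroup.toGroup.of hrel, PresentedGroup.toGroup.of hrel⟩

namespace D5Group

variable (n m₂ m₃ : ℕ)

/-- The image of a generator. -/
abbrev gen (g : D5Gen) : D5Group (n + 1) m₂ m₃ := PresentedGroup.of g

theorem rel {r : FreeGroup D5Gen} (hr : r ∈ d5Rels (n + 1) m₂ m₃) :
    PresentedGroup.mk (d5Rels (n + 1) m₂ m₃) r = 1 :=
  PresentedGroup.one_of_mem hr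

theorem t₁_pow : gen n m₂ m₃ .t₁ ^ 2 ^ (n + 1) = 1 :=
  rel n m₂ m₃ (Or.inl (by simp))

theorem x_sq : gen n m₂ m₃ .x ^ 2 = gen n m₂ m₃ .t₂ :=
  mul_inv_eq_one.1 (rel n m₂ m₃ (r := FreeGroup.of D5Gen.x ^ 2 * (FreeGroup.of D5Gen.t₂)⁻¹)
    (Or.inl (by simp)))

theorem y_sq : gen n m₂ m₃ .y ^ 2 = gen n m₂ m₃ .t₃ :=
  mul_inv_eq_one.1 (rel n m₂ m₃ (r := FreeGroup.of D5Gen.y ^ 2 * (FreeGroup.of D5Gen.t₃)⁻¹)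
    (Or.inl (by simp)))

theorem x_pow : gen n m₂ m₃ .x ^ 2 ^ (m₂ + 1) = 1 := by
  rw [pow_succ', pow_mul, x_sq]
  exact rel n m₂ m₃ (r := FreeGroup.of D5Gen.t₂ ^ 2 ^ m₂) (Or.inl (by simp))

theorem y_pow : gen n m₂ m₃ .y ^ 2 ^ (m₃ + 1) = 1 := by
  rw [pow_succ', pow_mul, y_sq]
  exact rel n m₂ m₃ (r := FreeGroup.of D5Gen.t₃ ^ 2 ^ m₃) (Or.inl (by simp))

theorem commutator_xy : ⁅gen n m₂ m₃ .x, gen n m₂ m₃ .y⁆ = gen n m₂ m₃ .t₁ ^ 2 ^ n :=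
  mul_inv_eq_one.1 (rel n m₂ m₃ (r := ⁅FreeGroup.of D5Gen.x, FreeGroup.of D5Gen.y⁆ *
      (FreeGroup.of D5Gen.t₁ ^ 2 ^ (n + 1 - 1))⁻¹) (Or.inl (by simp)))

theorem t₁_commute (g : D5Gen) : Commute (gen n m₂ m₃ .t₁) (gen n m₂ m₃ g) :=
  commutatorElement_eq_one_iff_commute.1
    (rel n m₂ m₃ (r := ⁅FreeGroup.of D5Gen.t₁, FreeGroup.of g⁆)
      (Or.inr ⟨D5Gen.t₁, by simp, g, rfl⟩))

/-- Each interchange of `y` and `x` contributes `t₁ ^ 2 ^ n`, an element of square one, so the order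
of the entries in the commutator does not matter. -/
theorem y_mul_x_pow (i : ℕ) : gen n m₂ m₃ .y * gen n m₂ m₃ .x ^ i =
    gen n m₂ m₃ .t₁ ^ (2 ^ n * i) * gen n m₂ m₃ .x ^ i * gen n m₂ m₃ .y := by
  have hs : gen n m₂ m₃ .y * gen n m₂ m₃ .x =
      gen n m₂ m₃ .t₁ ^ 2 ^ n * gen n m₂ m₃ .x * gen n m₂ m₃ .y := by
    have h1 := commutator_xy n m₂ m₃
    have h2 : gen n m₂ m₃ .t₁ ^ 2 ^ n * gen n m₂ m₃ .t₁ ^ 2 ^ n = 1 := by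
      rw [← pow_add, ← two_mul, ← pow_succ', t₁_pow]
    rw [commutatorElement_def, mul_inv_eq_iff_eq_mul, mul_inv_eq_iff_eq_mul] at h1
    rw [mul_assoc, h1]
    simp only [← mul_assoc]
    rw [h2, one_mul]
  induction i with
  | zero => simp
  | succ i ih =>
    have hc := ((t₁_commute n m₂ m₃ .x).pow_pow (2 ^ n) i).eq
    rw [pow_succ, ← mul_assoc, ih, mul_assoc _ (gen n m₂ m₃ .y), hs, mul_add, pow_add, mul_one]
    simp only [mul_assoc]
    rw [← mul_assoc (gen n m₂ m₃ .x ^ i) (gen n m₂ m₃ .t₁ ^ 2 ^ n), ← hc]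
    simp only [mul_assoc]

/-- The normal forms are closed under left multiplication by every generator. Inverses need no
separate treatment: each generator has finite order, so its inverse is a power of it. -/
theorem exists_normal_form (g : D5Group (n + 1) m₂ m₃) : ∃ a i j : ℕ,
    g = gen n m₂ m₃ .t₁ ^ a * gen n m₂ m₃ .x ^ i * gen n m₂ m₃ .y ^ j := by
  have hx : ∀ g : D5Group (n + 1) m₂ m₃, (∃ a i j : ℕ,
      g = gen n m₂ m₃ .t₁ ^ a * gen n m₂ m₃ .x ^ i * gen n m₂ m₃ .y ^ j) → ∃ a i j : ℕ,
      gen n m₂ m₃ .x * g = gen n m₂ m₃ .t₁ ^ a * gen n m₂ m₃ .x ^ i * gen n m₂ m₃ .y ^ j := by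
    rintro _ ⟨a, i, j, rfl⟩
    refine ⟨a, i + 1, j, ?_⟩
    rw [pow_succ', ← mul_assoc, ← mul_assoc, ← mul_assoc,
      ((t₁_commute n m₂ m₃ .x).pow_left a).eq]
  have hy : ∀ g : D5Group (n + 1) m₂ m₃, (∃ a i j : ℕ,
      g = gen n m₂ m₃ .t₁ ^ a * gen n m₂ m₃ .x ^ i * gen n m₂ m₃ .y ^ j) → ∃ a i j : ℕ,
      gen n m₂ m₃ .y * g = gen n m₂ m₃ .t₁ ^ a * gen n m₂ m₃ .x ^ i * gen n m₂ m₃ .y ^ j := by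
    rintro _ ⟨a, i, j, rfl⟩
    refine ⟨a + 2 ^ n * i, i, j + 1, ?_⟩
    rw [pow_succ', ← mul_assoc, ← mul_assoc, ← ((t₁_commute n m₂ m₃ .y).pow_left a).eq,
      mul_assoc _ _ (gen n m₂ m₃ .x ^ i), y_mul_x_pow, pow_add]
    simp only [mul_assoc]
  have ht : ∀ g : D5Group (n + 1) m₂ m₃, (∃ a i j : ℕ,
      g = gen n m₂ m₃ .t₁ ^ a * gen n m₂ m₃ .x ^ i * gen n m₂ m₃ .y ^ j) → ∃ a i j : ℕ,
      gen n m₂ m₃ .t₁ * g = gen n m₂ m₃ .t₁ ^ a * gen n m₂ m₃ .x ^ i * gen n m₂ m₃ .y ^ j := by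
    rintro _ ⟨a, i, j, rfl⟩
    refine ⟨a + 1, i, j, ?_⟩
    rw [pow_succ', ← mul_assoc, ← mul_assoc]
  have hgen : ∀ (s : D5Gen) (g : D5Group (n + 1) m₂ m₃), (∃ a i j : ℕ,
      g = gen n m₂ m₃ .t₁ ^ a * gen n m₂ m₃ .x ^ i * gen n m₂ m₃ .y ^ j) → ∃ a i j : ℕ,
      gen n m₂ m₃ s * g =
        gen n m₂ m₃ .t₁ ^ a * gen n m₂ m₃ .x ^ i * gen n m₂ m₃ .y ^ j := by
    intro s g hg
    cases s with
    | x => exact hx g hg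
    | y => exact hy g hg
    | t₁ => exact ht g hg
    | t₂ => rw [← x_sq, pow_two, mul_assoc]; exact hx _ (hx _ hg)
    | t₃ => rw [← y_sq, pow_two, mul_assoc]; exact hy _ (hy _ hg)
  have hpow : ∀ (s : D5Gen) (k : ℕ) (g : D5Group (n + 1) m₂ m₃), (∃ a i j : ℕ,
      g = gen n m₂ m₃ .t₁ ^ a * gen n m₂ m₃ .x ^ i * gen n m₂ m₃ .y ^ j) → ∃ a i j : ℕ,
      gen n m₂ m₃ s ^ k * g =
        gen n m₂ m₃ .t₁ ^ a * gen n m₂ m₃ .x ^ i * gen n m₂ m₃ .y ^ j := by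
    intro s k
    induction k with
    | zero => intro g hg; simpa using hg
    | succ k ih => intro g hg; rw [pow_succ, mul_assoc]; exact ih _ (hgen s g hg)
  have hinv : ∀ s : D5Gen, ∃ k, (gen n m₂ m₃ s)⁻¹ = gen n m₂ m₃ s ^ k := by
    have key : ∀ (g : D5Group (n + 1) m₂ m₃) (k : ℕ), g ^ 2 ^ k = 1 → ∃ k, g⁻¹ = g ^ k := by
      intro g k hk
      refine ⟨2 ^ k - 1, inv_eq_of_mul_eq_one_right ?_⟩
      rw [← pow_succ', Nat.sub_add_cancel Nat.one_le_two_pow, hk]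
    intro s
    cases s with
    | x => exact key _ _ (x_pow n m₂ m₃)
    | y => exact key _ _ (y_pow n m₂ m₃)
    | t₁ => exact key _ _ (t₁_pow n m₂ m₃)
    | t₂ => exact key _ m₂ (by rw [← x_sq, ← pow_mul, ← pow_succ', x_pow])
    | t₃ => exact key _ m₃ (by rw [← y_sq, ← pow_mul, ← pow_succ', y_pow])
  have hg : g ∈ Subgroup.closure (Set.range (gen n m₂ m₃)) := by
    rw [PresentedGroup.closure_range_of]; trivial
  induction hg using Subgroup.closure_induction_left with
  | one => exact ⟨0, 0, 0, by simp⟩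
  | mul_left s hs g _ ih =>
    obtain ⟨s, rfl⟩ := hs
    exact hgen s g ih
  | inv_mul_cancel s hs g _ ih =>
    obtain ⟨s, rfl⟩ := hs
    obtain ⟨k, hk⟩ := hinv s
    rw [hk]
    exact hpow s k g ih

end D5Group

namespace D5Model

variable {n m₂ m₃ : ℕ}

theorem t_pow (k : ℕ) : (⟨1, 0, 0⟩ : D5Model n m₂ m₃) ^ k = ⟨k, 0, 0⟩ := by
  induction k with
  | zero => ext <;> simp
  | succ k ih => rw [pow_succ, ih]; ext <;> simp [twist]

theorem x_pow (k : ℕ) : (⟨0, 1, 0⟩ : D5Model n m₂ m₃) ^ k = ⟨0, k, 0⟩ := by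
  induction k with
  | zero => ext <;> simp
  | succ k ih => rw [pow_succ, ih]; ext <;> simp [twist]

theorem y_pow (k : ℕ) : (⟨0, 0, 1⟩ : D5Model n m₂ m₃) ^ k = ⟨0, 0, k⟩ := by
  induction k with
  | zero => ext <;> simp
  | succ k ih => rw [pow_succ, ih]; ext <;> simp [twist]

theorem normal_form (a i j : ℕ) : (⟨1, 0, 0⟩ : D5Model n m₂ m₃) ^ a * ⟨0, 1, 0⟩ ^ i *
    ⟨0, 0, 1⟩ ^ j = ⟨a, i, j⟩ := by
  rw [t_pow, x_pow, y_pow]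
  ext <;> simp [twist]

end D5Model

theorem exists_equiv_d5Model (n m₂ m₃ : ℕ) : ∃ f : D5Group (n + 1) m₂ m₃ ≃* D5Model n m₂ m₃,
    f (PresentedGroup.of D5Gen.x) = ⟨0, 1, 0⟩ ∧ f (PresentedGroup.of D5Gen.y) = ⟨0, 0, 1⟩ ∧
      f (PresentedGroup.of D5Gen.t₁) = ⟨1, 0, 0⟩ := by
  obtain ⟨f, hx, hy, ht⟩ := exists_d5Group_hom n m₂ m₃ (U := D5Model n m₂ m₃)
    ⟨0, 1, 0⟩ ⟨0, 0, 1⟩ ⟨1, 0, 0⟩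
    (by rw [D5Model.x_pow, ZMod.natCast_self]; rfl)
    (by rw [D5Model.y_pow, ZMod.natCast_self]; rfl)
    (by rw [D5Model.t_pow, ZMod.natCast_self]; rfl)
    (by rw [commute_iff_eq]; ext <;> simp [D5Model.twist])
    (by rw [commute_iff_eq]; ext <;> simp [D5Model.twist])
    (by rw [commute_iff_eq, D5Model.x_pow]; ext <;> simp [D5Model.twist]
        rw [← ZMod.dbl_one, ZMod.par_dbl, map_zero])
    (by rw [commute_iff_eq, D5Model.y_pow]; ext <;> simp [D5Model.twist]
        rw [← ZMod.dbl_one, ZMod.par_dbl, map_zero])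
    (by
      rw [commutatorElement_def, D5Model.t_pow, mul_inv_eq_iff_eq_mul, mul_inv_eq_iff_eq_mul]
      ext <;> simp [D5Model.twist, ZMod.top_one]
      rw [← two_mul, ← pow_succ']
      exact_mod_cast (ZMod.natCast_self (2 ^ (n + 1))).symm)
  refine ⟨MulEquiv.ofBijective f ⟨?_, ?_⟩, hx, hy, ht⟩
  · rw [injective_iff_map_eq_one]
    intro g hg
    -- A normal form that dies in the model has exponents divisible by the orders of the
    -- coordinates, and the relations already kill such powers.
    obtain ⟨a, i, j, rfl⟩ := D5Group.exists_normal_form n m₂ m₃ g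
    rw [map_mul, map_mul, map_pow, map_pow, map_pow, hx, hy, ht, D5Model.normal_form] at hg
    have ha := congrArg D5Model.a hg
    have hi := congrArg D5Model.i hg
    have hj := congrArg D5Model.j hg
    simp only [D5Model.one_a, D5Model.one_i, D5Model.one_j, ZMod.natCast_eq_zero_iff]
      at ha hi hj
    rw [orderOf_dvd_iff_pow_eq_one.1 ((orderOf_dvd_of_pow_eq_one (D5Group.t₁_pow n m₂ m₃)).trans ha),
      orderOf_dvd_iff_pow_eq_one.1 ((orderOf_dvd_of_pow_eq_one (D5Group.x_pow n m₂ m₃)).trans hi),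
      orderOf_dvd_iff_pow_eq_one.1 ((orderOf_dvd_of_pow_eq_one (D5Group.y_pow n m₂ m₃)).trans hj),
      one_mul, one_mul]
  · intro g
    obtain ⟨a, ha⟩ := ZMod.natCast_zmod_surjective g.a
    obtain ⟨i, hi⟩ := ZMod.natCast_zmod_surjective g.i
    obtain ⟨j, hj⟩ := ZMod.natCast_zmod_surjective g.j
    refine ⟨D5Group.gen n m₂ m₃ .t₁ ^ a * D5Group.gen n m₂ m₃ .x ^ i *
      D5Group.gen n m₂ m₃ .y ^ j, ?_⟩
    rw [map_mul, map_mul, map_pow, map_pow, map_pow, hx, hy, ht, D5Model.normal_form]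
    ext
    · exact ha
    · exact hi
    · exact hj

theorem exists_typeD5 {n m₂ m₃ : ℕ} {G : Type*} [Group G] (e : D5Group (n + 1) m₂ m₃ ≃* G) :
    ∃ d : TypeD5 n m₂ m₃ G, d.x = e (PresentedGroup.of D5Gen.x) ∧
      d.y = e (PresentedGroup.of D5Gen.y) ∧
      d.ι (Multiplicative.ofAdd (1, 0, 0)) = e (PresentedGroup.of D5Gen.t₁) := by
  obtain ⟨f, hx, hy, ht⟩ := exists_equiv_d5Model n m₂ m₃
  refine ⟨D5Model.typeD5.map (f.symm.trans e), ?_, ?_, ?_⟩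
  · exact congrArg e (f.symm_apply_eq.2 hx.symm)
  · exact congrArg e (f.symm_apply_eq.2 hy.symm)
  · refine congrArg e (f.symm_apply_eq.2 (ht.trans ?_).symm)
    exact .symm (by ext <;> simp [D5Model.typeD5, D5Model.ι])

/-! ### Odd powers, and the parity layers of the abelianization. -/

theorem zpowers_eq_zpowers_iff_odd {A : Type*} [Group A] {a b : A} {N : ℕ}
    (ha : a ^ 2 ^ N = 1) :
    Subgroup.zpowers a = Subgroup.zpowers b ↔ ∃ r, Odd r ∧ a ^ r = b := by
  obtain ⟨k, -, hk⟩ := (Nat.dvd_prime_pow Nat.prime_two).1 (orderOf_dvd_of_pow_eq_one ha)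
  have hfin : IsOfFinOrder a := isOfFinOrder_iff_pow_eq_one.2 ⟨_, by positivity, ha⟩
  constructor
  · intro h
    have hb : b ∈ Subgroup.zpowers a := h ▸ Subgroup.mem_zpowers b
    obtain ⟨r, rfl⟩ := hfin.mem_powers_iff_mem_zpowers.2 hb
    have ho : orderOf (a ^ r) = orderOf a := by
      rw [← Nat.card_zpowers, ← h, Nat.card_zpowers]
    -- An even `r` can only occur when `a = 1`, and then `1` serves as an odd exponent.
    rcases Nat.even_or_odd r with hr | hr
    · rw [hfin.orderOf_pow, hk] at ho
      have h1 : (2 ^ k).gcd r = 1 := by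
        have := Nat.div_mul_cancel (Nat.gcd_dvd_left (2 ^ k) r)
        rw [ho] at this
        exact Nat.eq_of_mul_eq_mul_left (show 0 < 2 ^ k by positivity) (this.trans (mul_one _).symm)
      cases k with
      | zero =>
        have : a = 1 := orderOf_eq_one_iff.1 (by simpa using hk)
        exact ⟨1, odd_one, by simp [this]⟩
      | succ k =>
        have h2 : 2 ∣ (2 ^ (k + 1)).gcd r := Nat.dvd_gcd (dvd_pow_self 2 k.succ_ne_zero) hr.two_dvd
        rw [h1] at h2
        omega
    · exact ⟨r, hr, rfl⟩
  · rintro ⟨r, hr, rfl⟩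
    have hc : (orderOf a).Coprime r := by
      rw [hk]
      exact Nat.Coprime.pow_left k (Nat.coprime_two_left.2 hr)
    have : Finite (Subgroup.zpowers a) := finite_zpowers.2 hfin
    refine (Subgroup.eq_of_le_of_card_ge (H := Subgroup.zpowers (a ^ r)) ?_ ?_).symm
    · exact Subgroup.zpowers_le.2 (pow_mem (Subgroup.mem_zpowers a) r)
    · rw [Nat.card_zpowers, Nat.card_zpowers, hfin.orderOf_pow, hc.gcd_eq_one, Nat.div_one]

namespace TriCyclic

variable {a b c : ℕ}

theorem pow_eq_one (u : TriCyclic a b c) : u ^ 2 ^ (a + b + c) = 1 := by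
  have key : ∀ (m k : ℕ) (v : ZMod (2 ^ m)), m ≤ k → 2 ^ k • v = 0 := by
    intro m k v h
    rw [nsmul_eq_mul, (ZMod.natCast_eq_zero_iff _ _).2 (Nat.pow_dvd_pow 2 h), zero_mul]
  refine Multiplicative.toAdd.injective (Prod.ext ?_ (Prod.ext ?_ ?_))
  · exact key _ _ _ (by omega)
  · exact key _ _ _ (by omega)
  · exact key _ _ _ (by omega)

/-- The parities of the last two coordinates. -/
def parity : TriCyclic a (b + 1) (c + 1) →* Multiplicative (ZMod 2 × ZMod 2) :=
  AddMonoidHom.toMultiplicative (((ZMod.par b).toAddMonoidHom.prodMap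
    (ZMod.par c).toAddMonoidHom).comp (AddMonoidHom.snd _ _))

theorem parity_pow_odd (w : TriCyclic a (b + 1) (c + 1)) {r : ℕ} (hr : Odd r) :
    parity (w ^ r) = parity w := by
  obtain ⟨k, rfl⟩ := hr
  have h2 : ∀ v : Multiplicative (ZMod 2 × ZMod 2), v ^ 2 = 1 := by decide
  rw [map_pow, pow_succ, pow_mul, h2, one_pow, one_mul]

theorem parity_eq_of_zpowers_eq {v w : TriCyclic a (b + 1) (c + 1)}
    (h : Subgroup.zpowers v = Subgroup.zpowers w) : parity v = parity w := by
  obtain ⟨r, hr, rfl⟩ := (zpowers_eq_zpowers_iff_odd (pow_eq_one v)).1 h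
  exact (parity_pow_odd v hr).symm

/-- The elements with given parities. -/
def layer (a b c : ℕ) (i j : ZMod 2) : Set (TriCyclic a (b + 1) (c + 1)) :=
  {w | parity w = Multiplicative.ofAdd (i, j)}

theorem cycCount_layer_union (p q : ZMod 2 × ZMod 2) (h : p ≠ q)  :
    cycCount (layer a b c p.1 p.2 ∪ layer a b c q.1 q.2) =
      cycCount (layer a b c p.1 p.2) + cycCount (layer a b c q.1 q.2) := by
  refine cycCount_union fun v hv w hw hvw => h ?_
  have h1 : parity v = Multiplicative.ofAdd p := hv
  have h2 : parity w = Multiplicative.ofAdd q := hw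
  exact Multiplicative.ofAdd.injective (h1.symm.trans ((parity_eq_of_zpowers_eq hvw).trans h2))

theorem mem_layer {w : TriCyclic a (b + 1) (c + 1)} {i j : ZMod 2} :
    w ∈ layer a b c i j ↔ ZMod.par b w.toAdd.2.1 = i ∧ ZMod.par c w.toAdd.2.2 = j := by
  rw [← Prod.mk.injEq]
  exact Multiplicative.toAdd.injective.eq_iff.symm

theorem numCyclicSubgroups_eq_sum_layers :
    numCyclicSubgroups (TriCyclic a (b + 1) (c + 1)) = cycCount (layer a b c 0 0) +
      cycCount (layer a b c 1 0) + cycCount (layer a b c 0 1) + cycCount (layer a b c 1 1) := by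
  have hu : (Set.univ : Set (TriCyclic a (b + 1) (c + 1))) =
      (layer a b c 0 0 ∪ layer a b c 1 0) ∪ layer a b c 0 1 ∪ layer a b c 1 1 := by
    symm
    rw [Set.eq_univ_iff_forall]
    intro w
    simp only [Set.mem_union, mem_layer]
    rcases ZMod.two_cases (ZMod.par b w.toAdd.2.1) with h | h <;>
    rcases ZMod.two_cases (ZMod.par c w.toAdd.2.2) with h' | h' <;> simp [h, h']
  rw [← cycCount_univ, hu, cycCount_union, cycCount_union,
    cycCount_layer_union (0, 0) (1, 0) (by decide)]
  · intro v hv w hw hvw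
    have h := parity_eq_of_zpowers_eq hvw
    simp only [Set.mem_union, layer, Set.mem_ofPred_eq] at hv hw
    rw [← h] at hw
    rcases hv with hv | hv <;> rw [hv] at hw <;> revert hw <;> decide
  · intro v hv w hw hvw
    have h := parity_eq_of_zpowers_eq hvw
    simp only [Set.mem_union, layer, Set.mem_ofPred_eq] at hv hw
    rw [← h] at hw
    rcases hv with (hv | hv) | hv <;> rw [hv] at hw <;> revert hw <;> decide

theorem cycCount_layer_zero_zero :
    cycCount (layer a b c 0 0) = numCyclicSubgroups (TriCyclic a b c) := by
  let f : TriCyclic a b c →* TriCyclic a (b + 1) (c + 1) := AddMonoidHom.toMultiplicative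
    ((AddMonoidHom.id _).prodMap ((ZMod.dbl b).prodMap (ZMod.dbl c)))
  have hf : Function.Injective f :=
    Function.injective_id.prodMap ((ZMod.dbl_injective b).prodMap (ZMod.dbl_injective c))
  rw [← cycCount_range f hf]
  congr 1
  ext w
  rw [mem_layer, ZMod.par_eq_zero_iff, ZMod.par_eq_zero_iff]
  constructor
  · rintro ⟨⟨i, hi⟩, j, hj⟩
    exact ⟨Multiplicative.ofAdd (w.toAdd.1, i, j),
      Multiplicative.toAdd.injective (Prod.ext rfl (Prod.ext hi hj))⟩
  · rintro ⟨u, rfl⟩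
    exact ⟨⟨_, rfl⟩, _, rfl⟩

/-- The two layers together form a subgroup of index 2, whose last coordinate is a double. -/
theorem cycCount_layer_one_zero : cycCount (layer a b c 0 0) + cycCount (layer a b c 1 0) =
    numCyclicSubgroups (TriCyclic a (b + 1) c) := by
  let f : TriCyclic a (b + 1) c →* TriCyclic a (b + 1) (c + 1) := AddMonoidHom.toMultiplicative
    ((AddMonoidHom.id _).prodMap ((AddMonoidHom.id _).prodMap (ZMod.dbl c)))
  have hf : Function.Injective f :=
    Function.injective_id.prodMap (Function.injective_id.prodMap (ZMod.dbl_injective c))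
  rw [← cycCount_range f hf, ← cycCount_layer_union (0, 0) (1, 0) (by decide)]
  congr 1
  ext w
  simp only [Set.mem_union, mem_layer]
  rw [← or_and_right, ZMod.par_eq_zero_iff c]
  constructor
  · rintro ⟨-, j, hj⟩
    exact ⟨Multiplicative.ofAdd (w.toAdd.1, w.toAdd.2.1, j),
      Multiplicative.toAdd.injective (Prod.ext rfl (Prod.ext rfl hj))⟩
  · rintro ⟨u, rfl⟩
    exact ⟨ZMod.two_cases _, _, rfl⟩

theorem cycCount_layer_zero_one : cycCount (layer a b c 0 0) + cycCount (layer a b c 0 1) =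
    numCyclicSubgroups (TriCyclic a b (c + 1)) := by
  let f : TriCyclic a b (c + 1) →* TriCyclic a (b + 1) (c + 1) := AddMonoidHom.toMultiplicative
    ((AddMonoidHom.id _).prodMap ((ZMod.dbl b).prodMap (AddMonoidHom.id _)))
  have hf : Function.Injective f :=
    Function.injective_id.prodMap ((ZMod.dbl_injective b).prodMap Function.injective_id)
  rw [← cycCount_range f hf, ← cycCount_layer_union (0, 0) (0, 1) (by decide)]
  congr 1
  ext w
  simp only [Set.mem_union, mem_layer]
  rw [← and_or_left, ZMod.par_eq_zero_iff b]
  constructor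
  · rintro ⟨⟨j, hj⟩, -⟩
    exact ⟨Multiplicative.ofAdd (w.toAdd.1, j, w.toAdd.2.2),
      Multiplicative.toAdd.injective (Prod.ext rfl (Prod.ext hj rfl))⟩
  · rintro ⟨u, rfl⟩
    exact ⟨⟨_, rfl⟩, ZMod.two_cases _⟩

theorem mem_layer_diagonal {w : TriCyclic a (b + 1) (c + 1)} :
    w ∈ layer a b c 0 0 ∪ layer a b c 1 1 ↔
      ZMod.par b w.toAdd.2.1 = ZMod.par c w.toAdd.2.2 := by
  simp only [Set.mem_union, mem_layer]
  rcases ZMod.two_cases (ZMod.par b w.toAdd.2.1) with h | h <;>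
    rcases ZMod.two_cases (ZMod.par c w.toAdd.2.2) with h' | h' <;> simp [h, h']

/-- The two layers form the subgroup where the parities agree. If `c ≤ b`, it is the direct product
of the first factor, the group generated by `(0, 1, 1)`, of order `2 ^ (b + 1)`, and the doubles in
the last coordinate. Otherwise the last two factors exchange roles. -/
theorem cycCount_layer_one_one : cycCount (layer a b c 0 0) + cycCount (layer a b c 1 1) =
    if c ≤ b then numCyclicSubgroups (TriCyclic a (b + 1) c) else
      numCyclicSubgroups (TriCyclic a b (c + 1)) := by
  rw [← cycCount_layer_union (0, 0) (1, 1) (by decide)]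
  split_ifs with h
  -- The reduction `κ` exists because `c ≤ b`; it preserves parity, so subtracting `κ` of the second
  -- coordinate makes the third one even.
  · let κ : ZMod (2 ^ (b + 1)) →+* ZMod (2 ^ (c + 1)) :=
      ZMod.castHom (pow_dvd_pow 2 (by omega)) _
    have hκ : ∀ i, ZMod.par c (κ i) = ZMod.par b i := fun i =>
      congrArg (fun φ : ZMod (2 ^ (b + 1)) →+* ZMod 2 => φ i)
        (Subsingleton.elim ((ZMod.par c).comp κ) (ZMod.par b))
    let f : TriCyclic a (b + 1) c →* TriCyclic a (b + 1) (c + 1) := AddMonoidHom.toMultiplicative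
      { toFun := fun u => (u.1, u.2.1, ZMod.dbl c u.2.2 + κ u.2.1)
        map_zero' := by simp
        map_add' := fun u v => by ext <;> simp; abel }
    have hf : Function.Injective f := by
      intro u v huv
      have h1 := congrArg (fun w => (Multiplicative.toAdd w).1) huv
      have h2 : u.toAdd.2.1 = v.toAdd.2.1 := congrArg (fun w => (Multiplicative.toAdd w).2.1) huv
      have h3 : ZMod.dbl c u.toAdd.2.2 + κ u.toAdd.2.1 = ZMod.dbl c v.toAdd.2.2 + κ v.toAdd.2.1 :=
        congrArg (fun w => (Multiplicative.toAdd w).2.2) huv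
      rw [h2, add_left_inj] at h3
      exact Multiplicative.toAdd.injective (Prod.ext h1 (Prod.ext h2 (ZMod.dbl_injective c h3)))
    rw [← cycCount_range f hf]
    congr 1
    ext w
    rw [mem_layer_diagonal]
    constructor
    · intro hw
      obtain ⟨j, hj⟩ := (ZMod.par_eq_zero_iff c (w.toAdd.2.2 - κ w.toAdd.2.1)).1
        (by rw [map_sub, hκ, hw, sub_self])
      exact ⟨Multiplicative.ofAdd (w.toAdd.1, w.toAdd.2.1, j),
        Multiplicative.toAdd.injective (Prod.ext rfl (Prod.ext rfl (eq_sub_iff_add_eq.1 hj)))⟩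
    · rintro ⟨u, rfl⟩
      change ZMod.par b u.toAdd.2.1 = ZMod.par c (ZMod.dbl c u.toAdd.2.2 + κ u.toAdd.2.1)
      rw [map_add, ZMod.par_dbl, hκ, zero_add]
  · let κ : ZMod (2 ^ (c + 1)) →+* ZMod (2 ^ (b + 1)) :=
      ZMod.castHom (pow_dvd_pow 2 (by omega)) _
    have hκ : ∀ i, ZMod.par b (κ i) = ZMod.par c i := fun i =>
      congrArg (fun φ : ZMod (2 ^ (c + 1)) →+* ZMod 2 => φ i)
        (Subsingleton.elim ((ZMod.par b).comp κ) (ZMod.par c))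
    let f : TriCyclic a b (c + 1) →* TriCyclic a (b + 1) (c + 1) := AddMonoidHom.toMultiplicative
      { toFun := fun u => (u.1, ZMod.dbl b u.2.1 + κ u.2.2, u.2.2)
        map_zero' := by simp
        map_add' := fun u v => by ext <;> simp; abel }
    have hf : Function.Injective f := by
      intro u v huv
      have h1 := congrArg (fun w => (Multiplicative.toAdd w).1) huv
      have h2 : u.toAdd.2.2 = v.toAdd.2.2 := congrArg (fun w => (Multiplicative.toAdd w).2.2) huv
      have h3 : ZMod.dbl b u.toAdd.2.1 + κ u.toAdd.2.2 = ZMod.dbl b v.toAdd.2.1 + κ v.toAdd.2.2 :=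
        congrArg (fun w => (Multiplicative.toAdd w).2.1) huv
      rw [h2, add_left_inj] at h3
      exact Multiplicative.toAdd.injective (Prod.ext h1 (Prod.ext (ZMod.dbl_injective b h3) h2))
    rw [← cycCount_range f hf]
    congr 1
    ext w
    rw [mem_layer_diagonal]
    constructor
    · intro hw
      obtain ⟨j, hj⟩ := (ZMod.par_eq_zero_iff b (w.toAdd.2.1 - κ w.toAdd.2.2)).1
        (by rw [map_sub, hκ, hw, sub_self])
      exact ⟨Multiplicative.ofAdd (w.toAdd.1, j, w.toAdd.2.2),
        Multiplicative.toAdd.injective (Prod.ext rfl (Prod.ext (eq_sub_iff_add_eq.1 hj) rfl))⟩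
    · rintro ⟨u, rfl⟩
      change ZMod.par b (ZMod.dbl b u.toAdd.2.1 + κ u.toAdd.2.2) = ZMod.par c u.toAdd.2.2
      rw [map_add, ZMod.par_dbl, hκ, zero_add]

end TriCyclic

/-! ### The rational classes of the group. -/

/-- Irreducibility of the cyclotomic polynomial makes every exponent prime to the order of `ζ` come
from an automorphism. The exponent of `G` is a positive power of 2, so these are the odd exponents.
-/
theorem kConj_iff_of_irreducible (K : Type v) [Field K] [CharZero K] {G : Type*} [Group G] {N : ℕ}
    (hexp : Monoid.exponent G = 2 ^ (N + 1))
    (hirr : Irreducible (Polynomial.cyclotomic (Monoid.exponent G) K)) (g h : G) :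
    KConj K g h ↔ ∃ r, Odd r ∧ IsConj (g ^ r) h := by
  have : NeZero (Monoid.exponent G) := ⟨by rw [hexp]; positivity⟩
  have : NeZero (Monoid.exponent G : K) := ⟨Nat.cast_ne_zero.2 (NeZero.ne _)⟩
  have hcop : ∀ r : ℕ, r.Coprime (Monoid.exponent G) ↔ Odd r := by
    intro r
    rw [hexp, Nat.coprime_pow_right_iff N.succ_pos, Nat.coprime_two_right]
  constructor
  · rintro ⟨σ, r, ⟨ζ, hζ, hσ⟩, h⟩
    refine ⟨r, ?_, h⟩
    rw [← hcop, ← hζ.pow_iff_coprime (NeZero.pos _), ← hσ]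
    exact hζ.map_of_injective σ.injective
  · rintro ⟨r, hr, h⟩
    have hζ := IsCyclotomicExtension.zeta_spec (Monoid.exponent G) K
      (CyclotomicField (Monoid.exponent G) K)
    refine ⟨IsCyclotomicExtension.fromZetaAut (hζ.pow_of_coprime r ((hcop r).2 hr)) hirr,
      r, ⟨_, hζ, ?_⟩, h⟩
    exact IsCyclotomicExtension.fromZetaAut_spec _ _

theorem kConj_rat_iff {G : Type*} [Group G] {N : ℕ} (hexp : Monoid.exponent G = 2 ^ (N + 1))
    (g h : G) : KConj ℚ g h ↔ ∃ r, Odd r ∧ IsConj (g ^ r) h :=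
  kConj_iff_of_irreducible ℚ hexp
    (Polynomial.cyclotomic.irreducible_rat (by rw [hexp]; positivity)) g h

namespace TypeD5

variable {n m₂ m₃ : ℕ} {G : Type*} [Group G] (d : TypeD5 n m₂ m₃ G)

/-- The central involution, in the group. -/
def s : G := d.ι (TriCyclic.invol n m₂ m₃)

theorem invol_ne_one : TriCyclic.invol n m₂ m₃ ≠ 1 := by
  intro h
  have h : (2 ^ n : ZMod (2 ^ (n + 1))) = 0 := congrArg (fun w => (Multiplicative.toAdd w).1) h
  rw [← ZMod.top_one, ← map_zero (ZMod.top n)] at h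
  exact absurd (ZMod.top_injective n h) (by decide)

theorem invol_mul_invol :
    TriCyclic.invol n m₂ m₃ * TriCyclic.invol n m₂ m₃ = 1 := by
  rw [TriCyclic.invol, ← ofAdd_add]
  have : (2 ^ n + 2 ^ n : ZMod (2 ^ (n + 1))) = 0 := by
    rw [← two_mul, ← pow_succ']
    exact_mod_cast ZMod.natCast_self (2 ^ (n + 1))
  simp [this]

theorem s_ne_one : d.s ≠ 1 := by
  rw [s, ← map_one d.ι, d.ι_injective.ne_iff]
  exact invol_ne_one

theorem s_mul_s : d.s * d.s = 1 := by
  rw [s, ← map_mul, invol_mul_invol, map_one]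

theorem ι_mem_center (z) : d.ι z ∈ Subgroup.center G := d.range_ι ▸ ⟨z, rfl⟩

theorem ι_mul_comm (z) (g : G) : g * d.ι z = d.ι z * g :=
  Subgroup.mem_center_iff.1 (d.ι_mem_center z) g

theorem s_mul_comm (g : G) : g * d.s = d.s * g := d.ι_mul_comm _ g

theorem π_s : d.π d.s = 1 := by
  rw [s, d.π_ι]
  refine Multiplicative.toAdd.injective (Prod.ext ?_ (Prod.ext ?_ ?_))
  · exact (ZMod.red_eq_zero_iff n _).2 ⟨1, ZMod.top_one n⟩
  · exact map_zero _
  · exact map_zero _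

theorem π_eq_iff (g h : G) : d.π g = d.π h ↔ h = g ∨ h = g * d.s := by
  constructor
  · intro hgh
    rcases d.eq_of_π_eq_one (g⁻¹ * h) (by rw [map_mul, map_inv, hgh, inv_mul_cancel]) with h1 | h1
    · exact Or.inl (inv_mul_eq_one.1 h1).symm
    · exact Or.inr (inv_mul_eq_iff_eq_mul.1 h1)
  · rintro (rfl | rfl)
    · rfl
    · rw [map_mul, d.π_s, mul_one]

include d in
theorem finite : Finite G := by
  let f : TriCyclic (n + 1) m₂ m₃ × Fin 4 → G := fun p =>
    d.ι p.1 * ![1, d.x, d.y, d.x * d.y] p.2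
  refine Finite.of_surjective f fun g => ?_
  obtain ⟨z, h | h | h | h⟩ := d.exists_rep g
  · exact ⟨(z, 0), by simp [f, h]⟩
  · exact ⟨(z, 1), by simp [f, h]⟩
  · exact ⟨(z, 2), by simp [f, h]⟩
  · exact ⟨(z, 3), by simp [f, h]⟩

include d in
theorem exists_exponent : ∃ N, Monoid.exponent G = 2 ^ (N + 1) := by
  have h : ∀ g : G, g ^ 2 ^ (n + (m₂ + 1) + (m₃ + 1) + 1) = 1 := by
    intro g
    have h1 : d.π (g ^ 2 ^ (n + (m₂ + 1) + (m₃ + 1))) = 1 := by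
      rw [map_pow, TriCyclic.pow_eq_one]
    rw [pow_succ, pow_mul]
    rcases d.eq_of_π_eq_one _ h1 with h | h
    · rw [h, one_pow]
    · rw [h, pow_two]; exact d.s_mul_s
  obtain ⟨k, -, hk⟩ := (Nat.dvd_prime_pow Nat.prime_two).1 (Monoid.exponent_dvd_of_forall_pow_eq_one h)
  cases k with
  | zero =>
    have := Monoid.pow_exponent_eq_one d.s
    rw [hk, pow_zero, pow_one] at this
    exact absurd this d.s_ne_one
  | succ k => exact ⟨k, hk⟩

include d in
theorem pow_two_pow_eq_one : ∃ N, ∀ g : G, g ^ 2 ^ N = 1 := by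
  obtain ⟨N, hN⟩ := d.exists_exponent
  exact ⟨N + 1, fun g => hN ▸ Monoid.pow_exponent_eq_one g⟩

/-- The fibre of `π` through `g` is `{g, g * s}`. A noncentral `g` has a conjugate different from
itself, which must be `g * s`. -/
theorem isConj_iff_of_notMem_center {g h : G} (hg : g ∉ Subgroup.center G) :
    IsConj g h ↔ d.π g = d.π h := by
  constructor
  · rw [isConj_iff]
    rintro ⟨c, rfl⟩
    rw [map_mul, map_mul, map_inv, mul_inv_cancel_comm]
  · intro hgh
    rcases (d.π_eq_iff g h).1 hgh with rfl | rfl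
    · exact IsConj.refl _
    · have : ∃ k, k * g ≠ g * k := by
        by_contra hcon
        push Not at hcon
        exact hg (Subgroup.mem_center_iff.2 hcon)
      obtain ⟨k, hk⟩ := this
      refine isConj_iff.2 ⟨k, ?_⟩
      have h1 : d.π g = d.π (k * g * k⁻¹) := by rw [map_mul, map_mul, map_inv, mul_inv_cancel_comm]
      rcases (d.π_eq_iff _ _).1 h1 with h2 | h2
      · exact absurd (mul_inv_eq_iff_eq_mul.1 h2) hk
      · exact h2

include d in
theorem mem_kClass_iff (g h : G) : h ∈ kClass ℚ g ↔ ∃ r, Odd r ∧ IsConj (g ^ r) h := by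
  obtain ⟨N, hN⟩ := d.exists_exponent
  exact kConj_rat_iff hN g h

include d in
theorem self_mem_kClass (g : G) : g ∈ kClass ℚ g :=
  (d.mem_kClass_iff g g).2 ⟨1, odd_one, by rw [pow_one]⟩

theorem exists_π_of_mem_kClass {g h : G} (hh : h ∈ kClass ℚ g) : ∃ r, Odd r ∧ d.π g ^ r = d.π h := by
  obtain ⟨r, hr, h1⟩ := (d.mem_kClass_iff g h).1 hh
  refine ⟨r, hr, ?_⟩
  obtain ⟨c, rfl⟩ := isConj_iff.1 h1
  rw [← map_pow, map_mul, map_mul, map_inv, mul_inv_cancel_comm]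

include d in
theorem kClass_eq_iff_of_mem_center {g h : G} (hg : g ∈ Subgroup.center G)
    (hh : h ∈ Subgroup.center G) :
    kClass ℚ g = kClass ℚ h ↔ Subgroup.zpowers g = Subgroup.zpowers h := by
  obtain ⟨N, hN⟩ := d.pow_two_pow_eq_one
  have key : ∀ g ∈ Subgroup.center G, ∀ k, k ∈ kClass ℚ g ↔
      Subgroup.zpowers g = Subgroup.zpowers k := by
    intro g hg k
    rw [d.mem_kClass_iff, zpowers_eq_zpowers_iff_odd (hN g)]
    refine exists_congr fun r => and_congr_right fun _ => ?_
    rw [isConj_iff]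
    have : ∀ c, c * g ^ r * c⁻¹ = g ^ r := fun c => by
      rw [Subgroup.mem_center_iff.1 (pow_mem hg r) c, mul_inv_cancel_right]
    simp [this]
  constructor
  · intro h
    exact (key g hg _).1 (h ▸ d.self_mem_kClass _)
  · intro h
    ext k
    rw [key g hg, key _ hh, h]

theorem kClass_eq_iff_of_notMem_center {g h : G} (hg : g ∉ Subgroup.center G)
    (hh : h ∉ Subgroup.center G) :
    kClass ℚ g = kClass ℚ h ↔ Subgroup.zpowers (d.π g) = Subgroup.zpowers (d.π h) := by
  obtain ⟨N, hN⟩ := d.pow_two_pow_eq_one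
  have key : ∀ g ∉ Subgroup.center G, ∀ k, k ∈ kClass ℚ g ↔
      Subgroup.zpowers (d.π g) = Subgroup.zpowers (d.π k) := by
    intro g hg k
    rw [d.mem_kClass_iff, zpowers_eq_zpowers_iff_odd (TriCyclic.pow_eq_one _)]
    refine exists_congr fun r => and_congr_right fun hr => ?_
    rw [d.isConj_iff_of_notMem_center, map_pow]
    -- An odd power of `g` generates the same subgroup as `g`, so it cannot be central.
    intro hgr
    have h1 := (zpowers_eq_zpowers_iff_odd (hN g)).2 ⟨r, hr, rfl⟩
    have h2 : g ∈ Subgroup.zpowers (g ^ r) := h1 ▸ Subgroup.mem_zpowers g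
    exact hg (Subgroup.zpowers_le.2 hgr h2)
  constructor
  · intro h
    exact (key g hg _).1 (h ▸ d.self_mem_kClass _)
  · intro h
    ext k
    rw [key g hg, key _ hh, h]

/-- The coset of the centre with given parities. -/
def coset (i j : ZMod 2) : Set G := d.π ⁻¹' TriCyclic.layer n m₂ m₃ i j

theorem ι_mem_coset (z) : d.ι z ∈ d.coset 0 0 := by
  rw [coset, Set.mem_preimage, d.π_ι, TriCyclic.mem_layer]
  exact ⟨ZMod.par_dbl _ _, ZMod.par_dbl _ _⟩

theorem mul_mem_coset {g h : G} {i j k l : ZMod 2} (hg : g ∈ d.coset i j) (hh : h ∈ d.coset k l) :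
    g * h ∈ d.coset (i + k) (j + l) := by
  simp only [coset, Set.mem_preimage, TriCyclic.layer, Set.mem_ofPred_eq] at *
  rw [map_mul, map_mul, hg, hh]
  rfl

theorem x_mem_coset : d.x ∈ d.coset 1 0 := by
  rw [coset, Set.mem_preimage, d.π_x, TriCyclic.mem_layer]
  exact ⟨map_one _, map_zero _⟩

theorem y_mem_coset : d.y ∈ d.coset 0 1 := by
  rw [coset, Set.mem_preimage, d.π_y, TriCyclic.mem_layer]
  exact ⟨map_zero _, map_one _⟩

theorem xy_mem_coset : d.x * d.y ∈ d.coset 1 1 := d.mul_mem_coset d.x_mem_coset d.y_mem_coset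

theorem coset_disjoint {p q : ZMod 2 × ZMod 2} {g : G} (h : g ∈ d.coset p.1 p.2)
    (h' : g ∈ d.coset q.1 q.2) : p = q :=
  Multiplicative.ofAdd.injective (h.symm.trans h')

theorem coset_zero_zero : d.coset 0 0 = Subgroup.center G := by
  rw [← d.range_ι]
  ext g
  constructor
  · intro hg
    obtain ⟨z, rfl | rfl | rfl | rfl⟩ := d.exists_rep g
    · exact ⟨z, rfl⟩
    · exact absurd (d.coset_disjoint (p := (0, 0)) (q := (0 + 1, 0 + 0)) hg
        (d.mul_mem_coset (d.ι_mem_coset z) d.x_mem_coset)) (by decide)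
    · exact absurd (d.coset_disjoint (p := (0, 0)) (q := (0 + 0, 0 + 1)) hg
        (d.mul_mem_coset (d.ι_mem_coset z) d.y_mem_coset)) (by decide)
    · exact absurd (d.coset_disjoint (p := (0, 0)) (q := (0 + 1, 0 + 1)) hg
        (d.mul_mem_coset (d.ι_mem_coset z) d.xy_mem_coset)) (by decide)
  · rintro ⟨z, rfl⟩
    exact d.ι_mem_coset z

theorem coset_eq_image {w : G} {i j : ZMod 2} (hw : w ∈ d.coset i j) :
    d.coset i j = (fun a => a * w) '' (Subgroup.center G : Set G) := by
  -- The group of parities has exponent 2, so inversion keeps the coset.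
  have hw' : w⁻¹ ∈ d.coset i j := by
    simp only [coset, Set.mem_preimage, TriCyclic.layer, Set.mem_ofPred_eq] at *
    have h2 : ∀ v : Multiplicative (ZMod 2 × ZMod 2), v⁻¹ = v := by decide
    rw [map_inv, map_inv, hw, h2]
  rw [← d.coset_zero_zero]
  ext g
  constructor
  · intro hg
    refine ⟨g * w⁻¹, ?_, inv_mul_cancel_right g w⟩
    have := d.mul_mem_coset hg hw'
    rwa [CharTwo.add_self_eq_zero, CharTwo.add_self_eq_zero] at this
  · rintro ⟨a, ha, rfl⟩
    have := d.mul_mem_coset ha hw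
    rwa [zero_add, zero_add] at this

theorem ncard_kClass_coset {i j : ZMod 2} (hij : (i, j) ≠ (0, 0)) :
    (kClass ℚ '' d.coset i j).ncard = cycCount (TriCyclic.layer n m₂ m₃ i j) := by
  have h1 : d.π '' d.coset i j = TriCyclic.layer n m₂ m₃ i j :=
    Set.image_preimage_eq _ d.π_surjective
  have hnot : ∀ g ∈ d.coset i j, g ∉ Subgroup.center G := by
    intro g hg hc
    have hc : g ∈ d.coset 0 0 := by rw [d.coset_zero_zero]; exact hc
    exact hij (d.coset_disjoint (p := (i, j)) (q := (0, 0)) hg hc)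
  rw [← h1, cycCount, Set.image_image]
  exact ncard_image_congr fun a ha b hb => d.kClass_eq_iff_of_notMem_center (hnot a ha) (hnot b hb)

theorem numKClassesInvolving_eq {w : G} {i j : ZMod 2} (hw : w ∈ d.coset i j)
    (hij : (i, j) ≠ (0, 0)) :
    numKClassesInvolving ℚ w = cycCount (TriCyclic.layer n m₂ m₃ i j) := by
  rw [← d.ncard_kClass_coset hij, d.coset_eq_image hw, Set.image_image]
  rfl

include d in
theorem ncard_kClass_center : (kClass ℚ '' (Subgroup.center G : Set G)).ncard =
    numCyclicSubgroups (Subgroup.center G) := by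
  rw [← cycCount_range (Subgroup.center G).subtype (Subgroup.subtype_injective _)]
  rw [Subgroup.coe_subtype, Subtype.range_coe, cycCount]
  exact ncard_image_congr fun a ha b hb => d.kClass_eq_iff_of_mem_center ha hb

include d in
theorem numCyclicSubgroups_center :
    numCyclicSubgroups (Subgroup.center G) = numCyclicSubgroups (TriCyclic (n + 1) m₂ m₃) := by
  rw [← cycCount_range (Subgroup.center G).subtype (Subgroup.subtype_injective _),
    Subgroup.coe_subtype, Subtype.range_coe, ← cycCount_range d.ι d.ι_injective, ← d.range_ι]
  rfl

include d in
theorem numCyclicSubgroups_ab : numCyclicSubgroups (G ⧸ commutator G) =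
    numCyclicSubgroups (TriCyclic n (m₂ + 1) (m₃ + 1)) :=
  numCyclicSubgroups_congr ((QuotientGroup.quotientMulEquivOfEq d.ker_π.symm).trans
    (QuotientGroup.quotientKerEquivOfSurjective d.π d.π_surjective))

/-- Neither conjugation nor raising to an odd power changes the parities of the image in the
abelianization. -/
theorem disjoint_kClass {p q : ZMod 2 × ZMod 2} (hpq : p ≠ q) :
    Disjoint (kClass ℚ '' d.coset p.1 p.2) (kClass ℚ '' d.coset q.1 q.2) := by
  rw [Set.disjoint_left]
  rintro _ ⟨g, hg, rfl⟩ ⟨h, hh, hgh⟩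
  obtain ⟨r, hr, h1⟩ := d.exists_π_of_mem_kClass (g := g) (h := h) (hgh ▸ d.self_mem_kClass h)
  refine hpq (d.coset_disjoint (g := h) ?_ hh)
  rw [coset, Set.mem_preimage, TriCyclic.layer, Set.mem_ofPred_eq, ← h1,
    TriCyclic.parity_pow_odd _ hr]
  exact hg

theorem numKClasses_eq : numKClasses ℚ G = numCyclicSubgroups (Subgroup.center G) +
    numKClassesInvolving ℚ d.x + numKClassesInvolving ℚ d.y +
    numKClassesInvolving ℚ (d.x * d.y) := by
  have := d.finite
  have hu : (Set.univ : Set G) = d.coset 0 0 ∪ d.coset 1 0 ∪ d.coset 0 1 ∪ d.coset 1 1 := by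
    symm
    rw [Set.eq_univ_iff_forall]
    intro g
    simp only [Set.mem_union, coset, Set.mem_preimage, TriCyclic.mem_layer]
    rcases ZMod.two_cases (ZMod.par m₂ (d.π g).toAdd.2.1) with h | h <;>
    rcases ZMod.two_cases (ZMod.par m₃ (d.π g).toAdd.2.2) with h' | h' <;> simp [h, h']
  have hd := fun p q => d.disjoint_kClass (p := p) (q := q)
  have h1 : Disjoint (kClass ℚ '' d.coset 0 0) (kClass ℚ '' d.coset 1 0) :=
    hd (0, 0) (1, 0) (by decide)
  have h2 : Disjoint (kClass ℚ '' d.coset 0 0) (kClass ℚ '' d.coset 0 1) :=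
    hd (0, 0) (0, 1) (by decide)
  have h3 : Disjoint (kClass ℚ '' d.coset 0 0) (kClass ℚ '' d.coset 1 1) :=
    hd (0, 0) (1, 1) (by decide)
  have h4 : Disjoint (kClass ℚ '' d.coset 1 0) (kClass ℚ '' d.coset 0 1) :=
    hd (1, 0) (0, 1) (by decide)
  have h5 : Disjoint (kClass ℚ '' d.coset 1 0) (kClass ℚ '' d.coset 1 1) :=
    hd (1, 0) (1, 1) (by decide)
  have h6 : Disjoint (kClass ℚ '' d.coset 0 1) (kClass ℚ '' d.coset 1 1) :=
    hd (0, 1) (1, 1) (by decide)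
  rw [numKClasses, ← Set.image_univ, hu, Set.image_union, Set.image_union, Set.image_union,
    Set.ncard_union_eq ((h3.union_left h5).union_left h6), Set.ncard_union_eq (h2.union_left h4),
    Set.ncard_union_eq h1, d.coset_zero_zero, d.ncard_kClass_coset (by decide), d.ncard_kClass_coset (by decide),
    d.ncard_kClass_coset (by decide), d.ncard_kClass_center,
    d.numKClassesInvolving_eq d.x_mem_coset (by decide),
    d.numKClassesInvolving_eq d.y_mem_coset (by decide),
    d.numKClassesInvolving_eq d.xy_mem_coset (by decide)]

end TypeD5

/-! ### Maximal ideals of a commutative group algebra as Galois orbits of characters. -/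

section Characters

variable {K L A : Type*} [Field K] [Field L] [Algebra K L] [CommGroup A]

/-- The algebra homomorphism of the group algebra that extends a character. -/
noncomputable def charHom (K : Type*) {L A : Type*} [Field K] [Field L] [Algebra K L] [CommGroup A]
    (χ : A →* Lˣ) : MonoidAlgebra K A →ₐ[K] L :=
  MonoidAlgebra.lift K L A ((Units.coeHom L).comp χ)

theorem charHom_of (χ : A →* Lˣ) (a : A) : charHom K χ (MonoidAlgebra.of K A a) = χ a :=
  MonoidAlgebra.lift_of _ _

/-- The kernel, in the group algebra, of a character. -/
noncomputable def charKer (K : Type*) {L A : Type*} [Field K] [Field L] [Algebra K L] [CommGroup A]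
    (χ : A →* Lˣ) : Ideal (MonoidAlgebra K A) :=
  RingHom.ker (charHom K χ)

theorem charKer_isMaximal [Finite A] (χ : A →* Lˣ) : (charKer K χ).IsMaximal := by
  have : Module.Finite K (MonoidAlgebra K A) := inferInstance
  have : IsArtinianRing (MonoidAlgebra K A) := IsArtinianRing.of_finite K _
  have : (charKer K χ).IsPrime := RingHom.ker_isPrime _
  exact IsArtinianRing.isMaximal_of_isPrime _

/-- The residue field is finite over `K`, so it embeds in the algebraically closed `L`; the images
of the group elements are the character. -/
theorem exists_charKer_eq [Finite A] [IsAlgClosed L] (m : Ideal (MonoidAlgebra K A))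
    (hm : m.IsMaximal) : ∃ χ : A →* Lˣ, charKer K χ = m := by
  let _ : Field (MonoidAlgebra K A ⧸ m) := Ideal.Quotient.field m
  have : Module.Finite K (MonoidAlgebra K A ⧸ m) :=
    Module.Finite.of_surjective (Ideal.Quotient.mkₐ K m).toLinearMap
      (Ideal.Quotient.mkₐ_surjective K m)
  let f : (MonoidAlgebra K A ⧸ m) →ₐ[K] L := IsAlgClosed.lift
  let g : MonoidAlgebra K A →ₐ[K] L := f.comp (Ideal.Quotient.mkₐ K m)
  refine ⟨((g : MonoidAlgebra K A →* L).comp (MonoidAlgebra.of K A)).toHomUnits, ?_⟩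
  have : charHom K ((g : MonoidAlgebra K A →* L).comp (MonoidAlgebra.of K A)).toHomUnits = g := by
    refine (MonoidAlgebra.lift K L A).symm.injective (MonoidHom.ext fun a => ?_)
    exact charHom_of _ a
  rw [charKer, this]
  ext z
  rw [RingHom.mem_ker]
  change f (Ideal.Quotient.mk m z) = 0 ↔ _
  rw [map_eq_zero_iff f (RingHom.injective f.toRingHom), Ideal.Quotient.eq_zero_iff_mem]

/-- Both characters embed the same residue field in `L`. The isomorphism between the two images
extends to `L` by normality. -/
theorem exists_algEquiv_of_charKer_eq [Finite A] [Normal K L] {χ ψ : A →* Lˣ}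
    (h : charKer K χ = charKer K ψ) : ∃ σ : L ≃ₐ[K] L, ∀ a, σ (χ a) = ψ a := by
  have hm := charKer_isMaximal (K := K) χ
  let _ : Field (MonoidAlgebra K A ⧸ charKer K χ) := Ideal.Quotient.field _
  let f : (MonoidAlgebra K A ⧸ charKer K χ) →ₐ[K] L :=
    Ideal.Quotient.liftₐ _ (charHom K χ) (fun a ha => ha)
  let g : (MonoidAlgebra K A ⧸ charKer K χ) →ₐ[K] L :=
    Ideal.Quotient.liftₐ _ (charHom K ψ) (fun a ha => by rw [h] at ha; exact ha)
  let φ : f.fieldRange ≃ₐ[K] g.fieldRange :=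
    (AlgEquiv.ofInjectiveField f).symm.trans (AlgEquiv.ofInjectiveField g)
  refine ⟨φ.liftNormal L, fun a => ?_⟩
  have h1 := φ.liftNormal_commutes L
    (AlgEquiv.ofInjectiveField f (Ideal.Quotient.mk _ (MonoidAlgebra.of K A a)))
  have h2 : algebraMap f.fieldRange L
      (AlgEquiv.ofInjectiveField f (Ideal.Quotient.mk _ (MonoidAlgebra.of K A a))) = χ a :=
    charHom_of χ a
  rw [h2] at h1
  refine h1.trans ?_
  have h3 : φ (AlgEquiv.ofInjectiveField f (Ideal.Quotient.mk _ (MonoidAlgebra.of K A a))) =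
      AlgEquiv.ofInjectiveField g (Ideal.Quotient.mk _ (MonoidAlgebra.of K A a)) := by
    exact congrArg (AlgEquiv.ofInjectiveField g)
      ((AlgEquiv.ofInjectiveField f).symm_apply_apply _)
  rw [h3]
  exact charHom_of ψ a

theorem charKer_eq_of_algEquiv {χ ψ : A →* Lˣ} (σ : L ≃ₐ[K] L) (h : ∀ a, σ (χ a) = ψ a) :
    charKer K χ = charKer K ψ := by
  have : charHom K ψ = (σ : L →ₐ[K] L).comp (charHom K χ) := by
    refine (MonoidAlgebra.lift K L A).symm.injective (MonoidHom.ext fun a => ?_)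
    change charHom K ψ (MonoidAlgebra.of K A a) = σ (charHom K χ (MonoidAlgebra.of K A a))
    rw [charHom_of, charHom_of, h]
  rw [charKer, charKer, this]
  ext z
  simp [RingHom.mem_ker]

/-- The exponents by which the automorphisms of `L` over `K` act on the roots of unity of order
`2 ^ N`. -/
def galExponents (K L : Type*) [Field K] [Field L] [Algebra K L] (N : ℕ) : Set ℕ :=
  {r | ∃ σ : L ≃ₐ[K] L, ∀ z : L, z ^ 2 ^ N = 1 → σ z = z ^ r}

theorem exists_mem_galExponents {N : ℕ} {ζ : L} (hζ : IsPrimitiveRoot ζ (2 ^ N))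
    (σ : L ≃ₐ[K] L) : ∃ r ∈ galExponents K L N, ∀ z : L, z ^ 2 ^ N = 1 → σ z = z ^ r := by
  have h1 : σ ζ ^ 2 ^ N = 1 := by rw [← map_pow, hζ.pow_eq_one, map_one]
  obtain ⟨r, -, hr⟩ := hζ.eq_pow_of_pow_eq_one h1
  have key : ∀ z : L, z ^ 2 ^ N = 1 → σ z = z ^ r := by
    intro z hz
    obtain ⟨k, -, rfl⟩ := hζ.eq_pow_of_pow_eq_one hz
    rw [map_pow, ← hr, ← pow_mul, ← pow_mul, mul_comm]
  exact ⟨r, ⟨σ, key⟩, key⟩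

/-- Character values are roots of unity of order dividing `2 ^ N`, on which an automorphism acts by
one common exponent. -/
theorem charKer_eq_iff [Finite A] [Normal K L] {N : ℕ} {ζ : L} (hζ : IsPrimitiveRoot ζ (2 ^ N))
    (hA : ∀ a : A, a ^ 2 ^ N = 1) (χ ψ : A →* Lˣ) :
    charKer K χ = charKer K ψ ↔ ∃ r ∈ galExponents K L N, χ ^ r = ψ := by
  have hχ : ∀ (χ : A →* Lˣ) a, (χ a : L) ^ 2 ^ N = 1 := by
    intro χ a
    rw [← Units.val_pow_eq_pow_val, ← map_pow, hA, map_one, Units.val_one]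
  constructor
  · intro h
    obtain ⟨σ, hσ⟩ := exists_algEquiv_of_charKer_eq h
    obtain ⟨r, hr, h1⟩ := exists_mem_galExponents hζ σ
    refine ⟨r, hr, ?_⟩
    ext a
    rw [← hσ a, h1 _ (hχ χ a)]
    rfl
  · rintro ⟨r, ⟨σ, hσ⟩, rfl⟩
    refine charKer_eq_of_algEquiv σ fun a => ?_
    rw [hσ _ (hχ χ a)]
    rfl

theorem odd_of_mem_galExponents {N : ℕ} {ζ : L} (hζ : IsPrimitiveRoot ζ (2 ^ (N + 1))) {r : ℕ}
    (hr : r ∈ galExponents K L (N + 1)) : Odd r := by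
  obtain ⟨σ, hσ⟩ := hr
  have h1 := hζ.map_of_injective σ.injective
  rw [hσ ζ hζ.pow_eq_one, hζ.pow_iff_coprime (by positivity),
    Nat.coprime_pow_right_iff N.succ_pos, Nat.coprime_two_right] at h1
  exact h1

theorem exists_isPrimitiveRoot_two_pow [IsAlgClosed L] (h2 : (2 : K) ≠ 0) (N : ℕ) :
    ∃ ζ : L, IsPrimitiveRoot ζ (2 ^ N) := by
  have : NeZero ((2 : ℕ) : L) := ⟨by
    rw [Nat.cast_ofNat, ← map_ofNat (algebraMap K L) 2]
    exact (map_ne_zero _).2 h2⟩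
  have : HasEnoughRootsOfUnity L (2 ^ N) := inferInstance
  exact HasEnoughRootsOfUnity.exists_primitiveRoot L (2 ^ N)

theorem nonempty_character_equiv [IsAlgClosed L] [Finite A] (h2 : (2 : K) ≠ 0) {N : ℕ}
    (hA : ∀ a : A, a ^ 2 ^ N = 1) : Nonempty ((A →* Lˣ) ≃* A) := by
  have : NeZero ((2 : ℕ) : L) := ⟨by
    rw [Nat.cast_ofNat, ← map_ofNat (algebraMap K L) 2]
    exact (map_ne_zero _).2 h2⟩
  have : HasEnoughRootsOfUnity L (2 ^ N) := inferInstance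
  have : HasEnoughRootsOfUnity L (Monoid.exponent A) :=
    HasEnoughRootsOfUnity.of_dvd L (Monoid.exponent_dvd_of_forall_pow_eq_one hA)
  exact CommGroup.monoidHom_mulEquiv_of_hasEnoughRootsOfUnity A L

/-- Over the rationals the automorphisms act by all odd exponents. -/
theorem mem_galExponents_of_odd {N : ℕ} [Normal K L] [CharZero K]
    (hirr : Irreducible (Polynomial.cyclotomic (2 ^ N) K)) {ζ : L}
    (hζ : IsPrimitiveRoot ζ (2 ^ N)) {r : ℕ} (hr : Odd r) : r ∈ galExponents K L N := by
  have : NeZero ((2 ^ N : ℕ) : K) := ⟨Nat.cast_ne_zero.2 (by positivity)⟩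
  -- Both are primitive `2 ^ N`-th roots of unity, so the cyclotomic polynomial is their common
  -- minimal polynomial.
  have h1 : IsConjRoot K ζ (ζ ^ r) := by
    rw [isConjRoot_def, ← hζ.minpoly_eq_cyclotomic_of_irreducible hirr,
      ← (hζ.pow_of_coprime r (Nat.Coprime.pow_right N
        (Nat.coprime_two_right.2 hr))).minpoly_eq_cyclotomic_of_irreducible hirr]
  obtain ⟨σ, hσ⟩ := isConjRoot_iff_exists_algEquiv.1 h1.symm
  refine ⟨σ, fun z hz => ?_⟩
  obtain ⟨k, -, rfl⟩ := hζ.eq_pow_of_pow_eq_one hz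
  rw [map_pow, hσ, ← pow_mul, ← pow_mul, mul_comm]

/-- The characters that are `-1` on `s` are those whose kernel contains `s + 1`. -/
theorem of_add_one_mem_charKer_iff (χ : A →* Lˣ) (s : A) :
    MonoidAlgebra.of K A s + 1 ∈ charKer K χ ↔ χ s = -1 := by
  rw [charKer, RingHom.mem_ker, map_add, charHom_of, map_one, Units.ext_iff, Units.val_neg,
    Units.val_one, eq_neg_iff_add_eq_zero]

theorem setOf_isMaximal_eq [Finite A] [IsAlgClosed L] :
    {m : Ideal (MonoidAlgebra K A) | m.IsMaximal} =
      charKer K '' (Set.univ : Set (A →* Lˣ)) := by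
  ext m
  constructor
  · intro hm
    obtain ⟨χ, rfl⟩ := exists_charKer_eq (L := L) m hm
    exact ⟨χ, trivial, rfl⟩
  · rintro ⟨χ, -, rfl⟩
    exact charKer_isMaximal χ

theorem setOf_isMaximal_and_mem_eq [Finite A] [IsAlgClosed L] (s : A) :
    {m : Ideal (MonoidAlgebra K A) | m.IsMaximal ∧ MonoidAlgebra.of K A s + 1 ∈ m} =
      charKer K '' {χ : A →* Lˣ | χ s = -1} := by
  ext m
  constructor
  · rintro ⟨hm, hs⟩
    obtain ⟨χ, rfl⟩ := exists_charKer_eq (L := L) m hm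
    exact ⟨χ, (of_add_one_mem_charKer_iff χ s).1 hs, rfl⟩
  · rintro ⟨χ, hχ, rfl⟩
    exact ⟨charKer_isMaximal χ, (of_add_one_mem_charKer_iff χ s).2 hχ⟩

end Characters

/-! ### Classes under a set of odd exponents, compared with cyclic subgroups. -/

section ClassCount

variable {B I : Type*} [CommGroup B] [Finite B] {N : ℕ} (hB : ∀ b : B, b ^ 2 ^ N = 1)
  {cls : B → I} {S : Set ℕ} (hcls : ∀ a b, cls a = cls b ↔ ∃ r ∈ S, a ^ r = b)
  (hodd : ∀ r ∈ S, Odd r) {X : Set B} (hX : ∀ a ∈ X, ∀ r, Odd r → a ^ r ∈ X)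

omit [Finite B] in
include hB hcls hodd in
theorem zpowers_eq_of_cls_eq {a b : B} (h : cls a = cls b) :
    Subgroup.zpowers a = Subgroup.zpowers b := by
  obtain ⟨r, hr, rfl⟩ := (hcls a b).1 h
  exact (zpowers_eq_zpowers_iff_odd (hB a)).2 ⟨r, hodd r hr, rfl⟩

omit [Finite B] in
include hB hcls hodd in
theorem ncard_cls_of_forall_odd (hall : ∀ r, Odd r → r ∈ S) (X : Set B) :
    (cls '' X).ncard = cycCount X :=
  ncard_image_congr fun a _ b _ => ⟨zpowers_eq_of_cls_eq hB hcls hodd, fun h => by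
    obtain ⟨r, hr, rfl⟩ := (zpowers_eq_zpowers_iff_odd (hB a)).1 h
    exact (hcls _ _).2 ⟨r, hall r hr, rfl⟩⟩

omit [Finite B] in
theorem pow_four_ne_one_of_zpowers_eq {a b : B}
    (h : Subgroup.zpowers a = Subgroup.zpowers b) (hb : b ^ 4 ≠ 1) : a ^ 4 ≠ 1 := by
  intro ha
  obtain ⟨k, rfl⟩ := Subgroup.mem_zpowers_iff.1 (h ▸ Subgroup.mem_zpowers b)
  apply hb
  rw [← zpow_natCast, ← zpow_mul, mul_comm, zpow_mul, zpow_natCast, ha, one_zpow]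

omit [Finite B] in
include hB in
theorem eight_dvd_orderOf {a : B} (ha : a ^ 4 ≠ 1) : 8 ∣ orderOf a := by
  obtain ⟨k, -, hk⟩ := (Nat.dvd_prime_pow Nat.prime_two).1 (orderOf_dvd_of_pow_eq_one (hB a))
  rw [hk]
  rcases Nat.lt_or_ge k 3 with h | h
  · refine absurd (orderOf_dvd_iff_pow_eq_one.1 ?_) ha
    rw [hk]
    exact pow_dvd_pow 2 (show k ≤ 2 by omega)
  · exact pow_dvd_pow 2 h

include hB hcls hodd hX in
-- Each class lies among the generators of one cyclic subgroup. When the order is divisible by 8, a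
-- generator and its `r₀`-th power lie in different classes, since `r₀` is not congruent modulo 8 to
-- any element of `S`. The two further conditions say that `S` and `r₀ * S` exhaust the odd
-- residues, and that `S` alone does so modulo 4; then no other classes exist.
theorem ncard_cls_aux {r₀ : ℕ} (hr₀ : Odd r₀) (hS : ∀ r ∈ S, ¬ r ≡ r₀ [MOD 8]) :
    cycCount X + cycCount (X ∩ {a | a ^ 4 ≠ 1}) ≤ (cls '' X).ncard ∧
      ((∀ r, Odd r → ∃ r' ∈ S, r ≡ r' [MOD 2 ^ N] ∨ r ≡ r₀ * r' [MOD 2 ^ N]) →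
        (∀ r, Odd r → ∃ r' ∈ S, r ≡ r' [MOD 4]) →
        (cls '' X).ncard = cycCount X + cycCount (X ∩ {a | a ^ 4 ≠ 1})) := by
  classical
  set Y : Set B := X ∩ {a | a ^ 4 ≠ 1} with hY
  have hsub : Subgroup.zpowers '' Y ⊆ Subgroup.zpowers '' X :=
    Set.image_mono Set.inter_subset_left
  -- One generator in `X` is chosen for each subgroup that has one; elsewhere the value is a dummy.
  -- `T₁` consists of the classes of these generators, and `T₂` of the classes of their `r₀`-th
  -- powers when the order is divisible by 8.
  have key : ∀ C : Subgroup B, ∃ a, C ∈ Subgroup.zpowers '' X →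
      a ∈ X ∧ Subgroup.zpowers a = C := by
    intro C
    by_cases hC : C ∈ Subgroup.zpowers '' X
    · obtain ⟨a, ha, rfl⟩ := hC
      exact ⟨a, fun _ => ⟨ha, rfl⟩⟩
    · exact ⟨1, fun h => absurd h hC⟩
  choose rep hrep using key
  set T₁ := (fun C => cls (rep C)) '' (Subgroup.zpowers '' X) with hT₁
  set T₂ := (fun C => cls (rep C ^ r₀)) '' (Subgroup.zpowers '' Y) with hT₂
  have hpow : ∀ a : B, Subgroup.zpowers (a ^ r₀) = Subgroup.zpowers a := fun a =>
    ((zpowers_eq_zpowers_iff_odd (hB a)).2 ⟨r₀, hr₀, rfl⟩).symm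
  have h1 : T₁.ncard = cycCount X := by
    refine Set.InjOn.ncard_image ?_
    intro C hC D hD hCD
    have := zpowers_eq_of_cls_eq hB hcls hodd hCD
    rwa [(hrep C hC).2, (hrep D hD).2] at this
  have h2 : T₂.ncard = cycCount Y := by
    refine Set.InjOn.ncard_image ?_
    intro C hC D hD hCD
    have := zpowers_eq_of_cls_eq hB hcls hodd hCD
    rwa [hpow, hpow, (hrep C (hsub hC)).2, (hrep D (hsub hD)).2] at this
  have hdisj : Disjoint T₁ T₂ := by
    rw [Set.disjoint_left]
    rintro _ ⟨C, hC, rfl⟩ ⟨D, hD, hCD⟩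
    have h3 := zpowers_eq_of_cls_eq hB hcls hodd hCD.symm
    rw [hpow, (hrep C hC).2, (hrep D (hsub hD)).2] at h3
    subst h3
    obtain ⟨r, hr, h4⟩ := (hcls _ _).1 hCD.symm
    obtain ⟨y, hy, h5⟩ := hD
    have h6 : rep C ^ 4 ≠ 1 :=
      pow_four_ne_one_of_zpowers_eq ((hrep C hC).2.trans h5.symm) hy.2
    exact hS r hr ((pow_eq_pow_iff_modEq.1 h4).of_dvd (eight_dvd_orderOf hB h6))
  have hfin₁ : T₁.Finite := (Set.toFinite _).image _
  have hfin₂ : T₂.Finite := (Set.toFinite _).image _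
  have hle : T₁ ∪ T₂ ⊆ cls '' X := by
    rintro _ (⟨C, hC, rfl⟩ | ⟨C, hC, rfl⟩)
    · exact ⟨_, (hrep C hC).1, rfl⟩
    · exact ⟨_, hX _ (hrep C (hsub hC)).1 _ hr₀, rfl⟩
  rw [← h1, ← h2, ← Set.ncard_union_eq hdisj hfin₁ hfin₂]
  refine ⟨Set.ncard_le_ncard hle ((Set.toFinite _).image _), fun H1 H2 => ?_⟩
  congr 1
  refine Set.Subset.antisymm ?_ hle
  rintro _ ⟨b, hb, rfl⟩
  have hC : Subgroup.zpowers b ∈ Subgroup.zpowers '' X := ⟨b, hb, rfl⟩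
  obtain ⟨-, ha⟩ := hrep _ hC
  obtain ⟨r, hr, hrb⟩ := (zpowers_eq_zpowers_iff_odd (hB _)).1 ha
  by_cases h4 : rep (Subgroup.zpowers b) ^ 4 = 1
  · obtain ⟨r', hr', hm⟩ := H2 r hr
    refine Or.inl ⟨_, hC, (hcls _ _).2 ⟨r', hr', ?_⟩⟩
    refine Eq.trans ?_ hrb
    exact pow_eq_pow_iff_modEq.2 (hm.symm.of_dvd (orderOf_dvd_of_pow_eq_one h4))
  · obtain ⟨r', hr', hm | hm⟩ := H1 r hr
    · refine Or.inl ⟨_, hC, (hcls _ _).2 ⟨r', hr', ?_⟩⟩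
      refine Eq.trans ?_ hrb
      exact pow_eq_pow_iff_modEq.2 (hm.symm.of_dvd (orderOf_dvd_of_pow_eq_one (hB _)))
    · refine Or.inr ⟨_, ⟨b, ⟨hb, pow_four_ne_one_of_zpowers_eq ha.symm h4⟩, rfl⟩,
        (hcls _ _).2 ⟨r', hr', ?_⟩⟩
      refine Eq.trans ?_ hrb
      rw [← pow_mul]
      exact pow_eq_pow_iff_modEq.2 (hm.symm.of_dvd (orderOf_dvd_of_pow_eq_one (hB _)))

end ClassCount

/-! ### Galois action on 2-power roots of unity over a finite field. -/

section FiniteField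

variable {K L : Type*} [Field K] [Finite K] [Field L] [Algebra K L]

/-- The polynomial `X ^ q - X` already splits over `K`, so it has no further roots in `L`. -/
theorem FiniteField.mem_range_of_pow_card_eq {c : L} (hc : c ^ Nat.card K = c) :
    c ∈ Set.range (algebraMap K L) := by
  classical
  have := Fintype.ofFinite K
  have hmon : (Polynomial.X ^ Fintype.card K - Polynomial.X : Polynomial K).Monic :=
    Polynomial.monic_X_pow_sub (by
      rw [Polynomial.degree_X]
      exact_mod_cast Fintype.one_lt_card)
  have h1 := Polynomial.prod_multiset_X_sub_C_of_monic_of_roots_card_eq hmon (by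
    rw [FiniteField.roots_X_pow_card_sub_X,
      FiniteField.X_pow_card_sub_X_natDegree_eq K Fintype.one_lt_card]
    rfl)
  rw [FiniteField.roots_X_pow_card_sub_X] at h1
  have h2 := congrArg (Polynomial.aeval c) h1
  rw [map_sub, map_pow, Polynomial.aeval_X, ← Nat.card_eq_fintype_card, hc, sub_self] at h2
  change Polynomial.aeval c (∏ a : K, (Polynomial.X - Polynomial.C a)) = 0 at h2
  rw [map_prod, Finset.prod_eq_zero_iff] at h2
  obtain ⟨a, -, ha⟩ := h2
  rw [map_sub, Polynomial.aeval_X, Polynomial.aeval_C] at ha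
  exact ⟨a, (sub_eq_zero.1 ha).symm⟩

theorem FiniteField.exists_frobenius [Algebra.IsAlgebraic K L] :
    ∃ τ : L ≃ₐ[K] L, ∀ z, τ z = z ^ Nat.card K := by
  have := Fintype.ofFinite K
  refine ⟨FiniteField.frobeniusAlgEquivOfAlgebraic K L, fun z => ?_⟩
  rw [FiniteField.coe_frobeniusAlgEquivOfAlgebraic, Nat.card_eq_fintype_card]

/-- Let `η` be a primitive eighth root of unity. As `q ^ 2 ≡ 1` modulo 8, Frobenius interchanges `η`
and `η ^ q`, so their sum and product lie in `K`. Every automorphism then sends `η` to a root of the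
same quadratic polynomial. -/
theorem FiniteField.mod_eight_of_mem_galExponents [Algebra.IsAlgebraic K L]
    (hq : Odd (Nat.card K)) {N : ℕ} {ζ : L} (hζ : IsPrimitiveRoot ζ (2 ^ (N + 3))) {r : ℕ}
    (hr : r ∈ galExponents K L (N + 3)) : r ≡ 1 [MOD 8] ∨ r ≡ Nat.card K [MOD 8] := by
  set q := Nat.card K with hqdef
  obtain ⟨σ, hσ⟩ := hr
  obtain ⟨τ, hτ⟩ := FiniteField.exists_frobenius (K := K) (L := L)
  set η := ζ ^ 2 ^ N with hη
  have hη8 : IsPrimitiveRoot η 8 := hζ.pow (by positivity) (by rw [pow_add]; norm_num)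
  have hord : orderOf η = 8 := hη8.eq_orderOf.symm
  have hfin : IsOfFinOrder η := orderOf_pos_iff.1 (by omega)
  have hση : σ η = η ^ r := hσ η (by
    rw [pow_add, mul_comm, pow_mul, show 2 ^ 3 = 8 by norm_num, hη8.pow_eq_one, one_pow])
  have hqq : η ^ (q * q) = η := by
    conv_rhs => rw [← pow_one η]
    rw [hfin.pow_eq_pow_iff_modEq, hord]
    have : q % 8 = 1 ∨ q % 8 = 3 ∨ q % 8 = 5 ∨ q % 8 = 7 := by
      obtain ⟨k, hk⟩ := hq
      omega
    rw [Nat.ModEq, Nat.mul_mod]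
    rcases this with h | h | h | h <;> rw [h]
  have hτη : τ (η ^ q) = η := by rw [hτ, ← pow_mul, hqq]
  obtain ⟨c₁, hc₁⟩ := FiniteField.mem_range_of_pow_card_eq (K := K) (c := η + η ^ q)
    (by rw [← hτ, map_add, hτη, hτ, add_comm])
  obtain ⟨c₂, hc₂⟩ := FiniteField.mem_range_of_pow_card_eq (K := K) (c := η * η ^ q)
    (by rw [← hτ, map_mul, hτη, hτ, mul_comm])
  have h0 : (σ η - η) * (σ η - η ^ q) = 0 := by
    have h1 : σ η * σ η - algebraMap K L c₁ * σ η + algebraMap K L c₂ = 0 := by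
      rw [← σ.commutes c₁, ← σ.commutes c₂, ← map_mul, ← map_mul, ← map_sub, ← map_add, hc₁, hc₂]
      rw [show η * η - (η + η ^ q) * η + η * η ^ q = 0 by ring, map_zero]
    rw [hc₁, hc₂] at h1
    linear_combination h1
  rw [hση] at h0
  rcases mul_eq_zero.1 h0 with h | h
  · left
    rw [← hord, ← hfin.pow_eq_pow_iff_modEq, pow_one]
    exact sub_eq_zero.1 h
  · right
    rw [← hord, ← hfin.pow_eq_pow_iff_modEq]
    exact sub_eq_zero.1 h

theorem exists_pow_two_pow_eq {q : ℤ} (hq : q % 8 = 3) (k : ℕ) :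
    ∃ u : ℤ, Odd u ∧ q ^ 2 ^ (k + 1) = 1 + 2 ^ (k + 3) * u := by
  induction k with
  | zero =>
    obtain ⟨j, hj⟩ : ∃ j, q = 8 * j + 3 := ⟨q / 8, by omega⟩
    refine ⟨2 * (4 * j ^ 2 + 3 * j) + 1, odd_two_mul_add_one _, ?_⟩
    rw [hj]
    ring
  | succ k ih =>
    obtain ⟨u, hu, h⟩ := ih
    obtain ⟨j, hj⟩ := hu
    refine ⟨u + 2 ^ (k + 2) * u ^ 2, ?_, ?_⟩
    · refine Odd.add_even ⟨j, hj⟩ ?_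
      exact (Even.mul_right (Even.pow_of_ne_zero even_two (by omega)) _)
    · rw [pow_succ 2 (k + 1), pow_mul, h]
      ring

/-- Lifting from one power of 2 to the next: if the error `t` is odd, multiplying by `q ^ 2 ^ (N +
1)`, which is `1 + 2 ^ (N + 3) * u` with `u` odd, makes it even. Thus the powers of `q` fill the
residues congruent to 1 or 3 modulo 8. -/
theorem exists_pow_modEq {q : ℤ} (hq : q % 8 = 3) (N : ℕ) (r : ℤ)
    (hr : r % 8 = 1 ∨ r % 8 = 3) : ∃ i : ℕ, (2 : ℤ) ^ (N + 3) ∣ q ^ i - r := by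
  induction N with
  | zero =>
    rcases hr with hr | hr
    · exact ⟨0, by norm_num; omega⟩
    · exact ⟨1, by norm_num; omega⟩
  | succ N ih =>
    obtain ⟨i, t, ht⟩ := ih
    rcases Int.even_or_odd t with ⟨j, hj⟩ | hto
    · refine ⟨i, j, ?_⟩
      rw [ht, hj]
      ring
    · obtain ⟨u, hu, h⟩ := exists_pow_two_pow_eq hq N
      have hro : Odd r := by rw [Int.odd_iff]; omega
      obtain ⟨j, hj⟩ := hto.add_odd (hro.mul hu)
      refine ⟨i + 2 ^ (N + 1), j + 2 ^ (N + 2) * t * u, ?_⟩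
      rw [pow_add, h, eq_add_of_sub_eq ht]
      linear_combination 2 ^ (N + 3) * hj

theorem FiniteField.mem_galExponents_of_mod_eight [Algebra.IsAlgebraic K L]
    (hq : Nat.card K ≡ 3 [MOD 8]) (N : ℕ) {r : ℕ} (hr : r % 8 = 1 ∨ r % 8 = 3) :
    r ∈ galExponents K L (N + 3) := by
  obtain ⟨τ, hτ⟩ := FiniteField.exists_frobenius (K := K) (L := L)
  have hq' : ((Nat.card K : ℕ) : ℤ) % 8 = 3 := by
    have : Nat.card K % 8 = 3 := hq
    omega
  obtain ⟨i, hi⟩ := exists_pow_modEq hq' N r (by omega)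
  have hm : r ≡ Nat.card K ^ i [MOD 2 ^ (N + 3)] := by
    rw [Nat.modEq_iff_dvd]
    exact_mod_cast hi
  have hpow : ∀ (i : ℕ) (z : L), (τ ^ i) z = z ^ Nat.card K ^ i := by
    intro i z
    induction i with
    | zero => simp
    | succ i ih => rw [pow_succ', AlgEquiv.mul_apply, ih, hτ, ← pow_mul, ← pow_succ]
  refine ⟨τ ^ i, fun z hz => ?_⟩
  rw [hpow]
  exact pow_eq_pow_of_modEq hm.symm hz

end FiniteField

/-! ### The numbers of maximal ideals, over the rationals and over finite fields. -/

/-- The number of maximal ideals of the group algebra `K[A]`. -/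
noncomputable def numMaximal (K A : Type*) [Field K] [CommGroup A] : ℕ :=
  {m : Ideal (MonoidAlgebra K A) | m.IsMaximal}.ncard

/-- The number of maximal ideals of the group algebra `K[A]` that contain `s + 1`. -/
noncomputable def numMaximalNeg (K : Type*) {A : Type*} [Field K] [CommGroup A] (s : A) : ℕ :=
  {m : Ideal (MonoidAlgebra K A) | m.IsMaximal ∧ MonoidAlgebra.of K A s + 1 ∈ m}.ncard

section Dual

variable {K L A A₁ : Type*} [Field K] [Field L] [Algebra K L] [IsAlgClosed L] [CommGroup A]
  [Finite A] [CommGroup A₁] [Finite A₁] (h2 : (2 : K) ≠ 0) {N : ℕ} (hA : ∀ a : A, a ^ 2 ^ N = 1)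

include h2 hA in
theorem finite_dual : Finite (A →* Lˣ) := by
  obtain ⟨e⟩ := nonempty_character_equiv (L := L) h2 hA
  exact Finite.of_equiv A e.symm.toEquiv

omit [IsAlgClosed L] [Finite A] in
include hA in
theorem dual_pow_eq_one (χ : A →* Lˣ) : χ ^ 2 ^ N = 1 := by
  ext a
  rw [MonoidHom.pow_apply, ← map_pow, hA, map_one, MonoidHom.one_apply]

include h2 hA in
theorem numCyclicSubgroups_dual : numCyclicSubgroups (A →* Lˣ) = numCyclicSubgroups A := by
  obtain ⟨e⟩ := nonempty_character_equiv (L := L) h2 hA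
  exact numCyclicSubgroups_congr e

include h2 hA in
theorem cycCount_dual_pow_four :
    cycCount {χ : A →* Lˣ | χ ^ 4 = 1} = cycCount {a : A | a ^ 4 = 1} := by
  obtain ⟨e⟩ := nonempty_character_equiv (L := L) h2 hA
  rw [← cycCount_image (e : (A →* Lˣ) →* A) e.injective]
  congr 1
  ext a
  constructor
  · rintro ⟨χ, hχ, rfl⟩
    have hχ : χ ^ 4 = 1 := hχ
    change e χ ^ 4 = 1
    rw [← map_pow, hχ, map_one]
  · intro ha
    refine ⟨e.symm a, ?_, e.apply_symm_apply a⟩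
    have ha : a ^ 4 = 1 := ha
    rw [Set.mem_ofPred_eq, ← map_pow, ha, map_one]

include h2 hA in
-- A character is `1` or `-1` on `s`, and those with value `1` are exactly the characters of the
-- quotient `A₁`. Odd powers keep the value, so no cyclic subgroup is counted on both sides.
theorem cycCount_dual_neg {s : A} (hs : s * s = 1) (μ : A →* A₁) (hμ : Function.Surjective μ)
    (hμs : μ s = 1) (hker : ∀ a, μ a = 1 → a = 1 ∨ a = s) :
    cycCount {χ : A →* Lˣ | χ s = -1} + numCyclicSubgroups A₁ = numCyclicSubgroups A := by
  have := finite_dual (L := L) h2 hA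
  have h2L : (2 : L) ≠ 0 := by
    rw [← map_ofNat (algebraMap K L) 2]
    exact (map_ne_zero _).2 h2
  have hA₁ : ∀ a : A₁, a ^ 2 ^ N = 1 := by
    intro a
    obtain ⟨b, rfl⟩ := hμ a
    rw [← map_pow, hA, map_one]
  have hne : (1 : Lˣ) ≠ -1 := by
    intro h
    have h : (1 : L) = -1 := congrArg Units.val h
    apply h2L
    linear_combination h
  let f : (A₁ →* Lˣ) →* (A →* Lˣ) := MonoidHom.compHom' μ
  have hf : Function.Injective f := fun χ ψ h => (MonoidHom.cancel_right hμ).1 h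
  have hrange : Set.range f = {χ : A →* Lˣ | χ s = 1} := by
    ext χ
    constructor
    · rintro ⟨ψ, rfl⟩
      change ψ (μ s) = 1
      rw [hμs, map_one]
    · intro hχ
      have hle : μ.ker ≤ χ.ker := by
        intro a ha
        rcases hker a ha with rfl | rfl
        · exact one_mem _
        · exact hχ
      refine ⟨μ.liftOfSurjective hμ ⟨χ, hle⟩, ?_⟩
      exact MonoidHom.liftOfRightInverse_comp _ _ (Function.rightInverse_surjInv hμ) _
  have hu : (Set.univ : Set (A →* Lˣ)) = {χ | χ s = -1} ∪ Set.range f := by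
    rw [hrange]
    symm
    rw [Set.eq_univ_iff_forall]
    intro χ
    have h1 : (χ s : L) * χ s = 1 := by
      rw [← Units.val_mul, ← map_mul, hs, map_one, Units.val_one]
    rcases mul_self_eq_one_iff.1 h1 with h | h
    · exact Or.inr (Units.ext h)
    · exact Or.inl (Units.ext h)
  rw [← numCyclicSubgroups_dual (L := L) h2 hA, ← numCyclicSubgroups_dual (L := L) h2 hA₁,
    ← cycCount_univ (A →* Lˣ), hu, cycCount_union, cycCount_range f hf]
  intro χ hχ ψ hψ h
  rw [hrange] at hψ
  have hχ : χ s = -1 := hχ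
  have hψ : ψ s = 1 := hψ
  obtain ⟨r, hr, rfl⟩ := (zpowers_eq_zpowers_iff_odd (dual_pow_eq_one hA χ)).1 h
  rw [MonoidHom.pow_apply, hχ, hr.neg_one_pow] at hψ
  exact hne hψ.symm

end Dual

section Count

variable (K : Type v) {A A₁ : Type*} [Field K] [CommGroup A] [Finite A] [CommGroup A₁] [Finite A₁]
  {N : ℕ} (hA : ∀ a : A, a ^ 2 ^ (N + 3) = 1)

section Irreducible

variable [CharZero K] (hirr : Irreducible (Polynomial.cyclotomic (2 ^ (N + 3)) K))

include hA hirr in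
theorem ncard_charKer_of_irreducible (X : Set (A →* (AlgebraicClosure K)ˣ)) :
    (charKer K '' X).ncard = cycCount X := by
  obtain ⟨ζ, hζ⟩ := exists_isPrimitiveRoot_two_pow (L := AlgebraicClosure K)
    (two_ne_zero : (2 : K) ≠ 0) (N + 3)
  exact ncard_cls_of_forall_odd (dual_pow_eq_one hA) (charKer_eq_iff hζ hA)
    (fun r hr => odd_of_mem_galExponents hζ hr)
    (fun r hr => mem_galExponents_of_odd hirr hζ hr) X

include hA hirr in
theorem numMaximal_of_irreducible : numMaximal K A = numCyclicSubgroups A := by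
  rw [numMaximal, setOf_isMaximal_eq (L := AlgebraicClosure K),
    ncard_charKer_of_irreducible K hA hirr, cycCount_univ,
    numCyclicSubgroups_dual (two_ne_zero : (2 : K) ≠ 0) hA]

include hA hirr in
theorem numMaximalNeg_of_irreducible {s : A} (hs : s * s = 1) (μ : A →* A₁)
    (hμ : Function.Surjective μ) (hμs : μ s = 1) (hker : ∀ a, μ a = 1 → a = 1 ∨ a = s) :
    numMaximalNeg K s + numCyclicSubgroups A₁ = numCyclicSubgroups A := by
  rw [numMaximalNeg, setOf_isMaximal_and_mem_eq (L := AlgebraicClosure K),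
    ncard_charKer_of_irreducible K hA hirr]
  exact cycCount_dual_neg (two_ne_zero : (2 : K) ≠ 0) hA hs μ hμ hμs hker

end Irreducible

section Finite

variable [Finite K] (hq : Odd (Nat.card K))

include hq in
theorem FiniteField.two_ne_zero_of_odd_card : (2 : K) ≠ 0 := by
  have := Fintype.ofFinite K
  intro h
  have h1 := FiniteField.cast_card_eq_zero K
  rw [← Nat.card_eq_fintype_card] at h1
  obtain ⟨k, hk⟩ := hq
  rw [hk] at h1
  push_cast at h1
  rw [h, zero_mul, zero_add] at h1
  exact one_ne_zero h1

include hA hq in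
theorem ncard_charKer_of_finite {X : Set (A →* (AlgebraicClosure K)ˣ)}
    (hX : ∀ a ∈ X, ∀ r, Odd r → a ^ r ∈ X) :
    cycCount X + cycCount (X ∩ {a | a ^ 4 ≠ 1}) ≤ (charKer K '' X).ncard ∧
      (Nat.card K ≡ 3 [MOD 8] →
        (charKer K '' X).ncard = cycCount X + cycCount (X ∩ {a | a ^ 4 ≠ 1})) := by
  have h2 := FiniteField.two_ne_zero_of_odd_card K hq
  obtain ⟨ζ, hζ⟩ := exists_isPrimitiveRoot_two_pow (L := AlgebraicClosure K) h2 (N + 3)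
  have := finite_dual (L := AlgebraicClosure K) h2 hA
  have hodd : ∀ r ∈ galExponents K (AlgebraicClosure K) (N + 3), Odd r :=
    fun r hr => odd_of_mem_galExponents hζ hr
  have hmod : ∀ r ∈ galExponents K (AlgebraicClosure K) (N + 3), r % 8 = 1 ∨
      r % 8 = Nat.card K % 8 := fun r hr => FiniteField.mod_eight_of_mem_galExponents hq hζ hr
  constructor
  -- Modulo 8 the Galois exponents lie in `{1, q}`, so `5` is missed if `q ≡ 3`, and `3` is missed
  -- otherwise.
  · obtain ⟨r₀, hr₀, hS⟩ : ∃ r₀, Odd r₀ ∧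
        ∀ r ∈ galExponents K (AlgebraicClosure K) (N + 3), ¬ r ≡ r₀ [MOD 8] := by
      by_cases h : Nat.card K % 8 = 3
      · refine ⟨5, by decide, fun r hr h5 => ?_⟩
        have h5 : r % 8 = 5 := h5
        have := hmod r hr
        omega
      · refine ⟨3, by decide, fun r hr h3 => ?_⟩
        have h3 : r % 8 = 3 := h3
        have := hmod r hr
        omega
    exact (ncard_cls_aux (dual_pow_eq_one hA) (charKer_eq_iff hζ hA) hodd hX hr₀ hS).1
  · intro hq3
    have h3 : Nat.card K % 8 = 3 := hq3
    obtain ⟨M, hM⟩ : ∃ M, 2 ^ (N + 3) = 8 * (M + 1) :=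
      ⟨2 ^ N - 1, by rw [Nat.sub_add_cancel Nat.one_le_two_pow, pow_add]; ring⟩
    have hmem : ∀ r : ℕ, r % 8 = 1 ∨ r % 8 = 3 → r ∈ galExponents K (AlgebraicClosure K) (N + 3) :=
      fun r hr => FiniteField.mem_galExponents_of_mod_eight hq3 N hr
    -- Here `8 * M + 7` is `-1` modulo `2 ^ (N + 3)`. The residues 1 and 3 modulo 8 are Galois
    -- exponents, and negation carries them to 7 and 5.
    refine (ncard_cls_aux (dual_pow_eq_one hA) (charKer_eq_iff hζ hA) hodd hX
      (r₀ := 8 * M + 7) ⟨4 * M + 3, by ring⟩ ?_).2 ?_ ?_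
    · intro r hr h7
      have h7 : r % 8 = (8 * M + 7) % 8 := h7
      have := hmod r hr
      omega
    · intro r hr
      have h8 : r % 8 = 1 ∨ r % 8 = 3 ∨ r % 8 = 5 ∨ r % 8 = 7 := by
        obtain ⟨k, hk⟩ := hr
        omega
      rcases h8 with h | h | h | h
      · exact ⟨r, hmem r (Or.inl h), Or.inl rfl⟩
      · exact ⟨r, hmem r (Or.inr h), Or.inl rfl⟩
      all_goals
        refine ⟨(8 * M + 7) * r, hmem _ ?_, Or.inr ?_⟩
        · rw [Nat.mul_mod, h, Nat.mul_add_mod]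
          norm_num
        · rw [hM, ← mul_assoc]
          have : (8 * M + 7) * (8 * M + 7) ≡ 1 [MOD 8 * (M + 1)] := by
            rw [show (8 * M + 7) * (8 * M + 7) = 1 + 8 * (M + 1) * (8 * M + 6) by ring]
            exact (Nat.modEq_iff_dvd' (by omega)).2 (by simp) |>.symm
          simpa using (this.mul_right r).symm
    · intro r hr
      have h4 : r % 4 = 1 ∨ r % 4 = 3 := by
        obtain ⟨k, hk⟩ := hr
        omega
      rcases h4 with h | h
      · exact ⟨1, hmem 1 (Or.inl rfl), h⟩
      · exact ⟨3, hmem 3 (Or.inr rfl), h⟩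

include hA hq in
-- Cyclic subgroups of order divisible by 8 count twice and the others once. The count is stated
-- additively to avoid truncated subtraction.
theorem numMaximal_of_finite :
    2 * numCyclicSubgroups A ≤ numMaximal K A + cycCount {a : A | a ^ 4 = 1} ∧
      (Nat.card K ≡ 3 [MOD 8] →
        numMaximal K A + cycCount {a : A | a ^ 4 = 1} = 2 * numCyclicSubgroups A) := by
  have h2 := FiniteField.two_ne_zero_of_odd_card K hq
  have := finite_dual (L := AlgebraicClosure K) h2 hA
  obtain ⟨h3, h4⟩ := ncard_charKer_of_finite K hA hq (X := Set.univ) (fun _ _ _ _ => trivial)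
  have hu : (Set.univ : Set (A →* (AlgebraicClosure K)ˣ)) =
      {χ | χ ^ 4 = 1} ∪ {χ | χ ^ 4 ≠ 1} := by
    symm
    rw [Set.eq_univ_iff_forall]
    exact fun χ => em _
  have h5 : numCyclicSubgroups A = cycCount {a : A | a ^ 4 = 1} +
      cycCount {χ : A →* (AlgebraicClosure K)ˣ | χ ^ 4 ≠ 1} := by
    rw [← numCyclicSubgroups_dual (L := AlgebraicClosure K) h2 hA,
      ← cycCount_dual_pow_four (L := AlgebraicClosure K) h2 hA, ← cycCount_univ, hu, cycCount_union]
    exact fun a ha b hb h => pow_four_ne_one_of_zpowers_eq h hb ha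
  rw [Set.univ_inter, cycCount_univ, numCyclicSubgroups_dual h2 hA, ← setOf_isMaximal_eq] at h3 h4
  rw [numMaximal]
  refine ⟨by omega, fun hq3 => ?_⟩
  rw [h4 hq3]
  omega

include hA hq in
theorem numMaximalNeg_of_finite {s t : A} (hst : t ^ 4 = s) (hs : s * s = 1) (μ : A →* A₁)
    (hμ : Function.Surjective μ) (hμs : μ s = 1) (hker : ∀ a, μ a = 1 → a = 1 ∨ a = s) :
    2 * numCyclicSubgroups A ≤ numMaximalNeg K s + 2 * numCyclicSubgroups A₁ ∧
      (Nat.card K ≡ 3 [MOD 8] →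
        numMaximalNeg K s + 2 * numCyclicSubgroups A₁ = 2 * numCyclicSubgroups A) := by
  have h2 := FiniteField.two_ne_zero_of_odd_card K hq
  have h2L : (2 : AlgebraicClosure K) ≠ 0 := by
    rw [← map_ofNat (algebraMap K (AlgebraicClosure K)) 2]
    exact (map_ne_zero _).2 h2
  obtain ⟨h3, h4⟩ := ncard_charKer_of_finite K hA hq
    (X := {χ : A →* (AlgebraicClosure K)ˣ | χ s = -1}) (fun χ hχ r hr => by
      have hχ : χ s = -1 := hχ
      rw [Set.mem_ofPred_eq, MonoidHom.pow_apply, hχ, hr.neg_one_pow])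
  -- If `χ ^ 4 = 1`, then `χ s = (χ t) ^ 4 = 1`; so here every cyclic subgroup counts twice.
  have hX : {χ : A →* (AlgebraicClosure K)ˣ | χ s = -1} ∩ {χ | χ ^ 4 ≠ 1} =
      {χ : A →* (AlgebraicClosure K)ˣ | χ s = -1} := by
    refine Set.inter_eq_left.2 fun χ hχ h => ?_
    have hχ : χ s = -1 := hχ
    rw [← hst, map_pow, ← MonoidHom.pow_apply, h] at hχ
    have hχ : (1 : AlgebraicClosure K) = -1 := congrArg Units.val hχ
    apply h2L
    linear_combination hχ
  have h5 := cycCount_dual_neg (L := AlgebraicClosure K) h2 hA hs μ hμ hμs hker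
  rw [hX, ← setOf_isMaximal_and_mem_eq] at h3 h4
  rw [numMaximalNeg]
  refine ⟨by omega, fun hq3 => ?_⟩
  rw [h4 hq3]
  omega

end Finite

end Count

/-! ### Chinese remainder theorem for residue fields. -/

section Components

variable {K R ι : Type*} [Field K] [CommRing R] [Algebra K R] {F : ι → Type*} [∀ i, Field (F i)]
  [∀ i, Algebra K (F i)] (p : ∀ i, R →ₐ[K] F i) (hp : ∀ i, Function.Surjective (p i))
  (hinj : Function.Injective fun i => RingHom.ker (p i))

include hp hinj in
theorem exists_preimage_of_components [Finite ι] (c : ∀ i, F i) : ∃ r : R, ∀ i, p i r = c i := by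
  have hmax : ∀ i, (RingHom.ker (p i)).IsMaximal := fun i =>
    RingHom.ker_isMaximal_of_surjective (p i : R →+* F i) (hp i)
  choose r hr using fun i => hp i (c i)
  obtain ⟨t, ht⟩ := Ideal.pi_quotient_surjective (I := fun i => RingHom.ker (p i))
    (fun i j hij => Ideal.isCoprime_of_isMaximal (fun h => hij (hinj h)))
    (fun i => Ideal.Quotient.mk _ (r i))
  refine ⟨t, fun i => ?_⟩
  have h := (Ideal.Quotient.mk_eq_mk_iff_sub_mem _ _).1 (ht i)
  rw [RingHom.mem_ker, map_sub, sub_eq_zero, hr] at h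
  exact h

theorem eq_zero_of_forall_mem_maximal [IsArtinianRing R] [IsReduced R] {r : R}
    (h : ∀ m : Ideal R, m.IsMaximal → r ∈ m) : r = 0 := by
  refine IsNilpotent.eq_zero (nilpotent_iff_mem_prime.2 fun J hJ => h J ?_)
  exact IsArtinianRing.isMaximal_of_isPrime J

include hp hinj in
-- Surjectivity is the Chinese remainder theorem; injectivity holds because the intersection of the
-- maximal ideals of a reduced Artinian ring is zero.
theorem nonempty_algEquiv_pi [Finite ι] [IsArtinianRing R] [IsReduced R]
    (hall : ∀ m : Ideal R, m.IsMaximal → ∃ i, RingHom.ker (p i) = m) :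
    Nonempty (R ≃ₐ[K] ∀ i, F i) := by
  refine ⟨AlgEquiv.ofBijective (AlgHom.pi p) ⟨?_, ?_⟩⟩
  · rw [injective_iff_map_eq_zero]
    intro r hr
    refine eq_zero_of_forall_mem_maximal fun m hm => ?_
    obtain ⟨i, rfl⟩ := hall m hm
    exact congrFun hr i
  · intro c
    obtain ⟨r, hr⟩ := exists_preimage_of_components p hp hinj c
    exact ⟨r, funext hr⟩

end Components

theorem isReduced_monoidAlgebra {K A : Type*} [Field K] [CommGroup A] [Finite A] {N : ℕ}
    (h2 : (2 : K) ≠ 0) (hA : Nat.card A = 2 ^ N) : IsReduced (MonoidAlgebra K A) := by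
  have : NeZero (Nat.card A : K) := ⟨by rw [hA]; push_cast; exact pow_ne_zero _ h2⟩
  infer_instance

theorem TriCyclic.eq_mul (a b c : ℕ) (u : TriCyclic a b c) : ∃ i j k : ℕ,
    u = (Multiplicative.ofAdd (1, 0, 0) : TriCyclic a b c) ^ i *
      (Multiplicative.ofAdd (0, 1, 0) : TriCyclic a b c) ^ j *
      (Multiplicative.ofAdd (0, 0, 1) : TriCyclic a b c) ^ k := by
  obtain ⟨i, hi⟩ := ZMod.natCast_zmod_surjective u.toAdd.1
  obtain ⟨j, hj⟩ := ZMod.natCast_zmod_surjective u.toAdd.2.1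
  obtain ⟨k, hk⟩ := ZMod.natCast_zmod_surjective u.toAdd.2.2
  refine ⟨i, j, k, Multiplicative.toAdd.injective ?_⟩
  simp only [toAdd_mul, toAdd_pow, toAdd_ofAdd]
  refine Prod.ext ?_ (Prod.ext ?_ ?_)
  · simp [hi]
  · simp [hj]
  · simp [hk]

theorem TriCyclic.hom_ext {a b c : ℕ} {U : Type*} [Monoid U] {f g : TriCyclic a b c →* U}
    (h1 : f (Multiplicative.ofAdd (1, 0, 0)) = g (Multiplicative.ofAdd (1, 0, 0)))
    (h2 : f (Multiplicative.ofAdd (0, 1, 0)) = g (Multiplicative.ofAdd (0, 1, 0)))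
    (h3 : f (Multiplicative.ofAdd (0, 0, 1)) = g (Multiplicative.ofAdd (0, 0, 1))) : f = g := by
  refine MonoidHom.ext fun u => ?_
  obtain ⟨i, j, k, rfl⟩ := TriCyclic.eq_mul a b c u
  simp only [map_mul, map_pow, h1, h2, h3]

theorem TriCyclic.invol_eq_pow (n b c : ℕ) : TriCyclic.invol n b c =
    (Multiplicative.ofAdd (1, 0, 0) : TriCyclic (n + 1) b c) ^ 2 ^ n := by
  refine Multiplicative.toAdd.injective ?_
  simp only [toAdd_pow, toAdd_ofAdd, TriCyclic.invol]
  refine Prod.ext ?_ (Prod.ext ?_ ?_) <;> simp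

/-! ### Quaternion representations and the decomposition of the group algebra. -/

section Quaternion

variable {n m₂ m₃ : ℕ} {G : Type*} [Group G]

/-- A character of the centre that is `-1` on the central involution extends to a quaternion
representation. -/
theorem TypeD5.exists_quaternion_rep (d : TypeD5 n m₂ m₃ G) (e : D5Group (n + 1) m₂ m₃ ≃* G)
    (hx : d.x = e (PresentedGroup.of D5Gen.x)) (hy : d.y = e (PresentedGroup.of D5Gen.y))
    (ht : d.ι (Multiplicative.ofAdd (1, 0, 0)) = e (PresentedGroup.of D5Gen.t₁))
    {E : Type*} [CommRing E] (χ : TriCyclic (n + 1) m₂ m₃ →* E)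
    (hχ : χ (TriCyclic.invol n m₂ m₃) = -1) {a b : E}
    (ha : χ (Multiplicative.ofAdd (0, 1, 0)) = a) (hb : χ (Multiplicative.ofAdd (0, 0, 1)) = b) :
    ∃ ρ : G →* ℍ[E,a,0,b], ρ d.x = ⟨0, 1, 0, 0⟩ ∧ ρ d.y = ⟨0, 0, 1, 0⟩ ∧
      ∀ z, ρ (d.ι z) = algebraMap E _ (χ z) := by
  let c : TriCyclic (n + 1) m₂ m₃ →* (ℍ[E,a,0,b])ˣ :=
    (Units.map (algebraMap E ℍ[E,a,0,b] : E →* ℍ[E,a,0,b])).comp χ.toHomUnits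
  have hc : ∀ z, (c z : ℍ[E,a,0,b]) = algebraMap E _ (χ z) := fun z => rfl
  have hcomm : ∀ z u, Commute (c z) u := fun z u =>
    Units.ext (Algebra.commutes (χ z) (u : ℍ[E,a,0,b]))
  have hi : (⟨0, 1, 0, 0⟩ * ⟨0, 1, 0, 0⟩ : ℍ[E,a,0,b]) = algebraMap E _ a := by
    ext <;> simp [QuaternionAlgebra.algebraMap_eq]
  have hj : (⟨0, 0, 1, 0⟩ * ⟨0, 0, 1, 0⟩ : ℍ[E,a,0,b]) = algebraMap E _ b := by
    ext <;> simp [QuaternionAlgebra.algebraMap_eq]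
  -- The universal property needs a target group: `i` and `j` are units because their squares are
  -- values of `χ`, which are invertible scalars.
  have hunit : ∀ (q : ℍ[E,a,0,b]) z, q * q = algebraMap E _ (χ z) →
      ∃ Q : (ℍ[E,a,0,b])ˣ, (Q : ℍ[E,a,0,b]) = q ∧ Q * Q = c z := by
    intro q z hq
    have hz : algebraMap E ℍ[E,a,0,b] (χ z) * algebraMap E _ (χ z⁻¹) = 1 := by
      rw [← map_mul, ← map_mul, mul_inv_cancel, map_one, map_one]
    have hcq : algebraMap E ℍ[E,a,0,b] (χ z⁻¹) * q = q * algebraMap E _ (χ z⁻¹) :=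
      Algebra.commutes _ _
    refine ⟨⟨q, q * algebraMap E _ (χ z⁻¹), ?_, ?_⟩, rfl, Units.ext hq⟩
    · rw [← mul_assoc, hq, hz]
    · rw [mul_assoc, hcq, ← mul_assoc, hq, hz]
  obtain ⟨X, hX, hXX⟩ := hunit ⟨0, 1, 0, 0⟩ (Multiplicative.ofAdd (0, 1, 0)) (by rw [hi, ha])
  obtain ⟨Y, hY, hYY⟩ := hunit ⟨0, 0, 1, 0⟩ (Multiplicative.ofAdd (0, 0, 1)) (by rw [hj, hb])
  have hpow : ∀ (m : ℕ) (Q : (ℍ[E,a,0,b])ˣ) z, Q * Q = c z → z ^ 2 ^ m = 1 →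
      Q ^ 2 ^ (m + 1) = 1 := by
    intro m Q z hQ hz
    rw [pow_succ', pow_mul, pow_two, hQ, ← map_pow, hz, map_one]
  have hYX : Y * X = c (TriCyclic.invol n m₂ m₃) * (X * Y) := by
    refine Units.ext ?_
    rw [Units.val_mul, Units.val_mul, Units.val_mul, hX, hY, hc, hχ]
    ext <;> simp [QuaternionAlgebra.algebraMap_eq]
  obtain ⟨f, hfx, hfy, hft⟩ := exists_d5Group_hom n m₂ m₃ X Y (c (Multiplicative.ofAdd (1, 0, 0)))
    (hpow m₂ X _ hXX (Multiplicative.toAdd.injective (by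
      rw [toAdd_pow, toAdd_ofAdd]
      refine Prod.ext ?_ (Prod.ext ?_ ?_) <;> simp)))
    (hpow m₃ Y _ hYY (Multiplicative.toAdd.injective (by
      rw [toAdd_pow, toAdd_ofAdd]
      refine Prod.ext ?_ (Prod.ext ?_ ?_) <;> simp)))
    (by
      rw [← map_pow, ← map_one c]
      refine congrArg c (Multiplicative.toAdd.injective ?_)
      rw [toAdd_pow, toAdd_ofAdd]
      refine Prod.ext ?_ (Prod.ext ?_ ?_) <;> simp)
    (hcomm _ _) (hcomm _ _) (by rw [pow_two, hXX]; exact hcomm _ _)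
    (by rw [pow_two, hYY]; exact hcomm _ _)
    (by
      have hss : c (TriCyclic.invol n m₂ m₃) * c (TriCyclic.invol n m₂ m₃) = 1 := by
        rw [← map_mul, TypeD5.invol_mul_invol, map_one]
      rw [← map_pow, ← TriCyclic.invol_eq_pow, commutatorElement_def, mul_inv_eq_iff_eq_mul,
        mul_inv_eq_iff_eq_mul, mul_assoc, hYX, ← mul_assoc, hss, one_mul])
  refine ⟨((Units.coeHom _).comp f).comp e.symm.toMonoidHom, ?_, ?_, ?_⟩
  · simp [hx, hfx, hX]
  · simp [hy, hfy, hY]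
  · have : (f.comp e.symm.toMonoidHom).comp d.ι = c := by
      refine TriCyclic.hom_ext ?_ ?_ ?_
      · simp [ht, hft]
      · simp [← d.x_mul_x, hx, hfx, hXX]
      · simp [← d.y_mul_y, hy, hfy, hYY]
    intro z
    exact congrArg (fun φ : TriCyclic (n + 1) m₂ m₃ →* (ℍ[E,a,0,b])ˣ => (φ z : ℍ[E,a,0,b])) this

end Quaternion

namespace TypeD5

variable {n m₂ m₃ : ℕ} {G : Type*} [Group G] (d : TypeD5 n m₂ m₃ G) {K : Type*} [Field K]

/-- The inclusion of the group algebra of the centre. -/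
noncomputable def centerHom (K : Type*) [Field K] :
    MonoidAlgebra K (TriCyclic (n + 1) m₂ m₃) →ₐ[K] MonoidAlgebra K G :=
  MonoidAlgebra.lift K _ _ ((MonoidAlgebra.of K G).comp d.ι)

theorem centerHom_of (z) : d.centerHom K (MonoidAlgebra.of K _ z) = MonoidAlgebra.of K G (d.ι z) :=
  MonoidAlgebra.lift_of _ _

/-- The projection to the group algebra of the abelianization. -/
noncomputable def abHom (K : Type*) [Field K] :
    MonoidAlgebra K G →ₐ[K] MonoidAlgebra K (TriCyclic n (m₂ + 1) (m₃ + 1)) :=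
  MonoidAlgebra.lift K _ _ ((MonoidAlgebra.of K _).comp d.π)

theorem abHom_of (g) : d.abHom K (MonoidAlgebra.of K G g) = MonoidAlgebra.of K _ (d.π g) :=
  MonoidAlgebra.lift_of _ _

theorem exists_coset_form (f : MonoidAlgebra K G) : ∃ z₀ z₁ z₂ z₃ : MonoidAlgebra K _,
    f = d.centerHom K z₀ + d.centerHom K z₁ * MonoidAlgebra.of K G d.x +
      d.centerHom K z₂ * MonoidAlgebra.of K G d.y +
      d.centerHom K z₃ * MonoidAlgebra.of K G (d.x * d.y) := by
  induction f using MonoidAlgebra.induction_on with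
  | of g =>
    obtain ⟨z, rfl | rfl | rfl | rfl⟩ := d.exists_rep g
    · exact ⟨MonoidAlgebra.of K _ z, 0, 0, 0, by simp only [map_zero, centerHom_of]; simp⟩
    · exact ⟨0, MonoidAlgebra.of K _ z, 0, 0, by
        simp only [map_zero, centerHom_of, map_mul]; simp⟩
    · exact ⟨0, 0, MonoidAlgebra.of K _ z, 0, by
        simp only [map_zero, centerHom_of, map_mul]; simp⟩
    · exact ⟨0, 0, 0, MonoidAlgebra.of K _ z, by
        simp only [map_zero, centerHom_of, map_mul]; simp⟩
  | add f g hf hg =>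
    obtain ⟨a₀, a₁, a₂, a₃, rfl⟩ := hf
    obtain ⟨b₀, b₁, b₂, b₃, rfl⟩ := hg
    refine ⟨a₀ + b₀, a₁ + b₁, a₂ + b₂, a₃ + b₃, ?_⟩
    simp only [map_add, add_mul]
    abel
  | smul r f hf =>
    obtain ⟨a₀, a₁, a₂, a₃, rfl⟩ := hf
    exact ⟨r • a₀, r • a₁, r • a₂, r • a₃, by simp only [map_smul, smul_add, smul_mul_assoc]⟩

theorem abHom_surjective : Function.Surjective (d.abHom K) := by
  intro u
  induction u using MonoidAlgebra.induction_on with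
  | of a =>
    obtain ⟨g, rfl⟩ := d.π_surjective a
    exact ⟨MonoidAlgebra.of K G g, d.abHom_of g⟩
  | add u v hu hv =>
    obtain ⟨f, rfl⟩ := hu
    obtain ⟨g, rfl⟩ := hv
    exact ⟨f + g, map_add _ _ _⟩
  | smul r u hu =>
    obtain ⟨f, rfl⟩ := hu
    exact ⟨r • f, map_smul _ _ _⟩

/-- The kernel of the projection to the group algebra of the abelianization is annihilated by
`1 + s`. -/
theorem one_add_s_mul_eq_zero {f : MonoidAlgebra K G} (hf : d.abHom K f = 0) :
    (1 + MonoidAlgebra.of K G d.s) * f = 0 := by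
  -- A set-theoretic section sends `π g` to `g` or `g * s`, and `1 + s` does not distinguish the
  -- two. Hence `(1 + s) * f` depends only on the image of `f`.
  let σ := Function.surjInv d.π_surjective
  have key : ∀ f : MonoidAlgebra K G, (1 + MonoidAlgebra.of K G d.s) *
      MonoidAlgebra.mapDomain σ (d.abHom K f) = (1 + MonoidAlgebra.of K G d.s) * f := by
    intro f
    induction f using MonoidAlgebra.induction_on with
    | of g =>
      have h1 : MonoidAlgebra.mapDomain σ (d.abHom K (MonoidAlgebra.of K G g)) =
          MonoidAlgebra.of K G (σ (d.π g)) := by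
        rw [abHom_of]
        exact MonoidAlgebra.mapDomain_single
      rw [h1]
      rcases (d.π_eq_iff g (σ (d.π g))).1 (Function.surjInv_eq d.π_surjective _).symm with h | h
      · rw [h]
      · rw [h, add_mul, add_mul, one_mul, one_mul, ← map_mul, ← map_mul, d.s_mul_comm,
          ← mul_assoc, d.s_mul_s, one_mul, add_comm]
    | add f g hf hg => rw [map_add, MonoidAlgebra.mapDomain_add, mul_add, hf, hg, mul_add]
    | smul r f hf =>
      rw [map_smul, MonoidAlgebra.mapDomain_smul, mul_smul_comm, hf, mul_smul_comm]
  rw [← key, hf, MonoidAlgebra.mapDomain_zero, mul_zero]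

theorem abHom_s : d.abHom K (MonoidAlgebra.of K G d.s) = 1 := by
  rw [abHom_of, π_s, map_one]

/-- The group algebra is the direct sum of the group algebra of the abelianization and of the
quaternion algebras that belong to the characters of the centre that are `-1` on the central
involution. -/
theorem nonempty_algEquiv (e : D5Group (n + 1) m₂ m₃ ≃* G)
    (hx : d.x = e (PresentedGroup.of D5Gen.x)) (hy : d.y = e (PresentedGroup.of D5Gen.y))
    (ht : d.ι (Multiplicative.ofAdd (1, 0, 0)) = e (PresentedGroup.of D5Gen.t₁))
    (h2 : (2 : K) ≠ 0) {ι : Type*} [Finite ι] {E : ι → Type*} [∀ i, Field (E i)]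
    [∀ i, Algebra K (E i)] (p : ∀ i, MonoidAlgebra K (TriCyclic (n + 1) m₂ m₃) →ₐ[K] E i)
    (hp : ∀ i, Function.Surjective (p i)) (hinj : Function.Injective fun i => RingHom.ker (p i))
    (hneg : ∀ i, MonoidAlgebra.of K _ (TriCyclic.invol n m₂ m₃) + 1 ∈ RingHom.ker (p i))
    (hall : ∀ m : Ideal (MonoidAlgebra K (TriCyclic (n + 1) m₂ m₃)), m.IsMaximal →
      MonoidAlgebra.of K _ (TriCyclic.invol n m₂ m₃) + 1 ∈ m → ∃ i, RingHom.ker (p i) = m)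
    (a b : ∀ i, E i) (ha : ∀ i, p i (MonoidAlgebra.of K _ (Multiplicative.ofAdd (0, 1, 0))) = a i)
    (hb : ∀ i, p i (MonoidAlgebra.of K _ (Multiplicative.ofAdd (0, 0, 1))) = b i) :
    Nonempty (MonoidAlgebra K G ≃ₐ[K]
      MonoidAlgebra K (TriCyclic n (m₂ + 1) (m₃ + 1)) × ∀ i, ℍ[E i, a i, 0, b i]) := by
  have hps : ∀ i, p i (MonoidAlgebra.of K _ (TriCyclic.invol n m₂ m₃)) = -1 := fun i => by
    have := hneg i
    rw [RingHom.mem_ker, map_add, map_one] at this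
    exact eq_neg_of_add_eq_zero_left this
  have hrep := fun i => d.exists_quaternion_rep e hx hy ht
    ((p i : MonoidAlgebra K (TriCyclic (n + 1) m₂ m₃) →* E i).comp (MonoidAlgebra.of K _))
    (hps i) (ha i) (hb i)
  choose ρ hρx hρy hρ using hrep
  let Q : ∀ i, MonoidAlgebra K G →ₐ[K] ℍ[E i, a i, 0, b i] := fun i =>
    MonoidAlgebra.lift K _ _ (ρ i)
  have hQ : ∀ i g, Q i (MonoidAlgebra.of K G g) = ρ i g := fun i g => MonoidAlgebra.lift_of _ _
  have hQz : ∀ i z, Q i (d.centerHom K z) = algebraMap (E i) _ (p i z) := by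
    intro i z
    induction z using MonoidAlgebra.induction_on with
    | of z => rw [centerHom_of, hQ, hρ]; rfl
    | add z w hz hw => rw [map_add, map_add, hz, hw, map_add, map_add]
    | smul r z hz =>
      rw [map_smul, map_smul, hz, map_smul, Algebra.smul_def, Algebra.smul_def, map_mul,
        ← IsScalarTower.algebraMap_apply]
  -- The four coefficients in the coset form become the four quaternion coordinates, so the
  -- noncommutative part is settled inside the group algebra of the centre.
  have hQf : ∀ i z₀ z₁ z₂ z₃, Q i (d.centerHom K z₀ + d.centerHom K z₁ * MonoidAlgebra.of K G d.x +
      d.centerHom K z₂ * MonoidAlgebra.of K G d.y +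
      d.centerHom K z₃ * MonoidAlgebra.of K G (d.x * d.y)) =
        ⟨p i z₀, p i z₁, p i z₂, p i z₃⟩ := by
    intro i z₀ z₁ z₂ z₃
    simp only [map_add, map_mul, hQz, hQ, hρx, hρy, QuaternionAlgebra.algebraMap_eq]
    ext <;> simp
  have hQs : ∀ i, Q i (MonoidAlgebra.of K G d.s) = -1 := by
    intro i
    rw [s, ← centerHom_of, hQz, hps, map_neg, map_one]
  have hcs : ∀ z, d.centerHom K z * MonoidAlgebra.of K G d.s =
      MonoidAlgebra.of K G d.s * d.centerHom K z := by
    intro z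
    rw [s, ← centerHom_of, ← map_mul, mul_comm, map_mul]
  have hcard : Nat.card (TriCyclic (n + 1) m₂ m₃) = 2 ^ (n + 1 + (m₂ + m₃)) := by
    simp only [TriCyclic, Nat.card_congr Multiplicative.toAdd, Nat.card_prod, Nat.card_zmod,
      ← pow_add]
  have := isReduced_monoidAlgebra (K := K) h2 hcard
  have : IsArtinianRing (MonoidAlgebra K (TriCyclic (n + 1) m₂ m₃)) :=
    IsArtinianRing.of_finite K _
  have hss : (1 - MonoidAlgebra.of K (TriCyclic (n + 1) m₂ m₃) (TriCyclic.invol n m₂ m₃)) *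
      (MonoidAlgebra.of K _ (TriCyclic.invol n m₂ m₃) + 1) = 0 := by
    have : MonoidAlgebra.of K (TriCyclic (n + 1) m₂ m₃) (TriCyclic.invol n m₂ m₃) *
        MonoidAlgebra.of K _ (TriCyclic.invol n m₂ m₃) = 1 := by
      rw [← map_mul, invol_mul_invol, map_one]
    linear_combination -this
  -- Every maximal ideal contains `1 - s` or `s + 1`. In the second case it is the kernel of some `p
  -- i` and contains `z`, so the product lies in all maximal ideals.
  have hzero : ∀ z, (∀ i, p i z = 0) →
      (1 - MonoidAlgebra.of K (TriCyclic (n + 1) m₂ m₃) (TriCyclic.invol n m₂ m₃)) * z = 0 := by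
    intro z hz
    refine eq_zero_of_forall_mem_maximal fun m hm => ?_
    rcases hm.isPrime.mem_or_mem (hss ▸ m.zero_mem) with h | h
    · exact m.mul_mem_right _ h
    · obtain ⟨i, rfl⟩ := hall m hm h
      exact Ideal.mul_mem_left _ _ (hz i)
  have hcz : ∀ z, (1 - MonoidAlgebra.of K G d.s) * d.centerHom K z = d.centerHom K
      ((1 - MonoidAlgebra.of K (TriCyclic (n + 1) m₂ m₃) (TriCyclic.invol n m₂ m₃)) * z) := by
    intro z
    rw [map_mul, map_sub, map_one, centerHom_of]
    rfl
  refine ⟨AlgEquiv.ofBijective ((d.abHom K).prod (AlgHom.pi Q)) ⟨?_, ?_⟩⟩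
  · rw [injective_iff_map_eq_zero]
    intro f hf
    have h1 : d.abHom K f = 0 := congrArg Prod.fst hf
    have h3 : ∀ i, Q i f = 0 := fun i => congrFun (congrArg Prod.snd hf) i
    have h4 := d.one_add_s_mul_eq_zero h1
    obtain ⟨z₀, z₁, z₂, z₃, hz⟩ := d.exists_coset_form f
    have h5 : (1 - MonoidAlgebra.of K G d.s) * f = 0 := by
      have h6 := fun i => (hQf i z₀ z₁ z₂ z₃).symm.trans ((congrArg (Q i) hz.symm).trans (h3 i))
      have e0 := hzero z₀ fun i => congrArg QuaternionAlgebra.re (h6 i)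
      have e1 := hzero z₁ fun i => congrArg QuaternionAlgebra.imI (h6 i)
      have e2 := hzero z₂ fun i => congrArg QuaternionAlgebra.imJ (h6 i)
      have e3 := hzero z₃ fun i => congrArg QuaternionAlgebra.imK (h6 i)
      rw [hz]
      simp only [mul_add, ← mul_assoc, hcz, e0, e1, e2, e3, map_zero, zero_mul, add_zero]
    -- This is the sum of `(1 + s) * f = 0` and `(1 - s) * f = 0`.
    have h6 : (2 : K) • f = 0 := by
      rw [two_smul, ← add_zero 0]
      nth_rewrite 1 [← h4]
      rw [← h5]
      noncomm_ring
    exact (smul_eq_zero.1 h6).resolve_left h2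
  · rintro ⟨u, c⟩
    obtain ⟨v, hv⟩ := d.abHom_surjective u
    obtain ⟨z₀, hz₀⟩ := exists_preimage_of_components p hp hinj fun i => (c i).re
    obtain ⟨z₁, hz₁⟩ := exists_preimage_of_components p hp hinj fun i => (c i).imI
    obtain ⟨z₂, hz₂⟩ := exists_preimage_of_components p hp hinj fun i => (c i).imJ
    obtain ⟨z₃, hz₃⟩ := exists_preimage_of_components p hp hinj fun i => (c i).imK
    set f := d.centerHom K z₀ + d.centerHom K z₁ * MonoidAlgebra.of K G d.x +
      d.centerHom K z₂ * MonoidAlgebra.of K G d.y +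
      d.centerHom K z₃ * MonoidAlgebra.of K G (d.x * d.y) with hf
    have hQc : ∀ i, Q i f = c i := by
      intro i
      rw [hf, hQf, hz₀, hz₁, hz₂, hz₃]
    -- The complementary central idempotents `(1 + s) / 2` and `(1 - s) / 2` glue the two separate
    -- preimages.
    refine ⟨(2⁻¹ : K) • ((1 + MonoidAlgebra.of K G d.s) * v + (1 - MonoidAlgebra.of K G d.s) * f), ?_⟩
    refine Prod.ext ?_ (funext fun i => ?_)
    · change d.abHom K _ = u
      rw [map_smul, map_add, map_mul, map_mul, map_add, map_sub, map_one, abHom_s, hv, sub_self,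
        zero_mul, add_zero, add_mul, one_mul, ← two_smul K u, smul_smul, inv_mul_cancel₀ h2,
        one_smul]
    · change Q i _ = c i
      rw [map_smul, map_add, map_mul, map_mul, map_add, map_sub, map_one, hQs, add_neg_cancel,
        zero_mul, zero_add, sub_neg_eq_add, add_mul, one_mul, hQc, ← two_smul K (c i), smul_smul,
        inv_mul_cancel₀ h2, one_smul]

end TypeD5

/-! ### Splitting of quaternion algebras over finite fields. -/

theorem FiniteField.exists_sq_sub_mul_sq {E : Type*} [Field E] [Finite E] (h2 : (2 : E) ≠ 0)
    {a : E} (ha : a ≠ 0) (b : E) : ∃ u v : E, u ^ 2 - a * v ^ 2 = b := by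
  have := Fintype.ofFinite E
  have hodd : Fintype.card E % 2 = 1 := by
    refine FiniteField.odd_card_of_char_ne_two fun h => h2 ?_
    have := CharP.cast_eq_zero E (ringChar E)
    rw [h] at this
    exact_mod_cast this
  obtain ⟨u, v, huv⟩ := FiniteField.exists_root_sum_quadratic
    (f := Polynomial.C (1 : E) * Polynomial.X ^ 2 + Polynomial.C 0 * Polynomial.X + Polynomial.C 0)
    (g := Polynomial.C (-a) * Polynomial.X ^ 2 + Polynomial.C 0 * Polynomial.X + Polynomial.C (-b))
    (Polynomial.degree_quadratic one_ne_zero) (Polynomial.degree_quadratic (neg_ne_zero.2 ha)) hodd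
  refine ⟨u, v, ?_⟩
  simp at huv
  linear_combination huv

/-- A quaternion algebra over a finite field of odd order is a matrix ring. -/
theorem QuaternionAlgebra.nonempty_algEquiv_matrix {E : Type*} [Field E] [Finite E]
    (h2 : (2 : E) ≠ 0) {a b : E} (ha : a ≠ 0) (hb : b ≠ 0) :
    Nonempty (ℍ[E,a,0,b] ≃ₐ[E] Matrix (Fin 2) (Fin 2) E) := by
  obtain ⟨u, v, huv⟩ := FiniteField.exists_sq_sub_mul_sq h2 ha b
  -- In the basis `1, √a` of `E[√a]`, `i` is multiplication by `√a`, and `j` is conjugation followed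
  -- by multiplication by `u + v √a`, an element of norm `b`.
  let B : QuaternionAlgebra.Basis (Matrix (Fin 2) (Fin 2) E) a 0 b :=
    { i := !![0, a; 1, 0]
      j := !![u, -(a * v); v, -u]
      k := !![a * v, -(a * u); u, -(a * v)]
      i_mul_i := by ext i j; fin_cases i <;> fin_cases j <;> simp
      j_mul_j := by
        ext i j
        fin_cases i <;> fin_cases j <;> simp <;> first | linear_combination huv | linear_combination (0 : E) * huv
      i_mul_j := by ext i j; fin_cases i <;> fin_cases j <;> simp
      j_mul_i := by ext i j; fin_cases i <;> fin_cases j <;> simp [mul_comm] }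
  have hinj : Function.Injective B.liftHom := by
    rw [injective_iff_map_eq_zero]
    rintro ⟨r, p, q, w⟩ h
    have h : B.lift ⟨r, p, q, w⟩ = 0 := h
    have h00 := congrFun (congrFun h 0) 0
    have h01 := congrFun (congrFun h 0) 1
    have h10 := congrFun (congrFun h 1) 0
    have h11 := congrFun (congrFun h 1) 1
    simp [QuaternionAlgebra.Basis.lift, B, Matrix.algebraMap_eq_diagonal] at h00 h01 h10 h11
    have hr : r = 0 := by
      have : 2 * r = 0 := by linear_combination h00 + h11
      exact (mul_eq_zero.1 this).resolve_left h2
    have hp : p = 0 := by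
      have : (2 * a) * p = 0 := by linear_combination h01 + a * h10
      exact (mul_eq_zero.1 this).resolve_left (mul_ne_zero h2 ha)
    subst hr hp
    -- The first-column equations in `q` and `w` have determinant `u ^ 2 - a * v ^ 2 = b`, which is
    -- nonzero.
    have hq : q = 0 := by
      have : b * q = 0 := by rw [← huv]; linear_combination u * h00 - a * v * h10
      exact (mul_eq_zero.1 this).resolve_left hb
    have hw : w = 0 := by
      have : b * w = 0 := by rw [← huv]; linear_combination u * h10 - v * h00
      exact (mul_eq_zero.1 this).resolve_left hb
    subst hq hw
    rfl
  have hfin : Module.finrank E ℍ[E,a,0,b] = Module.finrank E (Matrix (Fin 2) (Fin 2) E) := by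
    rw [QuaternionAlgebra.finrank_eq_four, Module.finrank_matrix]
    simp
  exact ⟨AlgEquiv.ofBijective B.liftHom ⟨hinj,
    (LinearMap.injective_iff_surjective_of_finrank_eq_finrank hfin (f := B.liftHom.toLinearMap)).1
      hinj⟩⟩

theorem IsSumOfFieldsAndQuaternions.isSumOfFieldsAndMatrixRings {K : Type v} [Field K]
    {A : Type w} [Ring A] [Algebra K A] [Finite A] (h2 : (2 : K) ≠ 0) {r s : ℕ}
    (h : IsSumOfFieldsAndQuaternions K A r s) : IsSumOfFieldsAndMatrixRings K A r s := by
  obtain ⟨F, _, _, E, _, _, a, b, hab, ⟨f⟩⟩ := h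
  have hE : ∀ j, Finite (E j) := by
    intro j
    refine Finite.of_surjective (fun x : A => ((f x).2 j).re) fun c => ?_
    classical
    obtain ⟨x, hx⟩ := f.surjective (0, Pi.single j ⟨c, 0, 0, 0⟩)
    exact ⟨x, by simp [hx]⟩
  have hmat : ∀ j, Nonempty (ℍ[E j,a j,0,b j] ≃ₐ[K] Matrix (Fin 2) (Fin 2) (E j)) := by
    intro j
    have h2E : (2 : E j) ≠ 0 := by
      rw [← map_ofNat (algebraMap K (E j)) 2]
      exact (map_ne_zero _).2 h2
    obtain ⟨g⟩ := QuaternionAlgebra.nonempty_algEquiv_matrix h2E (hab j).1 (hab j).2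
    exact ⟨g.restrictScalars K⟩
  exact ⟨F, _, _, E, _, _, ⟨f.trans (AlgEquiv.prodCongr AlgEquiv.refl
    (AlgEquiv.piCongrRight fun j => (hmat j).some))⟩⟩

/-! ### Counting the simple components. -/

/-- The image of `I` in the simple ring `R` is a nonzero two-sided ideal, so it contains 1. -/
theorem TwoSidedIdeal.exists_mem_one_sub_mem_ker {A R : Type*} [Ring A] [Ring R]
    [IsSimpleRing R] (q : A →+* R) (hq : Function.Surjective q) (I : TwoSidedIdeal A) {x : A}
    (hx : x ∈ I) (hxq : x ∉ TwoSidedIdeal.ker q) : ∃ y ∈ I, 1 - y ∈ TwoSidedIdeal.ker q := by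
  let J : TwoSidedIdeal R := TwoSidedIdeal.mk' {c | ∃ y ∈ I, q y = c}
    ⟨0, I.zero_mem, map_zero _⟩
    (by rintro _ _ ⟨y, hy, rfl⟩ ⟨z, hz, rfl⟩; exact ⟨y + z, I.add_mem hy hz, map_add _ _ _⟩)
    (by rintro _ ⟨y, hy, rfl⟩; exact ⟨-y, I.neg_mem hy, map_neg _ _⟩)
    (by
      rintro c _ ⟨y, hy, rfl⟩
      obtain ⟨d, rfl⟩ := hq c
      exact ⟨d * y, I.mul_mem_left _ _ hy, map_mul _ _ _⟩)
    (by
      rintro _ c ⟨y, hy, rfl⟩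
      obtain ⟨d, rfl⟩ := hq c
      exact ⟨y * d, I.mul_mem_right _ _ hy, map_mul _ _ _⟩)
  have hJ : ∀ c, c ∈ J ↔ ∃ y ∈ I, q y = c := fun c => TwoSidedIdeal.mem_mk' ..
  have htop : J = ⊤ := by
    refine (eq_bot_or_eq_top J).resolve_left fun h => hxq ?_
    have : q x ∈ J := (hJ _).2 ⟨x, hx, rfl⟩
    rw [h] at this
    exact (TwoSidedIdeal.mem_ker _).2 ((TwoSidedIdeal.mem_bot _).1 this)
  obtain ⟨y, hy, hy1⟩ := (hJ 1).1 (htop ▸ TwoSidedIdeal.mem_top _)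
  exact ⟨y, hy, (TwoSidedIdeal.mem_ker _).2 (by rw [map_sub, map_one, hy1, sub_self])⟩

section SimpleComponents

variable {A : Type*} [Ring A] {ι : Type*} (Q : ι → TwoSidedIdeal A)
  (hQ : ∀ i (I : TwoSidedIdeal A) x, x ∈ I → x ∉ Q i → ∃ y ∈ I, 1 - y ∈ Q i)
  (hzero : ∀ x, (∀ i, x ∈ Q i) → x = 0) (e : ι → A) (he : ∀ i, e i ∉ Q i)
  (hne : ∀ i j, i ≠ j → e j ∈ Q i)

include hQ hzero hne in
-- If `y ∈ I` is 1 modulo `Q i`, then `e i * (1 - y)` lies in every `Q k` and vanishes, so `e i = e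
-- i * y`.
theorem idempotent_mem_of_notMem (I : TwoSidedIdeal A) {x : A} (hx : x ∈ I) {i : ι}
    (hxi : x ∉ Q i) : e i ∈ I := by
  obtain ⟨y, hy, hy1⟩ := hQ i I x hx hxi
  have : e i * (1 - y) = 0 := by
    refine hzero _ fun k => ?_
    by_cases hk : k = i
    · subst hk
      exact (Q k).mul_mem_left _ _ hy1
    · exact (Q k).mul_mem_right _ _ (hne k i hk)
  rw [mul_sub, mul_one, sub_eq_zero] at this
  rw [this]
  exact I.mul_mem_left _ _ hy

include hne he in
theorem idempotent_mem_span_iff {i j : ι} (h : e i ∈ TwoSidedIdeal.span {e j}) : i = j := by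
  by_contra hij
  have hle : TwoSidedIdeal.span {e j} ≤ Q i := by
    rw [TwoSidedIdeal.span_le]
    rintro _ rfl
    exact hne i j hij
  exact he i (hle h)

include hQ hzero he hne in
-- Every nonzero ideal contains some `e i`, and the ideals generated by different `e i` are not
-- comparable; hence these are exactly the atoms.
theorem numSimpleComponents_eq : numSimpleComponents A = Nat.card ι := by
  have hmem : ∀ j, e j ∈ TwoSidedIdeal.span {e j} := fun j => TwoSidedIdeal.subset_span rfl
  have hbot : ∀ I : TwoSidedIdeal A, I ≠ ⊥ → ∃ i, e i ∈ I := by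
    intro I hI
    have : ∃ x ∈ I, x ≠ 0 := by
      by_contra hcon
      push Not at hcon
      exact hI (le_antisymm (fun x hx => (TwoSidedIdeal.mem_bot _).2 (hcon x hx)) bot_le)
    obtain ⟨x, hx, hx0⟩ := this
    have : ∃ i, x ∉ Q i := by
      by_contra hcon
      push Not at hcon
      exact hx0 (hzero x hcon)
    obtain ⟨i, hi⟩ := this
    exact ⟨i, idempotent_mem_of_notMem Q hQ hzero e hne I hx hi⟩
  have hle : ∀ (I : TwoSidedIdeal A) i, e i ∈ I → TwoSidedIdeal.span {e i} ≤ I := by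
    intro I i hi
    rw [TwoSidedIdeal.span_le]
    rintro _ rfl
    exact hi
  have hspan : ∀ i, TwoSidedIdeal.span {e i} ≠ ⊥ := by
    intro i h
    have h0 : e i = 0 := (TwoSidedIdeal.mem_bot _).1 (h ▸ hmem i)
    exact he i (h0 ▸ (Q i).zero_mem)
  have hatom : ∀ i, IsAtom (TwoSidedIdeal.span {e i}) := by
    refine fun i => ⟨hspan i, fun J hJ => ?_⟩
    by_contra hJ0
    obtain ⟨k, hk⟩ := hbot J hJ0
    obtain rfl := idempotent_mem_span_iff Q e he hne (hJ.le hk)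
    exact hJ.not_ge (hle J k hk)
  refine (Nat.card_congr (Equiv.ofBijective
    (fun i => (⟨_, hatom i⟩ : {I : TwoSidedIdeal A // IsAtom I})) ⟨?_, ?_⟩)).symm
  · intro i j hij
    have hij : TwoSidedIdeal.span {e i} = TwoSidedIdeal.span {e j} := congrArg Subtype.val hij
    exact idempotent_mem_span_iff Q e he hne (hij ▸ hmem i)
  · rintro ⟨I, hI⟩
    obtain ⟨i, hi⟩ := hbot I hI.1
    exact ⟨i, Subtype.ext ((hI.le_iff.1 (hle I i hi)).resolve_left (hspan i))⟩

end SimpleComponents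

theorem IsSumOfFieldsAndMatrixRings.numSimpleComponents_eq {K : Type v} [Field K]
    {A : Type w} [Ring A] [Algebra K A] {r s : ℕ} (h : IsSumOfFieldsAndMatrixRings K A r s) :
    numSimpleComponents A = r + s := by
  classical
  obtain ⟨F, _, _, E, _, _, ⟨f⟩⟩ := h
  let p : ∀ i, A →+* F i := fun i =>
    ((Pi.evalRingHom F i).comp (RingHom.fst _ _)).comp f.toRingEquiv.toRingHom
  let q : ∀ j, A →+* Matrix (Fin 2) (Fin 2) (E j) := fun j =>
    ((Pi.evalRingHom (fun j => Matrix (Fin 2) (Fin 2) (E j)) j).comp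
      (RingHom.snd _ _)).comp f.toRingEquiv.toRingHom
  let e : Fin r ⊕ Fin s → A := fun i => match i with
    | .inl i => f.symm (Pi.single i 1, 0)
    | .inr j => f.symm (0, Pi.single j 1)
  have hcard : Nat.card (Fin r ⊕ Fin s) = r + s := by simp
  rw [← hcard]
  refine _root_.numSimpleComponents_eq
    (Sum.elim (fun i => TwoSidedIdeal.ker (p i)) fun j => TwoSidedIdeal.ker (q j)) ?_ ?_ e ?_ ?_
  · rintro (i | j) I x hx hxq
    · refine TwoSidedIdeal.exists_mem_one_sub_mem_ker (p i) (fun c => ?_) I hx hxq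
      refine ⟨f.symm (Pi.single i c, 0), ?_⟩
      change (f (f.symm _)).1 i = c
      rw [f.apply_symm_apply]
      exact Pi.single_eq_same ..
    · refine TwoSidedIdeal.exists_mem_one_sub_mem_ker (q j) (fun c => ?_) I hx hxq
      refine ⟨f.symm (0, Pi.single j c), ?_⟩
      change (f (f.symm _)).2 j = c
      rw [f.apply_symm_apply]
      exact Pi.single_eq_same ..
  · intro x hx
    rw [← map_eq_zero_iff f f.injective]
    exact Prod.ext (funext fun i => (TwoSidedIdeal.mem_ker _).1 (hx (.inl i)))
      (funext fun j => (TwoSidedIdeal.mem_ker _).1 (hx (.inr j)))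
  · rintro (i | j) h
    · have h : (f (f.symm _)).1 i = 0 := (TwoSidedIdeal.mem_ker _).1 h
      rw [f.apply_symm_apply] at h
      exact one_ne_zero ((Pi.single_eq_same ..).symm.trans h)
    · have h : (f (f.symm _)).2 j = 0 := (TwoSidedIdeal.mem_ker _).1 h
      rw [f.apply_symm_apply] at h
      exact one_ne_zero ((Pi.single_eq_same ..).symm.trans h)
  · rintro (i | i) (j | j) hij <;> refine (TwoSidedIdeal.mem_ker _).2 ?_
    · change (f (f.symm _)).1 i = 0
      rw [f.apply_symm_apply]
      exact Pi.single_eq_of_ne (fun h => hij (congrArg _ h)) _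
    · change (f (f.symm _)).1 i = 0
      rw [f.apply_symm_apply]
      rfl
    · change (f (f.symm _)).2 i = 0
      rw [f.apply_symm_apply]
      rfl
    · change (f (f.symm _)).2 i = 0
      rw [f.apply_symm_apply]
      exact Pi.single_eq_of_ne (fun h => hij (congrArg _ h)) _

/-! ### Assembling the decomposition and the counts. -/

/-- The residue fields at a finite set of maximal ideals of an algebra. -/
theorem Ideal.exists_residue_fields {K R : Type v} [Field K] [CommRing R] [Algebra K R]
    {X : Set (Ideal R)} (hX : X.Finite) (hmax : ∀ m ∈ X, m.IsMaximal) :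
    ∃ (F : Fin X.ncard → Type v) (_ : ∀ i, Field (F i)) (_ : ∀ i, Algebra K (F i))
      (p : ∀ i, R →ₐ[K] F i), (∀ i, Function.Surjective (p i)) ∧
      (Function.Injective fun i => RingHom.ker (p i)) ∧ (∀ i, RingHom.ker (p i) ∈ X) ∧
      ∀ m ∈ X, ∃ i, RingHom.ker (p i) = m := by
  have := hX.to_subtype
  have f : Fin X.ncard ≃ X := (Finite.equivFinOfCardEq (Nat.card_coe_set_eq X)).symm
  have := fun i => hmax _ (f i).2
  have hker : ∀ i, RingHom.ker (Ideal.Quotient.mkₐ K (f i : Ideal R)) = f i :=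
    fun i => Ideal.Quotient.mkₐ_ker K _
  refine ⟨fun i => R ⧸ (f i : Ideal R), fun i => Ideal.Quotient.field _, fun i => inferInstance,
    fun i => Ideal.Quotient.mkₐ K _, fun i => Ideal.Quotient.mkₐ_surjective K _, ?_, ?_, ?_⟩
  · intro i j hij
    exact f.injective (Subtype.ext ((hker i).symm.trans (hij.trans (hker j))))
  · exact fun i => (hker i).symm ▸ (f i).2
  · exact fun m hm => ⟨f.symm ⟨m, hm⟩, by rw [hker, f.apply_symm_apply]⟩

namespace TypeD5

variable {n m₂ m₃ : ℕ} {G : Type u} [Group G] (d : TypeD5 n m₂ m₃ G)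

theorem isSumOfFieldsAndQuaternions {K : Type v} [Field K] (e : D5Group (n + 1) m₂ m₃ ≃* G)
    (hx : d.x = e (PresentedGroup.of D5Gen.x)) (hy : d.y = e (PresentedGroup.of D5Gen.y))
    (ht : d.ι (Multiplicative.ofAdd (1, 0, 0)) = e (PresentedGroup.of D5Gen.t₁))
    (h2 : (2 : K) ≠ 0) :
    IsSumOfFieldsAndQuaternions K (MonoidAlgebra K G)
      (numMaximal K (TriCyclic n (m₂ + 1) (m₃ + 1)))
      (numMaximalNeg K (TriCyclic.invol n m₂ m₃)) := by
  unfold numMaximal numMaximalNeg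
  have hartin : ∀ a b c, IsArtinianRing (MonoidAlgebra K (TriCyclic a b c)) :=
    fun a b c => IsArtinianRing.of_finite K _
  have hfin : ∀ a b c,
      {m : Ideal (MonoidAlgebra K (TriCyclic a b c)) | m.IsMaximal}.Finite := fun a b c =>
    have := hartin a b c
    IsArtinianRing.setOfPred_isMaximal_finite _
  have hcard : Nat.card (TriCyclic n (m₂ + 1) (m₃ + 1)) = 2 ^ (n + ((m₂ + 1) + (m₃ + 1))) := by
    simp only [TriCyclic, Nat.card_congr Multiplicative.toAdd, Nat.card_prod, Nat.card_zmod,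
      pow_add]
  have := hartin n (m₂ + 1) (m₃ + 1)
  have := isReduced_monoidAlgebra (K := K) h2 hcard
  obtain ⟨F, _, _, p, hp, hinj, -, hall⟩ := Ideal.exists_residue_fields (K := K)
    (hfin n (m₂ + 1) (m₃ + 1)) fun m hm => hm
  obtain ⟨f⟩ := nonempty_algEquiv_pi p hp hinj hall
  obtain ⟨E, _, _, q, hq, hqinj, hneg, hqall⟩ := Ideal.exists_residue_fields (K := K)
    (X := {m | m.IsMaximal ∧ MonoidAlgebra.of K _ (TriCyclic.invol n m₂ m₃) + 1 ∈ m})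
    ((hfin (n + 1) m₂ m₃).subset fun m hm => hm.1) fun m hm => hm.1
  obtain ⟨g⟩ := d.nonempty_algEquiv e hx hy ht h2 q hq hqinj (fun i => (hneg i).2)
    (fun m hm hmem => hqall m ⟨hm, hmem⟩) _ _ (fun i => rfl) (fun i => rfl)
  have hunit : ∀ i z, q i (MonoidAlgebra.of K _ z) ≠ 0 := fun i z =>
    ((Group.isUnit z).map (MonoidAlgebra.of K _) |>.map (q i)).ne_zero
  exact ⟨F, _, _, E, _, _, _, _, fun j => ⟨hunit j _, hunit j _⟩,
    ⟨g.trans (AlgEquiv.prodCongr f AlgEquiv.refl)⟩⟩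

include d in
theorem isPGroup : IsPGroup 2 G := by
  intro g
  refine ⟨n + (m₂ + 1) + (m₃ + 1) + 1, ?_⟩
  rw [pow_succ, pow_mul]
  rcases d.eq_of_π_eq_one (g ^ 2 ^ (n + (m₂ + 1) + (m₃ + 1)))
    (by rw [map_pow, TriCyclic.pow_eq_one]) with h | h
  · rw [h, one_pow]
  · rw [h, sq, ← map_mul, invol_mul_invol, map_one]

include d in
theorem isSemisimpleRing {K : Type v} [Field K] (h2 : (2 : K) ≠ 0) :
    IsSemisimpleRing (MonoidAlgebra K G) := by
  have := d.finite
  obtain ⟨k, hk⟩ := IsPGroup.iff_card.1 d.isPGroup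
  have : NeZero (Nat.card G : K) := ⟨by rw [hk]; push_cast; exact pow_ne_zero _ h2⟩
  infer_instance

end TypeD5

/-- This identifies the centre modulo the involution, the group whose cyclic subgroups number `α`.
-/
theorem TriCyclic.exists_red (n b c : ℕ) :
    ∃ μ : TriCyclic (n + 1) b c →* TriCyclic n b c, Function.Surjective μ ∧
      μ (TriCyclic.invol n b c) = 1 ∧ ∀ a, μ a = 1 → a = 1 ∨ a = TriCyclic.invol n b c := by
  refine ⟨AddMonoidHom.toMultiplicative ((ZMod.red n).toAddMonoidHom.prodMap
    (AddMonoidHom.id (ZMod (2 ^ b) × ZMod (2 ^ c)))), ?_, ?_, ?_⟩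
  · intro w
    obtain ⟨a, ha⟩ := ZMod.red_surjective n w.toAdd.1
    exact ⟨Multiplicative.ofAdd (a, w.toAdd.2), Multiplicative.toAdd.injective (Prod.ext ha rfl)⟩
  · refine Multiplicative.toAdd.injective (Prod.ext ?_ rfl)
    exact (ZMod.red_eq_zero_iff n _).2 ⟨1, ZMod.top_one n⟩
  · intro a h
    have h1 : ZMod.red n a.toAdd.1 = 0 := congrArg (fun w => (Multiplicative.toAdd w).1) h
    have h2 : a.toAdd.2 = 0 := congrArg (fun w => (Multiplicative.toAdd w).2) h
    obtain ⟨k, hk⟩ := (ZMod.red_eq_zero_iff n _).1 h1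
    rcases ZMod.two_cases k with rfl | rfl
    · left
      exact Multiplicative.toAdd.injective (Prod.ext (by rw [← hk, map_zero]; rfl) h2)
    · right
      exact Multiplicative.toAdd.injective (Prod.ext (by rw [← hk, ZMod.top_one]; rfl) h2)

theorem TriCyclic.exists_pow_four_eq_invol (n b c : ℕ) :
    ∃ t, t ^ 4 = TriCyclic.invol (n + 2) b c := by
  refine ⟨Multiplicative.ofAdd (2 ^ n, 0, 0), Multiplicative.toAdd.injective ?_⟩
  refine Prod.ext ?_ (Prod.ext ?_ ?_)
  · change 4 • (2 : ZMod (2 ^ (n + 2 + 1))) ^ n = 2 ^ (n + 2)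
    rw [nsmul_eq_mul]
    push_cast
    ring
  · exact smul_zero (A := ZMod (2 ^ b)) 4
  · exact smul_zero (A := ZMod (2 ^ c)) 4

theorem cyclicCount_swap (a b c : ℕ) : cyclicCount a b c = cyclicCount a c b := by
  unfold cyclicCount
  congr 1 <;> omega

theorem cycCount_le_numCyclicSubgroups {A : Type*} [Group A] [Finite A] (X : Set A) :
    cycCount X ≤ numCyclicSubgroups A := by
  rw [← cycCount_univ]
  exact Set.ncard_le_ncard (Set.image_mono (Set.subset_univ X)) (Set.toFinite _)

theorem mainTheorem5 (m₁ m₂ m₃ : ℕ) (hm₁ : 3 ≤ m₁) (hm₂ : 3 ≤ m₂) (hm₃ : 3 ≤ m₃)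
    (G : Type u) [Group G] (e : D5Group m₁ m₂ m₃ ≃* G)
    (x y : G) (hx : x = e (PresentedGroup.of D5Gen.x)) (hy : y = e (PresentedGroup.of D5Gen.y))
    (N₀ N₁ N₂ N₃ N₄ N : ℕ)
    (hN₁ : N₁ = numCyclicSubgroups (Subgroup.center G))
    (hN₂ : N₂ = numKClassesInvolving ℚ x)
    (hN₃ : N₃ = numKClassesInvolving ℚ y)
    (hN₄ : N₄ = numKClassesInvolving ℚ (x * y))
    (hN : N = N₁ + N₂ + N₃ + N₄)
    (hN₀ : N₀ = numCyclicSubgroups (G ⧸ commutator G)) :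
    -- the numbers involved
    (N = numKClasses ℚ G ∧
      (N₁ : ℚ) = cyclicCount m₁ m₂ m₃ ∧
      (N₂ : ℚ) = cyclicCount (m₁ - 1) (m₂ + 1) m₃ - cyclicCount (m₁ - 1) m₂ m₃ ∧
      (N₃ : ℚ) = cyclicCount (m₁ - 1) m₂ (m₃ + 1) - cyclicCount (m₁ - 1) m₂ m₃ ∧
      (N₄ : ℚ) = cyclicCount (m₁ - 1) (max m₂ m₃ + 1) (min m₂ m₃)
        - cyclicCount (m₁ - 1) m₂ m₃ ∧
      (N₀ : ℚ) = cyclicCount (m₁ - 1) (m₂ + 1) (m₃ + 1) ∧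
      N₀ ≤ N ∧ 36 ≤ 2 * N₀) ∧
    -- the rational group algebra
    IsSumOfFieldsAndQuaternions ℚ (MonoidAlgebra ℚ G) N₀ (N - N₀) ∧
    -- the group algebra over a finite field of odd order
    (∀ (K : Type v) [Field K] [Finite K], Odd (Nat.card K) →
      IsSemisimpleRing (MonoidAlgebra K G) ∧
      2 * N - 36 ≤ numSimpleComponents (MonoidAlgebra K G) ∧
      (Nat.card K ≡ 3 [MOD 8] →
        numSimpleComponents (MonoidAlgebra K G) = 2 * N - 36 ∧
        IsSumOfFieldsAndMatrixRings K (MonoidAlgebra K G) (2 * N₀ - 36) (2 * (N - N₀)))) := by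
  -- This is where `m₁ ≥ 3` enters: the involution `t₁ ^ 2 ^ (n + 2)` is the fourth power of `t₁ ^ 2
  -- ^ n`.
  obtain ⟨n, rfl⟩ : ∃ n, m₁ = n + 2 + 1 := ⟨m₁ - 3, by omega⟩
  obtain ⟨d, hdx, hdy, hdt⟩ := exists_typeD5 e
  obtain rfl : x = d.x := hx.trans hdx.symm
  obtain rfl : y = d.y := hy.trans hdy.symm
  rw [d.numCyclicSubgroups_center] at hN₁
  rw [d.numKClassesInvolving_eq d.x_mem_coset (by decide)] at hN₂
  rw [d.numKClassesInvolving_eq d.y_mem_coset (by decide)] at hN₃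
  rw [d.numKClassesInvolving_eq d.xy_mem_coset (by decide)] at hN₄
  rw [d.numCyclicSubgroups_ab] at hN₀
  have hα := TriCyclic.cycCount_layer_zero_zero (a := n + 2) (b := m₂) (c := m₃)
  set α := numCyclicSubgroups (TriCyclic (n + 2) m₂ m₃)
  have hsum := TriCyclic.numCyclicSubgroups_eq_sum_layers (a := n + 2) (b := m₂) (c := m₃)
  have h10 := TriCyclic.cycCount_layer_one_zero (a := n + 2) (b := m₂) (c := m₃)
  have h01 := TriCyclic.cycCount_layer_zero_one (a := n + 2) (b := m₂) (c := m₃)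
  have h11 := TriCyclic.cycCount_layer_one_one (a := n + 2) (b := m₂) (c := m₃)
  rw [← hN₀, hα, ← hN₂, ← hN₃, ← hN₄] at hsum
  rw [hα, ← hN₂] at h10
  rw [hα, ← hN₃] at h01
  rw [hα, ← hN₄] at h11
  have h36 := TriCyclic.cycCount_pow_four (n + 2) (m₂ + 1) (m₃ + 1) (by omega) (by omega) (by omega)
  have hle36 := cycCount_le_numCyclicSubgroups
    {u : TriCyclic (n + 2) (m₂ + 1) (m₃ + 1) | u ^ 4 = 1}
  rw [h36, ← hN₀] at hle36
  obtain ⟨μ, hμ, hμs, hker⟩ := TriCyclic.exists_red (n + 2) m₂ m₃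
  obtain ⟨t, ht⟩ := TriCyclic.exists_pow_four_eq_invol n m₂ m₃
  have hinvol := TypeD5.invol_mul_invol (n := n + 2) (m₂ := m₂) (m₃ := m₃)
  have hpow : ∀ u : TriCyclic (n + 2 + 1) m₂ m₃, u ^ 2 ^ (n + m₂ + m₃ + 3) = 1 := fun u => by
    rw [show n + m₂ + m₃ + 3 = n + 2 + 1 + m₂ + m₃ by omega]
    exact TriCyclic.pow_eq_one u
  have hpow₀ : ∀ u : TriCyclic (n + 2) (m₂ + 1) (m₃ + 1),
      u ^ 2 ^ (n + m₂ + m₃ + 1 + 3) = 1 := fun u => by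
    rw [show n + m₂ + m₃ + 1 + 3 = n + 2 + (m₂ + 1) + (m₃ + 1) by omega]
    exact TriCyclic.pow_eq_one u
  have hrat := numMaximal_of_irreducible ℚ hpow₀
    (Polynomial.cyclotomic.irreducible_rat (by positivity))
  have hratneg := numMaximalNeg_of_irreducible ℚ hpow
    (Polynomial.cyclotomic.irreducible_rat (by positivity)) hinvol μ hμ hμs hker
  rw [← hN₀] at hrat
  rw [← hN₁] at hratneg
  -- From `N₀ = α + N₂ + N₃ + N₄` and `N₁ = α +` the number of these maximal ideals; so that number
  -- is `N - N₀`.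
  have hNN : N = N₀ + numMaximalNeg ℚ (TriCyclic.invol (n + 2) m₂ m₃) := by omega
  refine ⟨⟨?_, ?_, ?_, ?_, ?_, ?_, ?_, ?_⟩, ?_, ?_⟩
  · rw [d.numKClasses_eq, d.numCyclicSubgroups_center,
      d.numKClassesInvolving_eq d.x_mem_coset (by decide),
      d.numKClassesInvolving_eq d.y_mem_coset (by decide),
      d.numKClassesInvolving_eq d.xy_mem_coset (by decide), hN, hN₁, hN₂, hN₃, hN₄]
  · rw [hN₁, TriCyclic.numCyclicSubgroups_eq]
  · rw [Nat.add_sub_cancel, ← TriCyclic.numCyclicSubgroups_eq, ← TriCyclic.numCyclicSubgroups_eq,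
      eq_sub_iff_add_eq', ← h10, Nat.cast_add]
  · rw [Nat.add_sub_cancel, ← TriCyclic.numCyclicSubgroups_eq, ← TriCyclic.numCyclicSubgroups_eq,
      eq_sub_iff_add_eq', ← h01, Nat.cast_add]
  · rw [Nat.add_sub_cancel, ← TriCyclic.numCyclicSubgroups_eq (n + 2) m₂ m₃, eq_sub_iff_add_eq',
      ← Nat.cast_add, h11]
    split_ifs with h
    · rw [TriCyclic.numCyclicSubgroups_eq, max_eq_left h, min_eq_right h]
    · rw [TriCyclic.numCyclicSubgroups_eq, max_eq_right (not_le.1 h).le,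
        min_eq_left (not_le.1 h).le, cyclicCount_swap]
  · rw [Nat.add_sub_cancel, hN₀, TriCyclic.numCyclicSubgroups_eq]
  · omega
  · omega
  · have := d.isSumOfFieldsAndQuaternions (K := ℚ) e hdx hdy hdt two_ne_zero
    rwa [hrat, show numMaximalNeg ℚ _ = N - N₀ by omega] at this
  · intro K _ _ hq
    have h2 := FiniteField.two_ne_zero_of_odd_card K hq
    have := d.finite
    have hquat := d.isSumOfFieldsAndQuaternions (K := K) e hdx hdy hdt h2
    have hfinite : Finite (MonoidAlgebra K G) := Module.finite_of_finite K
    have hmat := hquat.isSumOfFieldsAndMatrixRings h2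
    obtain ⟨hr, hr3⟩ := numMaximal_of_finite K hpow₀ hq
    obtain ⟨hs, hs3⟩ := numMaximalNeg_of_finite K hpow hq ht hinvol μ hμ hμs hker
    rw [← hN₀, h36] at hr hr3
    rw [← hN₁] at hs hs3
    refine ⟨d.isSemisimpleRing h2, ?_, fun h3 => ?_⟩
    · rw [hmat.numSimpleComponents_eq]
      omega
    · have := hr3 h3
      have := hs3 h3
      rw [hmat.numSimpleComponents_eq]
      refine ⟨by omega, ?_⟩
      rwa [show numMaximal K _ = 2 * N₀ - 36 by omega,
        show numMaximalNeg K _ = 2 * (N - N₀) by omega] at hmat
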